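/- Let $g,v>0$, let $B\subset\mathbb R^3$ be the closed unit ball, let $f:B\to\mathbb R^3$ be continuous, and let $\rho\in L^1(B)$ be real valued (of either sign) with $\int_B\rho\,dy=1$. Consider the magnetic charge distribution of total charge $g$ given by the image under $f$ of $g\,\rho(y)\,dy$; it is carried by the compact set $K=f(B)$. (An example is $\rho=\det(\partial f/\partial y)\big/\int_B\det(\partial f/\partial y)\,dy$ for smooth $f$ with $\int_B\det(\partial f/\partial y)\,dy\neq0$.) Let $$\varphi(x)=-g\int_B\frac{\rho(y)}{|x-f(y)|}\,dy ,\qquad \varphi_H=v+\varphi .$$ A magnetic bag of charge $g$ and vacuum value $v$ consists of a bounded connected open set $\Omega\subset\mathbb R^3$ with smooth boundary $S$ and connected exterior, together with a magnetic potential $\varphi_m$ and a Higgs field $\varphi_H$, both harmonic on a neighbourhood of $\mathbb R^3\setminus\Omega$, such that $\varphi_m|_S$ is constant, $\int_S\partial\varphi_m/\partial n\,dA=4\pi g$ ($n$ the outward unit normal), $\varphi_m\to0$ at infinity, $\varphi_H|_S=0$ and $\varphi_H\to v$ at infinity. Its mass is $\int_{\mathbb R^3\setminus\overline\Omega}\tfrac12|\nabla\varphi_m|^2\,dx+\int_{\mathbb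 R^3\setminus\overline\Omega}\tfrac12|\nabla\varphi_H|^2\,dx$. 1. The potential $\varphi$ is locally integrable, solves $\Delta\varphi=4\pi g\int_B\delta(x-f(y))\,\rho(y)\,dy$ on $\mathbb R^3$ in the sense of distributions, tends to $0$ at infinity, and is harmonic on $\mathbb R^3\setminus K$. Suppose that the level $-v$ encloses the source, i.e. $\varphi<-v$ at all points outside $K$ that are sufficiently near $K$. Put $S=\{x\notin K:\varphi(x)=-v\}$ and $\Omega=K\cup\{\varphi<-v\}$. Then $\Omega$ is open, bounded and connected, has connected exterior, and $\partial\Omega=S$. If moreover $\nabla\varphi\ne0$ at every point of $S$, then $\Omega$ with the fields $\varphi_m=\varphi$ and $\varphi_H=v+\varphi$ is a magnetic bag of charge $g$ and vacuum value $v$. Whether or not this regularity condition holds, the abelian BPS equation $\nabla\varphi=\nabla\varphi_H$ holds on $\mathbb R^3\setminus\Omega$, both energy densities are integrable on $\mathbb R^3\setminus\overline\Omega$, and $$\int_{\mathbb R^3\setminus\overline\Omega}\tfrac12|\nabla\varphi|^2\,dx=\int_{\mathbb R^3\setminus\overline\Omega}\tfrac12|\nabla\varphi_H|^2\,dx=2\pi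 gv ,$$ so the mass is $4\pi gv$, the Bogomol'nyi bound. 2. If $\rho\ge0$, then for all sufficiently small $\lambda>0$ the source given by $\lambda f$ and $\rho$ is enclosed by the level $-v$ of its own potential, and the gradient of this potential does not vanish on that level set outside the source. 3. For every $g,v>0$ there are infinitely many magnetic bags of charge $g$ and vacuum value $v$ arising as in part 1, all of mass $4\pi gv$, no two of whose surfaces are related by a similarity of $\mathbb R^3$; they can be obtained from smooth maps $f$ that are injective on $B$ with $\det(\partial f/\partial y)>0$ on $B$ and $\rho=\det(\partial f/\partial y)\big/\int_B\det(\partial f/\partial y)\,dy$. -/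

import Mathlib

open MeasureTheory Set Filter Topology
open scoped Real ContDiff

noncomputable section

/-- Physical space `ℝ³` with its Euclidean norm. -/
abbrev Space3 : Type := EuclideanSpace ℝ (Fin 3)

/-- The parameter domain of a source: the closed unit ball of `ℝ³`. -/
def unitBall3 : Set Space3 := Metric.closedBall 0 1

/-- The compact region occupied by the source: the image of the unit ball under `f`. -/
def sourceBody (f : Space3 → Space3) : Set Space3 := f '' unitBall3

/-- A normalised source: a continuous map `f` of the closed unit ball into space and an integrable
charge density `ρ` (of either sign) on the ball whose integral is one.  The magnetic charge
distribution of total charge `g` is the image under `f` of the signed measure `g ρ(y) dy`. -/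
structure IsNormalizedSource (f : Space3 → Space3) (ρ : Space3 → ℝ) : Prop where
  continuousOn : ContinuousOn f unitBall3
  integrableOn : IntegrableOn ρ unitBall3
  integral_eq_one : ∫ y in unitBall3, ρ y = 1

/-- The Jacobian density `det(∂f/∂y)`, normalised to have integral one over the ball. -/
def jacobianDensity (f : Space3 → Space3) (y : Space3) : ℝ :=
  (fderiv ℝ f y).det / ∫ z in unitBall3, (fderiv ℝ f z).det

/-- The Newtonian (magnetic scalar) potential `φ(x) = -g ∫ ρ(y) / |x - f(y)| dy` of the source. -/
def newtonianPotential (g : ℝ) (f : Space3 → Space3) (ρ : Space3 → ℝ) (x : Space3) : ℝ :=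
  -g * ∫ y in unitBall3, ρ y / ‖x - f y‖

/-- `φ` solves `Δφ = 4πg ∫ δ(x - f(y)) ρ(y) dy` on `ℝ³` in the sense of distributions and vanishes
at infinity. -/
structure SolvesSourceEquation (g : ℝ) (f : Space3 → Space3) (ρ : Space3 → ℝ)
    (φ : Space3 → ℝ) : Prop where
  locallyIntegrable : LocallyIntegrable φ
  laplace : ∀ χ : Space3 → ℝ, ContDiff ℝ ∞ χ → HasCompactSupport χ →
    ∫ x, φ x * Laplacian.laplacian χ x = 4 * π * g * ∫ y in unitBall3, ρ y * χ (f y)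
  tendsto_zero : Tendsto φ (cocompact Space3) (𝓝 0)

/-- The part of the level set `φ = -v` that lies off the source. -/
def bagSurface (v : ℝ) (K : Set Space3) (φ : Space3 → ℝ) : Set Space3 :=
  {x | x ∉ K ∧ φ x = -v}

/-- The inside of the level surface: the source together with all points where `φ < -v`. -/
def bagInterior (v : ℝ) (K : Set Space3) (φ : Space3 → ℝ) : Set Space3 :=
  K ∪ {x | φ x < -v}

/-- The source is compact enough for the level `-v` to be attained around it: `φ < -v` at all
points off the source that are close enough to the source. -/
def LevelEncloses (v : ℝ) (K : Set Space3) (φ : Space3 → ℝ) : Prop :=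
  ∀ᶠ x in 𝓝ˢ K, x ∉ K → φ x < -v

/-- The level `-v` is a regular value of `φ` off the source, so the level set is a surface with
a normal direction at each of its points. -/
def LevelRegular (v : ℝ) (K : Set Space3) (φ : Space3 → ℝ) : Prop :=
  ∀ x ∈ bagSurface v K φ, gradient φ x ≠ 0

/-- `S` bounds the region `Ω`: a nonempty bounded connected open set with boundary `S` whose
exterior is connected. -/
structure Bounds (S Ω : Set Space3) : Prop where
  isOpen : IsOpen Ω
  isBounded : Bornology.IsBounded Ω
  isConnected : IsConnected Ω
  exterior_isConnected : IsConnected (closure Ω)ᶜ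
  frontier_eq : frontier Ω = S

/-- `Ω` has smooth boundary, and `n` is its outward unit normal: near each boundary point `x`, the
set `Ω` is `{h < 0}` and its boundary is `{h = 0}` for some smooth `h` whose gradient at `x` is a
positive multiple of the unit vector `n x`. -/
def IsOutwardUnitNormal (Ω : Set Space3) (n : Space3 → Space3) : Prop :=
  ∀ x ∈ frontier Ω, ‖n x‖ = 1 ∧ ∃ (h : Space3 → ℝ) (c : ℝ),
    ContDiffAt ℝ ∞ h x ∧ 0 < c ∧ gradient h x = c • n x ∧
    (∀ᶠ y in 𝓝 x, y ∈ Ω ↔ h y < 0) ∧ (∀ᶠ y in 𝓝 x, y ∈ frontier Ω ↔ h y = 0)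

/-- A magnetic bag with charge `g` and Higgs vacuum value `v`: a region `Ω` bounded by a smooth
closed surface `S`, with magnetic scalar potential `φm` and Higgs field `φH`, both harmonic outside
`Ω` up to and including `S`, such that
* `φm` is constant on `S`, its flux through `S` is `4πg`, and it vanishes at infinity;
* `φH` vanishes on `S` and tends to `v` at infinity.
The surface integral is with respect to two-dimensional Hausdorff measure, normalised to be
area. -/
structure IsMagneticBag (g v : ℝ) (S Ω : Set Space3) (φm φH : Space3 → ℝ) : Prop where
  bounds : Bounds S Ω
  harmonic_magnetic : InnerProductSpace.HarmonicOnNhd φm Ωᶜ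
  harmonic_higgs : InnerProductSpace.HarmonicOnNhd φH Ωᶜ
  magnetic_const : ∃ c : ℝ, ∀ x ∈ S, φm x = c
  magnetic_flux : ∃ n : Space3 → Space3, IsOutwardUnitNormal Ω n ∧
    IntegrableOn (fun x => inner ℝ (gradient φm x) (n x)) S (Measure.euclideanHausdorffMeasure 2) ∧
    ∫ x in S, inner ℝ (gradient φm x) (n x) ∂(Measure.euclideanHausdorffMeasure 2) = 4 * π * g
  magnetic_infinity : Tendsto φm (cocompact Space3) (𝓝 0)
  higgs_zero : ∀ x ∈ S, φH x = 0
  higgs_infinity : Tendsto φH (cocompact Space3) (𝓝 v)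

/-- The energy density `|∇u|² / 2`. -/
def energyDensity (u : Space3 → ℝ) (x : Space3) : ℝ := ‖gradient u x‖ ^ 2 / 2

/-- The energy of the field `u` in the exterior of `Ω`. -/
def exteriorEnergy (Ω : Set Space3) (u : Space3 → ℝ) : ℝ :=
  ∫ x in (closure Ω)ᶜ, energyDensity u x

/-- The mass of a bag: magnetic energy plus Higgs energy outside it. -/
def bagMass (Ω : Set Space3) (φm φH : Space3 → ℝ) : ℝ :=
  exteriorEnergy Ω φm + exteriorEnergy Ω φH

/-- Two subsets of space have the same shape if a similarity of `ℝ³` (an isometry, possibly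
orientation reversing, combined with a change of scale) maps one onto the other. -/
def SameShape (S T : Set Space3) : Prop :=
  ∃ (r : ℝ) (e : Space3 → Space3), 0 < r ∧ (∀ x y, dist (e x) (e y) = r * dist x y) ∧ e '' S = T

end

/-! Off `K` the potential is smooth and harmonic: near such a point the kernel `1/|x|` can be
replaced by a smooth compactly supported one, and the integral differentiated. The source equation
is Fubini together with the fundamental solution of the Laplacian
(`integral_inv_norm_sub_mul_laplacian`).

The topology of the bag comes from maximum principles. A component of `Ω` missing `K`, or a bounded
component of the exterior, would have boundary values that put `φ` on the wrong side of `-v` inside.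
A point of `S` away from the closure of `Ω` would be a local minimum, so `φ` would equal `-v` on an
open set; analyticity along lines spreads this through a component of the complement of `K`, up to
`K` or out to infinity, where it fails (`not_eventually_eq_level`).

The energy must be found without integrating over `S`, which need not be smooth. For continuous `η`
vanishing outside a compact part of `(-v, 0)`, take `W'' = η` with `W = 0` near `-v` and below. Then
`W ∘ φ`, extended by zero into `Ω`, is `C²` on all of space, its Laplacian is `η(φ)|∇φ|²` outside
`Ω`, and far away it is affine in `φ` with slope `∫ η`. Green's identity against a cutoff and the
source equation give `∫ η(φ)|∇φ|² = 4πg ∫ η` (`weighted_flux`). Letting `η` increase to the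
indicator of `(s, t)` yields `4πg(t - s)` for the integral of `|∇φ|²` over `s < φ < t`
(`lintegral_slab`), and hence `4πgv` for the exterior. Since `φ` and `v + φ` have the same gradient,
the two energies agree.

On a regular level the flux is the limit of these slab integrals divided by their thickness. Charts
that linearise `φ` and distort lengths by at most a factor `L` compare slab averages with surface
integrals, up to powers of `L`; then `L → 1` (`surface_estimates`, `lintegral_surface`).

For `ρ ≥ 0` and a source in a ball of radius `M` with `2M < g/v`, comparison with a point charge
traps the level surface in a shell outside that ball and makes the radial derivative positive there.
This is the second claim.

For the third claim the sources are small multiples of one linear ellipsoidal map. As the scale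
tends to zero, the ratio of the largest to the smallest distance from the centre tends to one on the
surface. No surface is a sphere about the origin, since the exterior potential would then be that of
a point charge and the quadrupole moment would vanish (`quadrupole_eq_zero`). The ratio is a
similarity invariant of centrally symmetric surfaces, so scales chosen recursively give pairwise
different shapes. -/

/-! ### Laplacian, gradient and their chain rules. -/

open Laplacian in
theorem laplacian_eq_sum_fderiv_fderiv {E : Type*} [NormedAddCommGroup E] [InnerProductSpace ℝ E]
    [FiniteDimensional ℝ E] {ι : Type*} [Fintype ι] (b : OrthonormalBasis ι ℝ E) (f : E → ℝ)
    (x : E) : Δ f x = ∑ i, fderiv ℝ (fderiv ℝ f) x (b i) (b i) := by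
  rw [InnerProductSpace.laplacian_eq_iteratedFDeriv_orthonormalBasis f b]
  simp [iteratedFDeriv_two_apply]

theorem norm_gradient {E : Type*} [NormedAddCommGroup E] [InnerProductSpace ℝ E]
    [CompleteSpace E] (f : E → ℝ) (x : E) : ‖gradient f x‖ = ‖fderiv ℝ f x‖ := by
  rw [← toDual_gradient, LinearIsometryEquiv.norm_map]

theorem norm_gradient_sq_eq_sum {E : Type*} [NormedAddCommGroup E] [InnerProductSpace ℝ E]
    [FiniteDimensional ℝ E] {ι : Type*} [Fintype ι] (b : OrthonormalBasis ι ℝ E) (f : E → ℝ)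
    (x : E) : ‖gradient f x‖ ^ 2 = ∑ i, (fderiv ℝ f x (b i)) ^ 2 := by
  rw [← b.sum_sq_norm_inner_left (gradient f x)]
  refine Finset.sum_congr rfl fun i _ => ?_
  rw [inner_gradient_left, Real.norm_eq_abs, sq_abs]

theorem ContDiffAt.hasFDerivAt_fderiv {E F : Type*} [NormedAddCommGroup E] [NormedSpace ℝ E]
    [NormedAddCommGroup F] [NormedSpace ℝ F] {f : E → F} {x : E} (hf : ContDiffAt ℝ 2 f x) :
    HasFDerivAt (fderiv ℝ f) (fderiv ℝ (fderiv ℝ f) x) x :=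
  ((hf.fderiv_right (m := 1) (by norm_num)).differentiableAt (by norm_num)).hasFDerivAt

theorem ContDiffAt.eventually_differentiableAt {E F : Type*} [NormedAddCommGroup E]
    [NormedSpace ℝ E] [NormedAddCommGroup F] [NormedSpace ℝ F] {f : E → F} {x : E}
    (hf : ContDiffAt ℝ 2 f x) : ∀ᶠ y in 𝓝 x, DifferentiableAt ℝ f y :=
  (hf.eventually (by simp)).mono fun _ h => h.differentiableAt (by norm_num)

open Laplacian in
/-- The chain rule for the Laplacian. -/
theorem laplacian_comp {E : Type*} [NormedAddCommGroup E] [InnerProductSpace ℝ E]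
    [FiniteDimensional ℝ E] {h : ℝ → ℝ} {u : E → ℝ} {x : E}
    (hh : ContDiffAt ℝ 2 h (u x)) (hu : ContDiffAt ℝ 2 u x) :
    Δ (fun y => h (u y)) x =
      deriv (deriv h) (u x) * ‖gradient u x‖ ^ 2 + deriv h (u x) * Δ u x := by
  have e1 : fderiv ℝ (fun y => h (u y)) =ᶠ[𝓝 x] fun y => deriv h (u y) • fderiv ℝ u y := by
    filter_upwards [hu.continuousAt.eventually hh.eventually_differentiableAt,
      hu.eventually_differentiableAt] with y h1 h2
    exact (h1.hasDerivAt.comp_hasFDerivAt y h2.hasFDerivAt).fderiv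
  have hd : HasDerivAt (deriv h) (deriv (deriv h) (u x)) (u x) := by
    have : deriv h = fun s => fderiv ℝ h s 1 := by ext s; exact fderiv_apply_one_eq_deriv.symm
    rw [this]
    exact (hh.hasFDerivAt_fderiv.clm_apply
      (hasFDerivAt_const 1 (u x))).differentiableAt.hasDerivAt
  have e2 := ((hd.comp_hasFDerivAt x (hu.differentiableAt (by norm_num)).hasFDerivAt).smul
    hu.hasFDerivAt_fderiv).fderiv
  let b := stdOrthonormalBasis ℝ E
  rw [laplacian_eq_sum_fderiv_fderiv b, laplacian_eq_sum_fderiv_fderiv b,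
    norm_gradient_sq_eq_sum b, e1.fderiv_eq]
  erw [e2]
  simp only [add_apply, smul_apply, smul_eq_mul,
    ContinuousLinearMap.smulRight_apply, Finset.sum_add_distrib, Finset.mul_sum]
  rw [add_comm]
  congr 1
  refine Finset.sum_congr rfl fun i _ => ?_
  ring

open Laplacian in
theorem fderiv_norm_sub_sq {E : Type*} [NormedAddCommGroup E] [InnerProductSpace ℝ E] (a x : E) :
    fderiv ℝ (fun y => ‖y - a‖ ^ 2) x = (2 : ℝ) • innerSL ℝ (x - a) := by
  have := ((hasFDerivAt_id x).sub_const a).norm_sq.fderiv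
  simpa [two_smul] using this

open Laplacian in
theorem laplacian_norm_sub_sq {E : Type*} [NormedAddCommGroup E] [InnerProductSpace ℝ E]
    [FiniteDimensional ℝ E] (a x : E) :
    Δ (fun y : E => ‖y - a‖ ^ 2) x = 2 * Module.finrank ℝ E := by
  let b := stdOrthonormalBasis ℝ E
  have e : fderiv ℝ (fun y => ‖y - a‖ ^ 2) = fun y => (2 : ℝ) • innerSL ℝ (y - a) := by
    ext1 y; exact fderiv_norm_sub_sq a y
  have e2 : HasFDerivAt (fun y => (2 : ℝ) • innerSL ℝ (y - a)) ((2 : ℝ) • innerSL ℝ (E := E)) x := by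
    exact (((innerSL ℝ (E := E)).hasFDerivAt (x := x - a)).comp x
      ((hasFDerivAt_id x).sub_const a)).const_smul (2 : ℝ)
  rw [laplacian_eq_sum_fderiv_fderiv b, e, e2.fderiv]
  have h (v : E) : ((innerSL ℝ) v) v = ‖v‖ ^ 2 := real_inner_self_eq_norm_sq v
  simp [h, mul_comm]

theorem norm_gradient_norm_sub_sq {E : Type*} [NormedAddCommGroup E] [InnerProductSpace ℝ E]
    [CompleteSpace E] (a x : E) : ‖gradient (fun y : E => ‖y - a‖ ^ 2) x‖ = 2 * ‖x - a‖ := by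
  rw [norm_gradient, fderiv_norm_sub_sq, norm_smul, innerSL_apply_norm]; norm_num

/-! ### Integration by parts and Green's identities. -/

theorem integral_mul_fderiv_apply {u w : Space3 → ℝ} (hu : ContDiff ℝ 1 u) (hw : ContDiff ℝ 1 w)
    (hc : HasCompactSupport u ∨ HasCompactSupport w) (e : Space3) :
    ∫ x, u x * fderiv ℝ w x e = - ∫ x, fderiv ℝ u x e * w x := by
  have cu : Continuous fun x => fderiv ℝ u x e := (hu.continuous_fderiv (by norm_num)).clm_apply
    continuous_const
  have cw : Continuous fun x => fderiv ℝ w x e := (hw.continuous_fderiv (by norm_num)).clm_apply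
    continuous_const
  refine integral_mul_fderiv_eq_neg_fderiv_mul_of_integrable ?_ ?_ ?_
    (fun x _ => hu.differentiable (by norm_num) x) (fun x _ => hw.differentiable (by norm_num) x)
  · refine (cu.mul hw.continuous).integrable_of_hasCompactSupport ?_
    rcases hc with h | h
    · exact (h.fderiv_apply (𝕜 := ℝ) e).mul_right
    · exact h.mul_left
  · refine (hu.continuous.mul cw).integrable_of_hasCompactSupport ?_
    rcases hc with h | h
    · exact h.mul_right
    · exact (h.fderiv_apply (𝕜 := ℝ) e).mul_left
  · refine (hu.continuous.mul hw.continuous).integrable_of_hasCompactSupport ?_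
    rcases hc with h | h
    · exact h.mul_right
    · exact h.mul_left

theorem fderiv_fderiv_apply {u : Space3 → ℝ} (hu : ContDiff ℝ 2 u) (x e : Space3) :
    fderiv ℝ (fun y => fderiv ℝ u y e) x e = fderiv ℝ (fderiv ℝ u) x e e := by
  have h := (hu.contDiffAt (x := x)).hasFDerivAt_fderiv
  have := (h.clm_apply (hasFDerivAt_const e x)).fderiv
  rw [this]; simp

open Laplacian in
theorem continuous_laplacian {u : Space3 → ℝ} (hu : ContDiff ℝ 2 u) : Continuous (Δ u) := by
  have e : Δ u = fun x => ∑ i, fderiv ℝ (fderiv ℝ u) x (stdOrthonormalBasis ℝ Space3 i)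
      (stdOrthonormalBasis ℝ Space3 i) := by
    ext x; exact laplacian_eq_sum_fderiv_fderiv _ _ _
  have c : Continuous (fderiv ℝ (fderiv ℝ u)) :=
    (hu.fderiv_right (m := 1) (by norm_num)).continuous_fderiv (by norm_num)
  rw [e]; fun_prop

open Laplacian in
theorem HasCompactSupport.laplacian {u : Space3 → ℝ} (hu : HasCompactSupport u) :
    HasCompactSupport (Δ u) := by
  refine HasCompactSupport.intro (K := tsupport u) hu fun x hx => ?_
  have : u =ᶠ[𝓝 x] fun _ => 0 := by
    filter_upwards [(isClosed_tsupport u).isOpen_compl.mem_nhds hx] with y hy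
    exact image_eq_zero_of_notMem_tsupport hy
  have := (InnerProductSpace.laplacian_congr_nhds this).eq_of_nhds
  rw [this]; simp

open Laplacian in
/-- Green's first identity. -/
theorem integral_mul_laplacian {u w : Space3 → ℝ} (hu : ContDiff ℝ 1 u) (hw : ContDiff ℝ 2 w)
    (hc : HasCompactSupport u ∨ HasCompactSupport w) :
    ∫ x, u x * Δ w x = - ∫ x, inner ℝ (gradient u x) (gradient w x) := by
  let b := stdOrthonormalBasis ℝ Space3
  have hwe : ∀ e : Space3, ContDiff ℝ 1 fun y => fderiv ℝ w y e := fun e =>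
    (hw.fderiv_right (m := 1) (by norm_num)).clm_apply contDiff_const
  have cw : Continuous (fderiv ℝ (fderiv ℝ w)) :=
    (hw.fderiv_right (m := 1) (by norm_num)).continuous_fderiv (by norm_num)
  have cw' : Continuous (fderiv ℝ w) := hw.continuous_fderiv (by norm_num)
  have cu : Continuous (fderiv ℝ u) := hu.continuous_fderiv (by norm_num)
  have uc := hu.continuous
  have key : ∀ i, ∫ x, u x * fderiv ℝ (fderiv ℝ w) x (b i) (b i)
      = - ∫ x, fderiv ℝ u x (b i) * fderiv ℝ w x (b i) := fun i => by
    rw [← integral_mul_fderiv_apply hu (hwe (b i))]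
    · simp_rw [fderiv_fderiv_apply hw]
    · exact hc.imp id fun h => h.fderiv_apply (𝕜 := ℝ) _
  have e1 : ∀ x, u x * Δ w x = ∑ i, u x * fderiv ℝ (fderiv ℝ w) x (b i) (b i) := fun x => by
    rw [laplacian_eq_sum_fderiv_fderiv b, Finset.mul_sum]
  have e2 : ∀ x, inner ℝ (gradient u x) (gradient w x) =
      ∑ i, fderiv ℝ u x (b i) * fderiv ℝ w x (b i) := fun x => by
    rw [← b.sum_inner_mul_inner]
    simp [inner_gradient_left, inner_gradient_right]
  simp_rw [e1, e2]
  rw [integral_finsetSum, integral_finsetSum, ← Finset.sum_neg_distrib]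
  · exact Finset.sum_congr rfl fun i _ => key i
  · intro i _
    refine Continuous.integrable_of_hasCompactSupport (by fun_prop) ?_
    rcases hc with h | h
    · exact (h.fderiv_apply (𝕜 := ℝ) _).mul_right
    · exact (h.fderiv_apply (𝕜 := ℝ) _).mul_left
  · intro i _
    refine Continuous.integrable_of_hasCompactSupport (by fun_prop) ?_
    rcases hc with h | h
    · exact h.mul_right
    · refine HasCompactSupport.mul_left ?_
      exact (((h.fderiv (𝕜 := ℝ)).fderiv (𝕜 := ℝ)).comp_left
        (g := fun A : Space3 →L[ℝ] Space3 →L[ℝ] ℝ => A (b i) (b i)) (by simp))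

open Laplacian in
/-- Green's second identity. -/
theorem integral_mul_laplacian_comm {u w : Space3 → ℝ} (hu : ContDiff ℝ 2 u)
    (hw : ContDiff ℝ 2 w) (hc : HasCompactSupport u ∨ HasCompactSupport w) :
    ∫ x, u x * Δ w x = ∫ x, w x * Δ u x := by
  rw [integral_mul_laplacian (hu.of_le (by norm_num)) hw hc,
    integral_mul_laplacian (hw.of_le (by norm_num)) hu hc.symm]
  simp_rw [real_inner_comm]

/-! ### Maximum principles and the mean value property. -/

/-- On the line through `x` in direction `e`, a positive second derivative would make the point a
local minimum as well as a maximum. The restriction would then be locally constant, with second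
derivative zero. -/
theorem IsLocalMax.fderiv_fderiv_nonpos {E : Type*} [NormedAddCommGroup E] [NormedSpace ℝ E]
    {u : E → ℝ} {x : E} (hm : IsLocalMax u x) (hu : ContDiffAt ℝ 2 u x) (e : E) :
    fderiv ℝ (fderiv ℝ u) x e e ≤ 0 := by
  have hl : Tendsto (fun t : ℝ => x + t • e) (𝓝 0) (𝓝 x) := by
    have : Continuous fun t : ℝ => x + t • e := by fun_prop
    simpa using this.tendsto 0
  have hld : ∀ t : ℝ, HasDerivAt (fun t : ℝ => x + t • e) e t := fun t => by
    simpa using ((hasDerivAt_id t).smul_const e).const_add x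
  have e1 : deriv (fun t : ℝ => u (x + t • e)) =ᶠ[𝓝 0] fun t => fderiv ℝ u (x + t • e) e := by
    filter_upwards [hl.eventually hu.eventually_differentiableAt] with t ht
    exact (ht.hasFDerivAt.comp_hasDerivAt t (hld t)).deriv
  have h2 : HasFDerivAt (fderiv ℝ u) (fderiv ℝ (fderiv ℝ u) x) (x + (0 : ℝ) • e) := by
    simpa using hu.hasFDerivAt_fderiv
  have e2 : deriv (deriv fun t : ℝ => u (x + t • e)) 0 = fderiv ℝ (fderiv ℝ u) x e e := by
    rw [e1.deriv_eq]
    have h3 : HasDerivAt (fun t : ℝ => fderiv ℝ u (x + t • e)) (fderiv ℝ (fderiv ℝ u) x e) 0 :=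
      h2.comp_hasDerivAt (0 : ℝ) (hld 0)
    exact ((ContinuousLinearMap.apply ℝ ℝ e).hasFDerivAt.comp_hasDerivAt (0 : ℝ) h3).deriv
  have hmax : IsLocalMax (fun t : ℝ => u (x + t • e)) 0 := by
    have := hl.eventually hm
    simpa [IsLocalMax, IsMaxFilter] using this
  by_contra! hpos
  rw [← e2] at hpos
  have hcont : ContinuousAt (fun t : ℝ => u (x + t • e)) 0 := by
    have h : ContinuousAt u (x + (0 : ℝ) • e) := by simpa using hu.continuousAt
    exact ContinuousAt.comp (f := fun t : ℝ => x + t • e) h (by fun_prop)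
  have hmin := isLocalMin_of_deriv_deriv_pos hpos hmax.deriv_eq_zero hcont
  have hconst : (fun t : ℝ => u (x + t • e)) =ᶠ[𝓝 0] fun _ => u (x + (0 : ℝ) • e) := by
    filter_upwards [hmin, hmax] with t h1 h2 using le_antisymm h2 h1
  have := hconst.deriv.deriv_eq
  simp at this
  simp [this] at hpos

open Laplacian in
/-- The weak maximum principle for harmonic functions. -/
theorem InnerProductSpace.HarmonicOnNhd.le_of_frontier_le {U : Set Space3} {u : Space3 → ℝ} {c : ℝ}
    (hh : InnerProductSpace.HarmonicOnNhd u U) (hU : IsOpen U) (hb : Bornology.IsBounded U)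
    (hc : ContinuousOn u (closure U)) (hf : ∀ x ∈ frontier U, u x ≤ c) {x : Space3}
    (hx : x ∈ U) : u x ≤ c := by
  obtain ⟨R, hR⟩ := hb.closure.subset_closedBall (0 : Space3)
  -- Adding `ε‖y‖²` makes the Laplacian equal to `6ε > 0`, which excludes an interior maximum. The
  -- price is at most `εR²`, and `ε` is sent to zero at the end.
  have key : ∀ ε : ℝ, 0 < ε → u x ≤ c + ε * R ^ 2 := fun ε hε => by
    have hcomp : IsCompact (closure U) := hb.isCompact_closure
    obtain ⟨p, hp, hmax⟩ := hcomp.exists_isMaxOn ⟨x, subset_closure hx⟩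
      (f := fun y => u y + ε * ‖y - 0‖ ^ 2) (hc.add (by fun_prop))
    have h1 : u x + ε * ‖x - 0‖ ^ 2 ≤ u p + ε * ‖p - 0‖ ^ 2 := hmax (subset_closure hx)
    by_cases hpU : p ∈ U
    · exfalso
      have hlm : IsLocalMax (fun y => u y + ε * ‖y - 0‖ ^ 2) p := by
        filter_upwards [hU.mem_nhds hpU] with y hy using hmax (subset_closure hy)
      have hup := (hh p hpU).1
      have hq : ContDiffAt ℝ 2 (fun y : Space3 => ‖y - 0‖ ^ 2) p := by
        exact ((contDiff_id.sub contDiff_const).norm_sq ℝ).contDiffAt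
      have hl : Δ (fun y => u y + ε * ‖y - 0‖ ^ 2) p = 6 * ε := by
        have := hup.laplacian_add (hq.const_smul ε)
        have e3 : Δ (fun y : Space3 => ε • ‖y - 0‖ ^ 2) p = _ :=
          InnerProductSpace.laplacian_smul ε hq
        rw [laplacian_norm_sub_sq] at e3
        rw [e3, (hh p hpU).2.eq_of_nhds] at this
        refine (congrArg (fun f : Space3 → ℝ => (Δ f) p) ?_).trans (this.trans ?_)
        · rfl
        · simp; ring
      have hcd : ContDiffAt ℝ 2 (fun y => u y + ε * ‖y - 0‖ ^ 2) p := hup.add (hq.const_smul ε)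
      rw [laplacian_eq_sum_fderiv_fderiv (stdOrthonormalBasis ℝ Space3)] at hl
      have := Finset.sum_nonpos fun i (_ : i ∈ Finset.univ) =>
        hlm.fderiv_fderiv_nonpos hcd (stdOrthonormalBasis ℝ Space3 i)
      rw [hl] at this
      linarith
    · have hfr : p ∈ frontier U := ⟨hp, by rwa [hU.interior_eq]⟩
      have hpR : ‖p - 0‖ ≤ R := by simpa using hR hp
      have : ‖p - 0‖ ^ 2 ≤ R ^ 2 := by gcongr
      have h3 := hf p hfr
      have h4 : 0 ≤ ε * ‖x - 0‖ ^ 2 := by positivity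
      have := mul_le_mul_of_nonneg_left this hε.le
      linarith
  refine le_of_forall_pos_le_add fun δ hδ => ?_
  have := key (δ / (R ^ 2 + 1)) (by positivity)
  refine this.trans ?_
  gcongr
  rw [div_mul_eq_mul_div, div_le_iff₀ (by positivity)]
  nlinarith [sq_nonneg R]

/-- At the corner `s = 0` the cube is `O(|s|³)`, hence differentiable. The cube is what lets
`radialPrimitive` be `C¹` across the unit sphere. -/
theorem hasDerivAt_max_zero_pow_three (s : ℝ) :
    HasDerivAt (fun s : ℝ => (max 0 s) ^ 3) (3 * (max 0 s) ^ 2) s := by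
  rcases lt_trichotomy s 0 with h | h | h
  · have : (fun s : ℝ => (max 0 s) ^ 3) =ᶠ[𝓝 s] fun _ => 0 := by
      filter_upwards [Iio_mem_nhds h] with t ht
      simp [max_eq_left (le_of_lt (mem_Iio.1 ht))]
    simpa [max_eq_left h.le] using (hasDerivAt_const s (0 : ℝ)).congr_of_eventuallyEq this
  · subst h
    have : (fun s : ℝ => (max 0 s) ^ 3) =O[𝓝 0] fun s => ‖s - 0‖ ^ 3 := by
      refine Asymptotics.IsBigO.of_bound 1 (Eventually.of_forall fun t => ?_)
      rw [norm_pow, norm_pow, norm_norm, one_mul, sub_zero]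
      gcongr
      rw [Real.norm_eq_abs, Real.norm_eq_abs, abs_of_nonneg (le_max_left _ _)]
      exact max_le (abs_nonneg _) (le_abs_self _)
    have := this.hasFDerivAt (𝕜 := ℝ) (by norm_num)
    simpa using this.hasDerivAt
  · have : (fun s : ℝ => (max 0 s) ^ 3) =ᶠ[𝓝 s] fun s => s ^ 3 := by
      filter_upwards [Ioi_mem_nhds h] with t ht
      rw [max_eq_right (le_of_lt (mem_Ioi.1 ht))]
    simpa [max_eq_right h.le] using (hasDerivAt_pow 3 s).congr_of_eventuallyEq this

open Laplacian in
theorem laplacian_comp_add_smul {u : Space3 → ℝ} (hu : ContDiff ℝ 2 u) (x₀ : Space3) (r : ℝ)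
    (y : Space3) : Δ (fun z => u (x₀ + r • z)) y = r ^ 2 * Δ u (x₀ + r • y) := by
  let b := stdOrthonormalBasis ℝ Space3
  have ha : ∀ z, HasFDerivAt (fun z : Space3 => x₀ + r • z) (r • ContinuousLinearMap.id ℝ Space3) z :=
    fun z => ((hasFDerivAt_id z).const_smul r).const_add x₀
  have e1 : fderiv ℝ (fun z => u (x₀ + r • z)) = fun z => r • fderiv ℝ u (x₀ + r • z) := by
    ext1 z
    have := (((hu.differentiable (by norm_num)) (x₀ + r • z)).hasFDerivAt.comp z (ha z)).fderiv
    refine this.trans ?_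
    ext v; simp
  have e2 : HasFDerivAt (fun z => r • fderiv ℝ u (x₀ + r • z))
      (r • (fderiv ℝ (fderiv ℝ u) (x₀ + r • y)).comp (r • ContinuousLinearMap.id ℝ Space3)) y :=
    (((hu.contDiffAt (x := x₀ + r • y)).hasFDerivAt_fderiv).comp y (ha y)).const_smul r
  rw [laplacian_eq_sum_fderiv_fderiv b, laplacian_eq_sum_fderiv_fderiv b, e1, e2.fderiv,
    Finset.mul_sum]
  refine Finset.sum_congr rfl fun i _ => ?_
  simp
  ring

/-- A nonnegative radial weight supported in the closed unit ball. -/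
noncomputable def radialWeight (y : Space3) : ℝ := (max 0 (1 - ‖y - 0‖ ^ 2)) ^ 2

theorem continuous_radialWeight : Continuous radialWeight := by
  unfold radialWeight; fun_prop

theorem radialWeight_nonneg (y : Space3) : 0 ≤ radialWeight y := sq_nonneg _

theorem radialWeight_eq_zero {y : Space3} (hy : 1 ≤ ‖y‖) : radialWeight y = 0 := by
  have : 1 - ‖y - 0‖ ^ 2 ≤ 0 := by rw [sub_zero]; nlinarith
  rw [radialWeight, max_eq_left this]; norm_num

theorem radialWeight_pos {y : Space3} (hy : ‖y‖ < 1) : 0 < radialWeight y := by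
  have : 0 < 1 - ‖y - 0‖ ^ 2 := by rw [sub_zero]; nlinarith [norm_nonneg y]
  unfold radialWeight
  rw [max_eq_right this.le]; positivity

theorem hasCompactSupport_radialWeight : HasCompactSupport radialWeight := by
  refine HasCompactSupport.intro (isCompact_closedBall (0 : Space3) 1) fun y hy => ?_
  refine radialWeight_eq_zero ?_
  simp at hy; exact hy.le

/-- A potential of the vector field `radialWeight y • y`. -/
noncomputable def radialPrimitive (y : Space3) : ℝ := -(1 / 6) * (max 0 (1 - ‖y - 0‖ ^ 2)) ^ 3

theorem hasFDerivAt_radialPrimitive (y : Space3) :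
    HasFDerivAt radialPrimitive (radialWeight y • innerSL ℝ y) y := by
  have h1 : HasFDerivAt (fun y : Space3 => 1 - ‖y - 0‖ ^ 2) (-((2 : ℝ) • innerSL ℝ (y - 0))) y := by
    rw [← fderiv_norm_sub_sq]
    refine HasFDerivAt.const_sub (DifferentiableAt.hasFDerivAt ?_) 1
    exact (((contDiff_id.sub contDiff_const).norm_sq ℝ (n := 1)).differentiable (by norm_num)) y
  have h2 := ((hasDerivAt_max_zero_pow_three (1 - ‖y - 0‖ ^ 2)).comp_hasFDerivAt y h1).const_mul
    (-(1 / 6))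
  refine h2.congr_fderiv ?_
  ext v
  simp [radialWeight]
  ring

theorem contDiff_radialPrimitive : ContDiff ℝ 1 radialPrimitive := by
  rw [contDiff_one_iff_fderiv]
  refine ⟨fun y => (hasFDerivAt_radialPrimitive y).differentiableAt, ?_⟩
  have : fderiv ℝ radialPrimitive = fun y => radialWeight y • innerSL ℝ y := by
    ext1 y; exact (hasFDerivAt_radialPrimitive y).fderiv
  rw [this]
  exact continuous_radialWeight.smul (innerSL ℝ).continuous

theorem hasCompactSupport_radialPrimitive : HasCompactSupport radialPrimitive := by
  refine HasCompactSupport.intro (isCompact_closedBall (0 : Space3) 1) fun y hy => ?_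
  have hy : 1 < ‖y‖ := by simpa using hy
  have : 1 - ‖y - 0‖ ^ 2 ≤ 0 := by rw [sub_zero]; nlinarith
  rw [radialPrimitive, max_eq_left this]; norm_num

open Laplacian in
/-- The mean value property of harmonic functions, for averages with a radial weight. -/
theorem integral_radialWeight_mul_eq {u : Space3 → ℝ} (hu : ContDiff ℝ 2 u)
    (hus : HasCompactSupport u) {x₀ : Space3} {R : ℝ} (hR : 0 < R)
    (hh : ∀ x ∈ Metric.ball x₀ R, Δ u x = 0) :
    ∫ y, radialWeight y * u (x₀ + R • y) = (∫ y, radialWeight y) * u x₀ := by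
  -- `M r` is, up to normalisation, the weighted average of `u` over the ball of radius `r`; the aim
  -- is `M R = M 0`.
  let M : ℝ → ℝ := fun r => ∫ y, radialWeight y * u (x₀ + r • y)
  have hdu := hu.differentiable (by norm_num)
  have cdu : Continuous (fderiv ℝ u) := hu.continuous_fderiv (by norm_num)
  have cu := hu.continuous
  have cw := continuous_radialWeight
  obtain ⟨C, hC⟩ := (hus.fderiv (𝕜 := ℝ)).exists_bound_of_continuous cdu
  have hM : ∀ r, HasDerivAt M (∫ y, radialWeight y * fderiv ℝ u (x₀ + r • y) y) r := fun r => by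
    refine (hasDerivAt_integral_of_dominated_loc_of_deriv_le
      (F := fun r y => radialWeight y * u (x₀ + r • y))
      (F' := fun r y => radialWeight y * fderiv ℝ u (x₀ + r • y) y)
      (bound := fun y => radialWeight y * (C * ‖y‖)) univ_mem
      (Eventually.of_forall fun s => ?_) ?_ ?_ ?_ ?_ ?_).2
    · exact (by fun_prop : Continuous _).aestronglyMeasurable
    · exact (by fun_prop : Continuous _).integrable_of_hasCompactSupport
        hasCompactSupport_radialWeight.mul_right
    · exact (by fun_prop : Continuous _).aestronglyMeasurable
    · refine Eventually.of_forall fun y s _ => ?_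
      rw [norm_mul, Real.norm_of_nonneg (radialWeight_nonneg y)]
      exact mul_le_mul_of_nonneg_left (((fderiv ℝ u _).le_opNorm y).trans
        (mul_le_mul_of_nonneg_right (hC _) (norm_nonneg y))) (radialWeight_nonneg y)
    · exact (by fun_prop : Continuous _).integrable_of_hasCompactSupport
        hasCompactSupport_radialWeight.mul_right
    · refine Eventually.of_forall fun y s _ => ?_
      have h1 : HasDerivAt (fun s : ℝ => x₀ + s • y) y s := by
        simpa using ((hasDerivAt_id s).smul_const y).const_add x₀
      exact ((hdu _).hasFDerivAt.comp_hasDerivAt s h1).const_mul _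
  -- The derivative of `M` pairs `∇u` with `radialWeight y • y`, the gradient of `radialPrimitive`.
  -- Green's identity turns it into an integral of `radialPrimitive` against a Laplacian that
  -- vanishes on the unit ball.
  have hz : ∀ r ∈ Ioo 0 R, ∫ y, radialWeight y * fderiv ℝ u (x₀ + r • y) y = 0 := fun r hr => by
    have hw : ContDiff ℝ 2 fun z : Space3 => u (x₀ + r • z) := hu.comp (by fun_prop)
    have g := integral_mul_laplacian contDiff_radialPrimitive hw
      (Or.inl hasCompactSupport_radialPrimitive)
    have e1 : ∀ y, radialPrimitive y * Δ (fun z : Space3 => u (x₀ + r • z)) y = 0 := fun y => by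
      by_cases hy : ‖y‖ < 1
      · rw [laplacian_comp_add_smul hu, hh]
        · simp
        · simp [norm_smul, abs_of_pos hr.1]
          nlinarith [hr.1, hr.2, norm_nonneg y]
      · have : 1 - ‖y - 0‖ ^ 2 ≤ 0 := by rw [sub_zero]; nlinarith
        rw [radialPrimitive, max_eq_left this]; norm_num
    have e2 : ∀ y, inner ℝ (gradient radialPrimitive y)
        (gradient (fun z : Space3 => u (x₀ + r • z)) y) =
        r * (radialWeight y * fderiv ℝ u (x₀ + r • y) y) := fun y => by
      have : fderiv ℝ (fun z : Space3 => u (x₀ + r • z)) y = r • fderiv ℝ u (x₀ + r • y) := by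
        have := ((hdu (x₀ + r • y)).hasFDerivAt.comp y
          (((hasFDerivAt_id y).const_smul r).const_add x₀)).fderiv
        refine this.trans ?_
        ext v; simp
      rw [inner_gradient_left, (hasFDerivAt_radialPrimitive y).fderiv]
      simp only [smul_apply, innerSL_apply_apply, smul_eq_mul, inner_gradient_right, this]
      simp
      ring
    simp_rw [e1, e2] at g
    rw [integral_const_mul, integral_zero] at g
    have := hr.1.ne'
    simpa [this] using g.symm
  obtain ⟨r, hr, hs⟩ := exists_hasDerivAt_eq_slope M _ hR
    (fun r _ => (hM r).continuousAt.continuousWithinAt) fun r _ => hM r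
  rw [hz r hr, eq_comm, div_eq_zero_iff] at hs
  have h0 : M 0 = (∫ y, radialWeight y) * u x₀ := by
    simp only [M, zero_smul, add_zero, integral_mul_const]
  rcases hs with h | h
  · rw [← h0]; exact sub_eq_zero.1 h
  · linarith

/-- The integral identities above need globally defined, compactly supported functions; a bump
function makes them available for a germ. -/
theorem exists_contDiff_hasCompactSupport_eventuallyEq {u : Space3 → ℝ} {x₀ : Space3}
    (hu : ContDiffAt ℝ 2 u x₀) :
    ∃ w : Space3 → ℝ, ContDiff ℝ 2 w ∧ HasCompactSupport w ∧ w =ᶠ[𝓝 x₀] u := by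
  obtain ⟨R, hR, hRu⟩ := Metric.eventually_nhds_iff_ball.1 (hu.eventually (by simp))
  let b : ContDiffBump x₀ := ⟨R / 4, R / 2, by positivity, by linarith⟩
  refine ⟨fun x => b x * u x, contDiff_iff_contDiffAt.2 fun x => ?_, b.hasCompactSupport.mul_right,
    ?_⟩
  · by_cases hx : x ∈ tsupport b
    · rw [b.tsupport_eq] at hx
      refine b.contDiff.contDiffAt.mul (hRu x ?_)
      exact Metric.closedBall_subset_ball (by change R / 2 < R; linarith) hx
    · have : (fun x => b x * u x) =ᶠ[𝓝 x] fun _ => 0 := by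
        filter_upwards [(isClosed_tsupport b).isOpen_compl.mem_nhds hx] with y hy
        rw [image_eq_zero_of_notMem_tsupport hy, zero_mul]
      exact contDiffAt_const.congr_of_eventuallyEq this
  · filter_upwards [b.eventuallyEq_one] with y hy
    simp [hy]

open Laplacian in
/-- The strong minimum principle: a harmonic function is constant near a local minimum. -/
theorem InnerProductSpace.HarmonicAt.eventuallyEq_of_isLocalMin {u : Space3 → ℝ} {x₀ : Space3}
    (hu : InnerProductSpace.HarmonicAt u x₀) (hm : IsLocalMin u x₀) :
    ∀ᶠ x in 𝓝 x₀, u x = u x₀ := by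
  obtain ⟨w, hw, hws, hwu⟩ := exists_contDiff_hasCompactSupport_eventuallyEq hu.1
  have h0 : w x₀ = u x₀ := hwu.eq_of_nhds
  have hΔ : ∀ᶠ x in 𝓝 x₀, Δ w x = 0 :=
    (InnerProductSpace.laplacian_congr_nhds hwu).trans hu.2
  obtain ⟨R, hR, hb⟩ := Metric.eventually_nhds_iff_ball.1 (hΔ.and (hm.and hwu))
  have hmean := integral_radialWeight_mul_eq hw hws (half_pos hR) (x₀ := x₀) fun x hx =>
    (hb x (Metric.ball_subset_ball (by linarith) hx)).1
  have cw := hw.continuous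
  have crw := continuous_radialWeight
  have hmem : ∀ y : Space3, ‖y‖ ≤ 1 → x₀ + (R / 2) • y ∈ Metric.ball x₀ R := fun y hy => by
    simp [norm_smul, abs_of_pos hR]
    nlinarith
  have hint : Integrable fun y => radialWeight y * w (x₀ + (R / 2) • y) :=
    (by fun_prop : Continuous _).integrable_of_hasCompactSupport
      hasCompactSupport_radialWeight.mul_right
  have hint2 : Integrable fun y => radialWeight y * w x₀ :=
    (by fun_prop : Continuous _).integrable_of_hasCompactSupport
      hasCompactSupport_radialWeight.mul_right
  -- Near a minimum the integrand is continuous and nonnegative, so its zero integral forces `w = w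
  -- x₀` wherever the weight is positive.
  have hzero : ∫ y, radialWeight y * (w (x₀ + (R / 2) • y) - w x₀) = 0 := by
    simp_rw [mul_sub]
    rw [integral_sub hint hint2, hmean, integral_mul_const, sub_self]
  have hcont : Continuous fun y => radialWeight y * (w (x₀ + (R / 2) • y) - w x₀) := by fun_prop
  have hnn : 0 ≤ fun y => radialWeight y * (w (x₀ + (R / 2) • y) - w x₀) := fun y => by
    by_cases hy : 1 ≤ ‖y‖
    · simp [radialWeight_eq_zero hy]
    · have := hb _ (hmem y (not_le.1 hy).le)
      refine mul_nonneg (radialWeight_nonneg y) ?_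
      rw [h0, this.2.2]
      exact sub_nonneg.2 this.2.1
  have hall : (fun y => radialWeight y * (w (x₀ + (R / 2) • y) - w x₀)) = 0 := by
    have := (integral_eq_zero_iff_of_nonneg hnn ((hint.sub hint2).congr
      (Eventually.of_forall fun y => (mul_sub _ _ _).symm))).1 hzero
    exact (Continuous.ae_eq_iff_eq volume hcont continuous_const).1 this
  filter_upwards [Metric.ball_mem_nhds x₀ (half_pos hR)] with x hx
  have hx' : ‖(2 / R) • (x - x₀)‖ < 1 := by
    rw [norm_smul, Real.norm_of_nonneg (by positivity), ← dist_eq_norm]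
    rw [Metric.mem_ball] at hx
    rw [div_mul_eq_mul_div, div_lt_one hR]; linarith
  have hxe : x₀ + (R / 2) • (2 / R) • (x - x₀) = x := by
    rw [smul_smul, div_mul_div_cancel₀ (by norm_num), div_self hR.ne']
    simp
  have h1 := congrFun hall ((2 / R) • (x - x₀))
  simp only [hxe, Pi.zero_apply, mul_eq_zero, (radialWeight_pos hx').ne', false_or] at h1
  rw [← h0, ← (hb x (Metric.ball_subset_ball (by linarith) hx)).2.2]
  linarith

/-! ### The Newtonian kernel as fundamental solution. -/

theorem finrank_space3 : Module.finrank ℝ Space3 = 3 := by simp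

theorem volume_real_ball_space3 : volume.real (Metric.ball (0 : Space3) 1) = 4 * π / 3 := by
  rw [Measure.real, EuclideanSpace.volume_ball_fin_three]
  simp only [ENNReal.ofReal_one, one_pow, one_mul]
  rw [ENNReal.toReal_ofReal (by positivity)]; ring

theorem norm_inv_eq_rpow {E : Type*} [NormedAddCommGroup E] (x : E) :
    ‖x‖⁻¹ = (‖x‖ ^ 2) ^ (-(1 / 2) : ℝ) := by
  rw [← Real.rpow_natCast, ← Real.rpow_mul (norm_nonneg x), ← Real.rpow_neg_one]; norm_num

-- The parameter serves twice: `δ = 0` gives harmonicity of `1/|x - a|` off its pole, while `δ = ε²`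
-- produces a rescaled bump concentrating at `a`.
open Laplacian in
theorem laplacian_regularized_kernel (a x : Space3) {δ : ℝ}
    (h : 0 < ‖x - a‖ ^ 2 + δ) :
    Δ (fun y => (‖y - a‖ ^ 2 + δ) ^ (-(1 / 2) : ℝ)) x =
      -3 * δ * (‖x - a‖ ^ 2 + δ) ^ (-(5 / 2) : ℝ) := by
  have hq : ContDiffAt ℝ 2 (fun y : Space3 => ‖y - a‖ ^ 2) x :=
    ((contDiff_id.sub contDiff_const).norm_sq ℝ).contDiffAt
  have hh : ContDiffAt ℝ 2 (fun s : ℝ => (s + δ) ^ (-(1 / 2) : ℝ)) (‖x - a‖ ^ 2) :=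
    ContDiffAt.rpow_const_of_ne (by fun_prop) h.ne'
  have d1 : deriv (fun s : ℝ => (s + δ) ^ (-(1 / 2) : ℝ)) =
      fun s => -(1 / 2) * (s + δ) ^ (-(1 / 2) - 1 : ℝ) := by
    ext s
    rw [deriv_comp_add_const (f := fun s : ℝ => s ^ (-(1 / 2) : ℝ)), Real.deriv_rpow_const]
  have d2 : deriv (fun s : ℝ => -(1 / 2) * (s + δ) ^ (-(1 / 2) - 1 : ℝ)) (‖x - a‖ ^ 2) =
      -(1 / 2) * ((-(1 / 2) - 1) * (‖x - a‖ ^ 2 + δ) ^ (-(1 / 2) - 1 - 1 : ℝ)) := by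
    rw [deriv_const_mul_field,
      deriv_comp_add_const (f := fun s : ℝ => s ^ (-(1 / 2) - 1 : ℝ)), Real.deriv_rpow_const]
  rw [laplacian_comp (h := fun s : ℝ => (s + δ) ^ (-(1 / 2) : ℝ))
    (u := fun y : Space3 => ‖y - a‖ ^ 2) hh hq, d1, d2,
    norm_gradient_norm_sub_sq, laplacian_norm_sub_sq, finrank_space3]
  have e1 : (-(1 / 2) - 1 - 1 : ℝ) = -(5 / 2) := by norm_num
  have e2 : (-(1 / 2) - 1 : ℝ) = -(5 / 2) + 1 := by norm_num
  rw [e1, e2]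
  beta_reduce
  rw [Real.rpow_add h, Real.rpow_one]
  push_cast
  ring

theorem harmonicAt_inv_norm {x : Space3} (hx : x ≠ 0) :
    InnerProductSpace.HarmonicAt (fun y : Space3 => ‖y‖⁻¹) x := by
  have e : (fun y : Space3 => ‖y‖⁻¹) = fun y => (‖y - 0‖ ^ 2 + 0) ^ (-(1 / 2) : ℝ) := by
    ext y; rw [norm_inv_eq_rpow]; simp
  refine ⟨(contDiffAt_norm ℝ hx).inv (norm_ne_zero_iff.2 hx), ?_⟩
  filter_upwards [isOpen_ne.mem_nhds hx] with y hy
  have := norm_pos_iff.2 hy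
  rw [e, laplacian_regularized_kernel 0 y (by simpa using by positivity)]
  simp

theorem integral_regularized_delta :
    ∫ y : Space3, 3 * (‖y‖ ^ 2 + 1) ^ (-(5 / 2) : ℝ) = 4 * π := by
  have h1 : ∫ y in Ioi (0 : ℝ), y ^ 2 • (3 * (y ^ 2 + 1) ^ (-(5 / 2) : ℝ)) = 1 := by
    have hpos : ∀ y : ℝ, 0 < y ^ 2 + 1 := fun y => by positivity
    -- The radial integrand has the explicit primitive `y³(y² + 1)^(-3/2)`, which rises from `0` to
    -- `1`.
    have hd : ∀ y : ℝ, HasDerivAt (fun y : ℝ => y ^ 3 * (y ^ 2 + 1) ^ (-(3 / 2) : ℝ))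
        (y ^ 2 • (3 * (y ^ 2 + 1) ^ (-(5 / 2) : ℝ))) y := fun y => by
      have a1 : HasDerivAt (fun y : ℝ => y ^ 2 + 1) (2 * y) y := by
        simpa using (hasDerivAt_pow 2 y).add_const 1
      have a2 := a1.rpow_const (p := (-(3 / 2) : ℝ)) (Or.inl (hpos y).ne')
      have a3 := (hasDerivAt_pow 3 y).mul a2
      refine a3.congr_deriv ?_
      have e1 : (-(3 / 2) - 1 : ℝ) = -(5 / 2) := by norm_num
      have e2 : (-(3 / 2) : ℝ) = -(5 / 2) + 1 := by norm_num
      rw [e1, e2, Real.rpow_add (hpos y), Real.rpow_one]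
      simp only [smul_eq_mul]
      push_cast
      ring
    rw [integral_Ioi_of_hasDerivAt_of_nonneg (l := 1) (hd 0).continuousAt.continuousWithinAt
      (fun y _ => hd y) (fun y _ => by positivity)]
    · simp
    · have t1 : Tendsto (fun y : ℝ => (1 + (y⁻¹) ^ 2) ^ (-(3 / 2) : ℝ)) atTop (𝓝 1) := by
        have : Tendsto (fun y : ℝ => 1 + (y⁻¹) ^ 2) atTop (𝓝 (1 + 0 ^ 2)) :=
          (tendsto_inv_atTop_zero.pow 2).const_add 1
        simpa using this.rpow_const (p := (-(3 / 2) : ℝ)) (by norm_num)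
      refine t1.congr' ?_
      filter_upwards [eventually_gt_atTop 0] with y hy
      have e : y ^ 3 = (y ^ 2) ^ (3 / 2 : ℝ) := by
        rw [← Real.rpow_natCast, ← Real.rpow_natCast, ← Real.rpow_mul hy.le]; norm_num
      have e2 : y ^ 2 + 1 = y ^ 2 * (1 + (y⁻¹) ^ 2) := by field_simp
      rw [e, e2, Real.mul_rpow (by positivity) (by positivity), ← mul_assoc,
        ← Real.rpow_add (by positivity)]
      simp
  have := integral_fun_norm_addHaar (volume : Measure Space3)
    (fun r : ℝ => 3 * (r ^ 2 + 1) ^ (-(5 / 2) : ℝ))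
  rw [this, finrank_space3, volume_real_ball_space3, h1]
  simp only [nsmul_eq_mul, smul_eq_mul]
  push_cast
  ring

theorem integrable_regularized_delta :
    Integrable fun y : Space3 => 3 * (‖y‖ ^ 2 + 1) ^ (-(5 / 2) : ℝ) := by
  have := integrable_rpow_neg_one_add_norm_sq (E := Space3) (μ := volume) (r := 5)
    (by rw [finrank_space3]; norm_num)
  refine (this.const_mul 3).congr (Eventually.of_forall fun y => ?_)
  simp only
  rw [add_comm]; norm_num

theorem integrableOn_inv_norm_ball : IntegrableOn (fun x : Space3 => ‖x‖⁻¹) (Metric.ball 0 1) := by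
  rw [integrableOn_fun_norm_addHaar volume (f := fun r : ℝ => r⁻¹)]
  have : IntegrableOn (fun y : ℝ => y) (Ioo 0 1) :=
    (continuous_id.integrableOn_Icc (a := (0 : ℝ)) (b := 1)).mono_set Ioo_subset_Icc_self
  refine this.congr_fun (fun y hy => ?_) measurableSet_Ioo
  have := hy.1.ne'
  simp only [finrank_space3, smul_eq_mul]
  field_simp

/-- The Newtonian kernel is integrable on sets of finite measure, uniformly in its pole. -/
theorem exists_lintegral_inv_norm_sub_le {T : Set Space3} (hT : volume T < ⊤) :
    ∃ C : ENNReal, C < ⊤ ∧ ∀ a : Space3, ∫⁻ x in T, ‖‖x - a‖⁻¹‖ₑ ≤ C := by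
  refine ⟨(∫⁻ x in Metric.ball (0 : Space3) 1, ‖‖x‖⁻¹‖ₑ) + volume T,
    ENNReal.add_lt_top.2 ⟨integrableOn_inv_norm_ball.2, hT⟩, fun a => ?_⟩
  have hb : ∫⁻ x in Metric.ball a 1, ‖‖x - a‖⁻¹‖ₑ = ∫⁻ x in Metric.ball (0 : Space3) 1, ‖‖x‖⁻¹‖ₑ := by
    have := (measurePreserving_sub_right (volume : Measure Space3) a).setLIntegral_comp_preimage
      (s := Metric.ball (0 : Space3) 1) measurableSet_ball (f := fun x => ‖‖x‖⁻¹‖ₑ) (by fun_prop)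
    rw [← this]
    congr 2
    ext x; simp [dist_eq_norm]
  -- Inside the unit ball about the pole, translation reduces to the pole at the origin; outside it
  -- the kernel is at most one.
  calc ∫⁻ x in T, ‖‖x - a‖⁻¹‖ₑ
      ≤ ∫⁻ x in T, ((Metric.ball a 1).indicator (fun x => ‖‖x - a‖⁻¹‖ₑ) x + 1) := by
        refine lintegral_mono fun x => ?_
        by_cases hx : x ∈ Metric.ball a 1
        · simp [hx]
        · have h1 : 1 ≤ ‖x - a‖ := by simpa [dist_eq_norm] using hx
          have : ‖‖x - a‖⁻¹‖ₑ ≤ 1 := by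
            rw [Real.enorm_of_nonneg (by positivity)]
            exact ENNReal.ofReal_le_one.2 (inv_le_one_of_one_le₀ h1)
          simpa [hx] using this
    _ = (∫⁻ x in T, (Metric.ball a 1).indicator (fun x => ‖‖x - a‖⁻¹‖ₑ) x) + volume T := by
        rw [lintegral_add_right _ measurable_const]; simp
    _ ≤ _ := by
        refine add_le_add_left ?_ _
        rw [← hb, ← lintegral_indicator measurableSet_ball]
        exact setLIntegral_le_lintegral _ _

theorem integrableOn_inv_norm_sub {T : Set Space3} (hT : volume T < ⊤) (a : Space3) :
    IntegrableOn (fun x => ‖x - a‖⁻¹) T := by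
  obtain ⟨C, hC, h⟩ := exists_lintegral_inv_norm_sub_le hT
  exact ⟨(by fun_prop : Measurable fun x : Space3 => ‖x - a‖⁻¹).aestronglyMeasurable,
    (h a).trans_lt hC⟩

theorem integrable_inv_norm_sub_mul {w : Space3 → ℝ} (hw : Continuous w) (hs : HasCompactSupport w)
    (a : Space3) : Integrable fun x => ‖x - a‖⁻¹ * w x := by
  obtain ⟨C, hC⟩ := hs.exists_bound_of_continuous hw
  have h1 : IntegrableOn (fun x => w x * ‖x - a‖⁻¹) (tsupport w) :=
    (integrableOn_inv_norm_sub hs.measure_lt_top a).bdd_mul hw.aestronglyMeasurable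
      (Eventually.of_forall hC)
  rw [integrableOn_iff_integrable_of_support_subset] at h1
  · exact h1.congr (Eventually.of_forall fun x => mul_comm _ _)
  · exact fun x hx => subset_tsupport w (left_ne_zero_of_mul hx)

open Laplacian in
/-- `-1 / (4π|x - a|)` is the fundamental solution of the Laplace equation in space. -/
theorem integral_inv_norm_sub_mul_laplacian {χ : Space3 → ℝ} (hχ : ContDiff ℝ 2 χ)
    (hs : HasCompactSupport χ) (a : Space3) :
    ∫ x, ‖x - a‖⁻¹ * Δ χ x = -4 * π * χ a := by
  have cΔ := continuous_laplacian hχ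
  have hsΔ := hs.laplacian
  have hne : ∀ᵐ x : Space3, x ≠ a := by
    simp [ae_iff]
  -- The regularised kernel increases to `1/|x - a|` as `ε` decreases, so the singular integrand
  -- itself dominates.
  have lim1 : Tendsto (fun ε : ℝ => ∫ x, (‖x - a‖ ^ 2 + ε ^ 2) ^ (-(1 / 2) : ℝ) * Δ χ x) (𝓝[>] 0)
      (𝓝 (∫ x, ‖x - a‖⁻¹ * Δ χ x)) := by
    refine tendsto_integral_filter_of_dominated_convergence (fun x => ‖‖x - a‖⁻¹ * Δ χ x‖)
      ?_ ?_ (integrable_inv_norm_sub_mul cΔ hsΔ a).norm ?_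
    · refine Eventually.of_forall fun ε => ?_
      exact ((by fun_prop : Measurable fun x : Space3 => (‖x - a‖ ^ 2 + ε ^ 2) ^ (-(1 / 2) : ℝ)).mul
        cΔ.measurable).aestronglyMeasurable
    · refine Eventually.of_forall fun ε => ?_
      filter_upwards [hne] with x hx
      rw [norm_mul, norm_mul]
      gcongr
      have hx' := norm_pos_iff.2 (sub_ne_zero.2 hx)
      rw [norm_inv_eq_rpow, Real.norm_of_nonneg (by positivity), Real.norm_of_nonneg (by positivity)]
      exact Real.rpow_le_rpow_of_nonpos (by positivity) (by nlinarith) (by norm_num)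
    · filter_upwards [hne] with x hx
      have hx' := norm_pos_iff.2 (sub_ne_zero.2 hx)
      rw [norm_inv_eq_rpow]
      refine Tendsto.mul_const _ ?_
      have : Tendsto (fun ε : ℝ => ‖x - a‖ ^ 2 + ε ^ 2) (𝓝[>] 0) (𝓝 (‖x - a‖ ^ 2)) := by
        have : Continuous fun ε : ℝ => ‖x - a‖ ^ 2 + ε ^ 2 := by fun_prop
        simpa using (this.tendsto 0).mono_left nhdsWithin_le_nhds
      exact this.rpow_const (Or.inl (by positivity))
  have lim2 : Tendsto (fun ε : ℝ => ∫ y : Space3, (3 * (‖y‖ ^ 2 + 1) ^ (-(5 / 2) : ℝ)) *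
      χ (a + ε • y)) (𝓝[>] 0) (𝓝 (∫ y : Space3, (3 * (‖y‖ ^ 2 + 1) ^ (-(5 / 2) : ℝ)) * χ a)) := by
    obtain ⟨C, hC⟩ := hs.exists_bound_of_continuous hχ.continuous
    have cχ := hχ.continuous
    refine tendsto_integral_filter_of_dominated_convergence
      (fun y => (3 * (‖y‖ ^ 2 + 1) ^ (-(5 / 2) : ℝ)) * C) ?_ ?_
      (integrable_regularized_delta.mul_const C) ?_
    · refine Eventually.of_forall fun ε => ?_
      exact integrable_regularized_delta.aestronglyMeasurable.mul
        (by fun_prop : Continuous _).aestronglyMeasurable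
    · refine Eventually.of_forall fun ε => Eventually.of_forall fun y => ?_
      rw [norm_mul, Real.norm_of_nonneg (by positivity)]
      gcongr
      exact hC _
    · refine Eventually.of_forall fun y => Tendsto.const_mul _ ?_
      have : Continuous fun ε : ℝ => χ (a + ε • y) := by fun_prop
      simpa using (this.tendsto 0).mono_left nhdsWithin_le_nhds
  rw [integral_mul_const, integral_regularized_delta] at lim2
  -- After Green's identity the substitution `x = a + εy` contributes `ε³`, which cancels `ε²` from
  -- the Laplacian and `ε⁻⁵` from the power.
  have heq : ∀ ε : ℝ, 0 < ε → ∫ x, (‖x - a‖ ^ 2 + ε ^ 2) ^ (-(1 / 2) : ℝ) * Δ χ x =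
      -∫ y : Space3, (3 * (‖y‖ ^ 2 + 1) ^ (-(5 / 2) : ℝ)) * χ (a + ε • y) := fun ε hε => by
    have hpos : ∀ x : Space3, 0 < ‖x - a‖ ^ 2 + ε ^ 2 := fun x => by positivity
    have hN : ContDiff ℝ 2 fun x : Space3 => (‖x - a‖ ^ 2 + ε ^ 2) ^ (-(1 / 2) : ℝ) :=
      (((contDiff_id.sub contDiff_const).norm_sq ℝ).add contDiff_const).rpow_const_of_ne
        fun x => (hpos x).ne'
    rw [integral_mul_laplacian_comm hN hχ (Or.inr hs)]
    simp_rw [laplacian_regularized_kernel a _ (hpos _)]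
    rw [← integral_add_left_eq_self _ a]
    have := Measure.integral_comp_smul (volume : Measure Space3) (fun y => χ (a + y) *
      (-3 * ε ^ 2 * (‖a + y - a‖ ^ 2 + ε ^ 2) ^ (-(5 / 2) : ℝ))) ε
    rw [finrank_space3, abs_of_pos (by positivity), smul_eq_mul, eq_comm,
      inv_mul_eq_iff_eq_mul₀ (by positivity), ← integral_const_mul] at this
    rw [this, ← integral_neg]
    congr 1
    ext y
    have e : ‖a + ε • y - a‖ ^ 2 + ε ^ 2 = ε ^ 2 * (‖y‖ ^ 2 + 1) := by
      rw [add_sub_cancel_left, norm_smul, Real.norm_of_nonneg hε.le]; ring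
    have e2 : (ε ^ 2) ^ (-(5 / 2) : ℝ) * ε ^ 5 = 1 := by
      rw [← Real.rpow_natCast, ← Real.rpow_natCast, ← Real.rpow_mul hε.le, ← Real.rpow_add hε]
      norm_num
    rw [e, Real.mul_rpow (by positivity) (by positivity)]
    linear_combination (-3 * χ (a + ε • y) * (‖y‖ ^ 2 + 1) ^ (-(5 / 2) : ℝ)) * e2
  have lim3 := (lim1.congr' (by filter_upwards [self_mem_nhdsWithin] with ε hε using heq ε hε))
  have := tendsto_nhds_unique lim3 lim2.neg
  rw [this]; ring

/-! ### Sources and differentiation of smeared kernels. -/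

theorem isCompact_unitBall3 : IsCompact unitBall3 := isCompact_closedBall 0 1

theorem measurableSet_unitBall3 : MeasurableSet unitBall3 := isCompact_unitBall3.measurableSet

theorem nonempty_unitBall3 : unitBall3.Nonempty := ⟨0, by simp [unitBall3]⟩

theorem IsNormalizedSource.isCompact_sourceBody {f : Space3 → Space3} {ρ : Space3 → ℝ}
    (h : IsNormalizedSource f ρ) : IsCompact (sourceBody f) :=
  isCompact_unitBall3.image_of_continuousOn h.continuousOn

theorem nonempty_sourceBody (f : Space3 → Space3) : (sourceBody f).Nonempty :=
  nonempty_unitBall3.image f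

theorem IsNormalizedSource.aestronglyMeasurable {f : Space3 → Space3} {ρ : Space3 → ℝ}
    (h : IsNormalizedSource f ρ) : AEStronglyMeasurable f (volume.restrict unitBall3) :=
  h.continuousOn.aestronglyMeasurable measurableSet_unitBall3

/-- The field of a source with interaction kernel `k`. -/
noncomputable def smear (f : Space3 → Space3) (ρ : Space3 → ℝ) {F : Type} [NormedAddCommGroup F]
    [NormedSpace ℝ F] (k : Space3 → F) (x : Space3) : F :=
  ∫ y in unitBall3, ρ y • k (x - f y)

section smear

variable {f : Space3 → Space3} {ρ : Space3 → ℝ} {F : Type} [NormedAddCommGroup F] [NormedSpace ℝ F]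
  {k : Space3 → F}

theorem IsNormalizedSource.integrable_smul_comp (h : IsNormalizedSource f ρ) {w : Space3 → F}
    (hw : Continuous w) (hs : HasCompactSupport w) (x : Space3) :
    Integrable (fun y => ρ y • w (x - f y)) (volume.restrict unitBall3) := by
  obtain ⟨C, hC⟩ := hs.exists_bound_of_continuous hw
  refine h.integrableOn.smul_bdd (C := C) ?_ (Eventually.of_forall fun y => hC _)
  exact hw.comp_aestronglyMeasurable (aestronglyMeasurable_const.sub h.aestronglyMeasurable)

theorem IsNormalizedSource.hasFDerivAt_smear (h : IsNormalizedSource f ρ) (hk : ContDiff ℝ 1 k)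
    (hs : HasCompactSupport k) (x : Space3) :
    HasFDerivAt (smear f ρ k) (smear f ρ (fderiv ℝ k) x) x := by
  have ck' := hk.continuous_fderiv (by norm_num)
  obtain ⟨C, hC⟩ := (hs.fderiv (𝕜 := ℝ)).exists_bound_of_continuous ck'
  refine hasFDerivAt_integral_of_dominated_of_fderiv_le (bound := fun y => ‖ρ y‖ * C)
    (F' := fun z y => ρ y • fderiv ℝ k (z - f y)) univ_mem
    (Eventually.of_forall fun z => (h.integrable_smul_comp hk.continuous hs z).1)
    (h.integrable_smul_comp hk.continuous hs x)
    (h.integrable_smul_comp ck' (hs.fderiv (𝕜 := ℝ)) x).1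
    (Eventually.of_forall fun y z _ => ?_) (h.integrableOn.norm.mul_const C)
    (Eventually.of_forall fun y z _ => ?_)
  · rw [norm_smul]; exact mul_le_mul_of_nonneg_left (hC _) (norm_nonneg _)
  · have := ((hk.differentiable (by norm_num)) (z - f y)).hasFDerivAt.comp z
      ((hasFDerivAt_id z).sub_const (f y))
    exact this.const_smul (ρ y)

/-- The target space is quantified inside the induction because differentiating the kernel changes
its codomain. -/
theorem IsNormalizedSource.contDiff_smear_nat (h : IsNormalizedSource f ρ) (n : ℕ) :
    ∀ (F : Type) [NormedAddCommGroup F] [NormedSpace ℝ F] (k : Space3 → F), ContDiff ℝ ∞ k →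
      HasCompactSupport k → ContDiff ℝ n (smear f ρ k) := by
  induction n with
  | zero =>
    intro F _ _ k hk hs
    exact contDiff_zero.2 (continuous_iff_continuousAt.2 fun x =>
      (h.hasFDerivAt_smear (hk.of_le (by norm_num)) hs x).continuousAt)
  | succ n ih =>
    intro F _ _ k hk hs
    have hd := h.hasFDerivAt_smear (hk.of_le (by norm_num)) hs
    have e : fderiv ℝ (smear f ρ k) = smear f ρ (fderiv ℝ k) := by ext1 x; exact (hd x).fderiv
    push_cast
    refine contDiff_succ_iff_fderiv.2 ⟨fun x => (hd x).differentiableAt, by simp, ?_⟩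
    rw [e]
    exact ih _ _ (hk.fderiv_right (m := ∞) (by norm_num)) (hs.fderiv (𝕜 := ℝ))

theorem IsNormalizedSource.contDiff_smear (h : IsNormalizedSource f ρ) (hk : ContDiff ℝ ∞ k)
    (hs : HasCompactSupport k) : ContDiff ℝ ∞ (smear f ρ k) :=
  contDiff_infty.2 fun n => h.contDiff_smear_nat n F k hk hs

theorem IsNormalizedSource.fderiv_smear_apply (h : IsNormalizedSource f ρ) {k : Space3 → ℝ}
    (hk : ContDiff ℝ 1 k) (hs : HasCompactSupport k) (x e : Space3) :
    fderiv ℝ (smear f ρ k) x e = smear f ρ (fun w => fderiv ℝ k w e) x := by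
  rw [(h.hasFDerivAt_smear hk hs x).fderiv, smear,
    ContinuousLinearMap.integral_apply (h.integrable_smul_comp
      (hk.continuous_fderiv (by norm_num)) (hs.fderiv (𝕜 := ℝ)) x)]
  rfl

open Laplacian in
theorem IsNormalizedSource.laplacian_smear (h : IsNormalizedSource f ρ) {k : Space3 → ℝ}
    (hk : ContDiff ℝ ∞ k) (hs : HasCompactSupport k) (x : Space3) :
    Δ (smear f ρ k) x = smear f ρ (Δ k) x := by
  let b := stdOrthonormalBasis ℝ Space3
  have hk1 : ContDiff ℝ 1 k := hk.of_le (by norm_num)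
  have hk2 : ContDiff ℝ 2 k := hk.of_le (by norm_cast)
  have hke : ∀ e, ContDiff ℝ 1 fun w => fderiv ℝ k w e := fun e =>
    (hk2.fderiv_right (m := 1) (by norm_num)).clm_apply contDiff_const
  have hse : ∀ e, HasCompactSupport fun w => fderiv ℝ k w e := fun e => hs.fderiv_apply (𝕜 := ℝ) e
  have e1 : ∀ e, (fun z => fderiv ℝ (smear f ρ k) z e) = smear f ρ fun w => fderiv ℝ k w e :=
    fun e => by ext z; exact h.fderiv_smear_apply hk1 hs z e
  rw [laplacian_eq_sum_fderiv_fderiv b]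
  simp_rw [← fderiv_fderiv_apply ((h.contDiff_smear hk hs).of_le (by norm_cast : (2 : ℕ∞ω) ≤ ∞)), e1,
    h.fderiv_smear_apply (hke _) (hse _)]
  unfold smear
  rw [← integral_finsetSum _ fun i _ => h.integrable_smul_comp
    (((hke _).continuous_fderiv (by norm_num)).clm_apply continuous_const)
    ((hse _).fderiv_apply (𝕜 := ℝ) _) x]
  congr 1
  ext y
  rw [laplacian_eq_sum_fderiv_fderiv b, ← Finset.smul_sum]
  simp_rw [fderiv_fderiv_apply hk2]

end smear

/-- A smooth compactly supported kernel that agrees with the Newtonian kernel on a shell. -/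
theorem exists_newtonian_cutoff {r R : ℝ} (hr : 0 < r) (hrR : r < R) :
    ∃ k : Space3 → ℝ, ContDiff ℝ ∞ k ∧ HasCompactSupport k ∧
      ∀ w : Space3, r < ‖w‖ → ‖w‖ < R → k =ᶠ[𝓝 w] fun w => ‖w‖⁻¹ := by
  let b : ContDiffBump (0 : Space3) := ⟨r / 2, r, by positivity, by linarith⟩
  let c : ContDiffBump (0 : Space3) := ⟨R, R + 1, by linarith, by linarith⟩
  refine ⟨fun w => (c w - b w) * ‖w‖⁻¹, contDiff_iff_contDiffAt.2 fun w => ?_, ?_, ?_⟩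
  · by_cases hw : w = 0
    · subst hw
      have : (fun w : Space3 => (c w - b w) * ‖w‖⁻¹) =ᶠ[𝓝 0] fun _ => 0 := by
        filter_upwards [b.eventuallyEq_one, c.eventuallyEq_one] with w h1 h2
        simp [h1, h2]
      exact contDiffAt_const.congr_of_eventuallyEq this
    · exact (c.contDiff.contDiffAt.sub b.contDiff.contDiffAt).mul
        ((contDiffAt_norm ℝ hw).inv (norm_ne_zero_iff.2 hw))
  · exact (c.hasCompactSupport.sub b.hasCompactSupport).mul_right
  · intro w h1 h2
    have o1 : {w : Space3 | r < ‖w‖} ∈ 𝓝 w := (isOpen_lt continuous_const continuous_norm).mem_nhds h1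
    have o2 : {w : Space3 | ‖w‖ < R} ∈ 𝓝 w := (isOpen_lt continuous_norm continuous_const).mem_nhds h2
    filter_upwards [o1, o2] with z hz1 hz2
    have e1 : b z = 0 := b.zero_of_le_dist (by simpa [b] using (le_of_lt hz1))
    have e2 : c z = 1 := c.one_of_mem_closedBall (by simpa [c] using (le_of_lt hz2))
    simp [e1, e2]

/-! ### Smoothness and harmonicity of the potential off the source. -/

section potential

variable {f : Space3 → Space3} {ρ : Space3 → ℝ}

theorem IsNormalizedSource.isOpen_compl (h : IsNormalizedSource f ρ) : IsOpen (sourceBody f)ᶜ :=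
  h.isCompact_sourceBody.isClosed.isOpen_compl

/-- Off the source, the potential is locally given by a smooth kernel. -/
theorem IsNormalizedSource.exists_kernel (h : IsNormalizedSource f ρ) {x₀ : Space3}
    (hx : x₀ ∉ sourceBody f) : ∃ k : Space3 → ℝ, ContDiff ℝ ∞ k ∧ HasCompactSupport k ∧
      ∀ᶠ x in 𝓝 x₀, ∀ z ∈ sourceBody f, k =ᶠ[𝓝 (x - z)] fun w => ‖w‖⁻¹ := by
  obtain ⟨d, hd, hdK⟩ := Metric.isOpen_iff.1 h.isOpen_compl x₀ hx
  obtain ⟨M, hM⟩ := h.isCompact_sourceBody.isBounded.subset_closedBall (0 : Space3)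
  have hM0 : 0 ≤ M := by
    obtain ⟨z, hz⟩ := nonempty_sourceBody f
    exact (norm_nonneg z).trans (by simpa using hM hz)
  obtain ⟨k, hk, hs, he⟩ := exists_newtonian_cutoff (r := d / 4) (R := ‖x₀‖ + d + M + 1)
    (by positivity) (by linarith [norm_nonneg x₀])
  refine ⟨k, hk, hs, ?_⟩
  filter_upwards [Metric.ball_mem_nhds x₀ (half_pos hd)] with x hx z hz
  rw [Metric.mem_ball, dist_eq_norm] at hx
  have h1 : d ≤ ‖z - x₀‖ := by
    by_contra! hlt
    exact hdK (by simpa [dist_eq_norm] using hlt) hz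
  have h2 : ‖z‖ ≤ M := by simpa using hM hz
  refine he _ ?_ ?_
  · have : ‖z - x₀‖ ≤ ‖x - x₀‖ + ‖x - z‖ := by
      rw [show z - x₀ = (x - x₀) - (x - z) by abel]; exact norm_sub_le _ _
    linarith
  · have : ‖x - z‖ ≤ ‖x - x₀‖ + ‖x₀‖ + ‖z‖ := by
      rw [show x - z = (x - x₀) + x₀ - z by abel]
      exact (norm_sub_le _ _).trans (by gcongr; exact norm_add_le _ _)
    linarith

theorem newtonianPotential_eq_of_kernel (g : ℝ) {k : Space3 → ℝ} {x : Space3}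
    (hk : ∀ z ∈ sourceBody f, k =ᶠ[𝓝 (x - z)] fun w => ‖w‖⁻¹) :
    newtonianPotential g f ρ x = ((-g) • smear f ρ k) x := by
  rw [newtonianPotential, Pi.smul_apply, smul_eq_mul, smear]
  congr 1
  refine setIntegral_congr_fun measurableSet_unitBall3 fun y hy => ?_
  simp only [smul_eq_mul]
  rw [(hk _ (mem_image_of_mem f hy)).eq_of_nhds, div_eq_mul_inv]

theorem IsNormalizedSource.contDiffAt_potential (h : IsNormalizedSource f ρ) (g : ℝ) {x : Space3}
    (hx : x ∉ sourceBody f) : ContDiffAt ℝ ∞ (newtonianPotential g f ρ) x := by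
  obtain ⟨k, hk, hs, he⟩ := h.exists_kernel hx
  refine ((h.contDiff_smear hk hs).const_smul (-g)).contDiffAt.congr_of_eventuallyEq ?_
  filter_upwards [he] with x hx using newtonianPotential_eq_of_kernel g hx

theorem IsNormalizedSource.fderiv_potential_apply (h : IsNormalizedSource f ρ) (g : ℝ) {x : Space3}
    (hx : x ∉ sourceBody f) (v : Space3) : fderiv ℝ (newtonianPotential g f ρ) x v =
      -g * ∫ y in unitBall3, ρ y * fderiv ℝ (fun w : Space3 => ‖w‖⁻¹) (x - f y) v := by
  obtain ⟨k, hk, hs, he⟩ := h.exists_kernel hx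
  have e1 : newtonianPotential g f ρ =ᶠ[𝓝 x] (-g) • smear f ρ k := by
    filter_upwards [he] with x hx using newtonianPotential_eq_of_kernel g hx
  have hk1 : ContDiff ℝ 1 k := hk.of_le (by norm_num)
  rw [e1.fderiv_eq, ((h.hasFDerivAt_smear hk1 hs x).const_smul (-g)).fderiv]
  simp only [smul_apply, smul_eq_mul]
  congr 1
  rw [smear, ContinuousLinearMap.integral_apply (h.integrable_smul_comp
    (hk1.continuous_fderiv (by norm_num)) (hs.fderiv (𝕜 := ℝ)) x)]
  refine setIntegral_congr_fun measurableSet_unitBall3 fun y hy => ?_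
  simp only [smul_apply, smul_eq_mul]
  rw [(he.self_of_nhds _ (mem_image_of_mem f hy)).fderiv_eq]

open Laplacian in
theorem IsNormalizedSource.harmonicOnNhd_potential (h : IsNormalizedSource f ρ) (g : ℝ) :
    InnerProductSpace.HarmonicOnNhd (newtonianPotential g f ρ) (sourceBody f)ᶜ := by
  have hΔ : ∀ x ∉ sourceBody f, Δ (newtonianPotential g f ρ) x = 0 := fun x hx => by
    obtain ⟨k, hk, hs, he⟩ := h.exists_kernel hx
    have e1 : newtonianPotential g f ρ =ᶠ[𝓝 x] (-g) • smear f ρ k := by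
      filter_upwards [he] with x hx using newtonianPotential_eq_of_kernel g hx
    have hc : ContDiffAt ℝ 2 (smear f ρ k) x := (h.contDiff_smear hk hs).contDiffAt.of_le
      (by norm_cast)
    rw [(InnerProductSpace.laplacian_congr_nhds e1).eq_of_nhds,
      InnerProductSpace.laplacian_smul (-g) hc, h.laplacian_smear hk hs, smear,
      setIntegral_eq_zero_of_forall_eq_zero, smul_zero]
    intro y hy
    have hz := he.self_of_nhds _ (mem_image_of_mem f hy)
    have hne : x - f y ≠ 0 := fun h0 => hx (by rw [sub_eq_zero.1 h0]; exact mem_image_of_mem f hy)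
    rw [(InnerProductSpace.laplacian_congr_nhds hz).eq_of_nhds, (harmonicAt_inv_norm hne).2.eq_of_nhds]
    simp
  intro x hx
  refine ⟨(h.contDiffAt_potential g hx).of_le (by norm_cast), ?_⟩
  filter_upwards [h.isOpen_compl.mem_nhds hx] with y hy using hΔ y hy

end potential

/-! ### The source equation and decay at infinity. -/

section potential

variable {f : Space3 → Space3} {ρ : Space3 → ℝ}

/-- The kernel's integral over `T` is bounded uniformly in the pole, so integrability of `ρ` alone
suffices; `f` may collapse volume arbitrarily. This justifies Fubini both for local integrability
and for the source equation. -/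
theorem IsNormalizedSource.integrable_prod (h : IsNormalizedSource f ρ) {T : Set Space3}
    (hT : volume T < ⊤) : Integrable (fun p : Space3 × Space3 => ρ p.2 * ‖p.1 - f p.2‖⁻¹)
      ((volume.restrict T).prod (volume.restrict unitBall3)) := by
  obtain ⟨C, hC, hle⟩ := exists_lintegral_inv_norm_sub_le hT
  have hm : AEStronglyMeasurable (fun p : Space3 × Space3 => ρ p.2 * ‖p.1 - f p.2‖⁻¹)
      ((volume.restrict T).prod (volume.restrict unitBall3)) := by
    have h1 : AEStronglyMeasurable (fun p : Space3 × Space3 => p.1 - f p.2)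
        ((volume.restrict T).prod (volume.restrict unitBall3)) :=
      (measurable_fst.aestronglyMeasurable).sub h.aestronglyMeasurable.comp_snd
    exact h.integrableOn.1.comp_snd.mul h1.norm.inv₀
  have hb : ∀ y, ∫ x in T, ‖ρ y * ‖x - f y‖⁻¹‖ ≤ ‖ρ y‖ * C.toReal := fun y => by
    simp_rw [norm_mul]
    rw [integral_const_mul]
    refine mul_le_mul_of_nonneg_left ?_ (norm_nonneg _)
    rw [integral_norm_eq_lintegral_enorm (integrableOn_inv_norm_sub hT (f y)).1]
    exact ENNReal.toReal_mono hC.ne (hle _)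
  rw [integrable_prod_iff' hm]
  refine ⟨Eventually.of_forall fun y => (integrableOn_inv_norm_sub hT (f y)).const_mul (ρ y), ?_⟩
  refine (h.integrableOn.norm.mul_const C.toReal).mono' hm.norm.prod_swap.integral_prod_right'
    (Eventually.of_forall fun y => ?_)
  rw [Real.norm_of_nonneg (integral_nonneg fun x => norm_nonneg _)]
  exact hb y

theorem newtonianPotential_eq_mul (g : ℝ) (x : Space3) : newtonianPotential g f ρ x =
    -g * ∫ y in unitBall3, ρ y * ‖x - f y‖⁻¹ := by
  simp only [newtonianPotential, div_eq_mul_inv]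

theorem IsNormalizedSource.locallyIntegrable_potential (h : IsNormalizedSource f ρ) (g : ℝ) :
    LocallyIntegrable (newtonianPotential g f ρ) := by
  refine locallyIntegrable_iff.2 fun T hT => ?_
  have := (h.integrable_prod hT.measure_lt_top).integral_prod_left.const_mul (-g)
  exact this.congr (Eventually.of_forall fun x => (newtonianPotential_eq_mul g x).symm)

open Laplacian in
theorem IsNormalizedSource.integral_potential_mul_laplacian (h : IsNormalizedSource f ρ) (g : ℝ)
    {χ : Space3 → ℝ} (hχ : ContDiff ℝ 2 χ) (hs : HasCompactSupport χ) :
    ∫ x, newtonianPotential g f ρ x * Δ χ x = 4 * π * g * ∫ y in unitBall3, ρ y * χ (f y) := by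
  have cΔ := continuous_laplacian hχ
  have hsΔ := hs.laplacian
  obtain ⟨C, hC⟩ := hsΔ.exists_bound_of_continuous cΔ
  have hint : Integrable (Function.uncurry fun x y => Δ χ x * (ρ y * ‖x - f y‖⁻¹))
      ((volume.restrict (tsupport (Δ χ))).prod (volume.restrict unitBall3)) := by
    refine (h.integrable_prod hsΔ.measure_lt_top).bdd_mul (c := C) ?_ ?_
    · exact (cΔ.comp continuous_fst).aestronglyMeasurable
    · exact Eventually.of_forall fun p => hC _
  have hout : ∀ x, x ∉ tsupport (Δ χ) → Δ χ x = 0 := fun x hx => image_eq_zero_of_notMem_tsupport hx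
  calc ∫ x, newtonianPotential g f ρ x * Δ χ x
      = ∫ x in tsupport (Δ χ), newtonianPotential g f ρ x * Δ χ x :=
        (setIntegral_eq_integral_of_forall_compl_eq_zero fun x hx => by rw [hout x hx, mul_zero]).symm
    _ = -g * ∫ x in tsupport (Δ χ), ∫ y in unitBall3, Δ χ x * (ρ y * ‖x - f y‖⁻¹) := by
        rw [← integral_const_mul]
        congr 1
        ext x
        rw [newtonianPotential_eq_mul, integral_const_mul]; ring
    _ = -g * ∫ y in unitBall3, ∫ x in tsupport (Δ χ), Δ χ x * (ρ y * ‖x - f y‖⁻¹) := by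
        rw [integral_integral_swap hint]
    _ = -g * ∫ y in unitBall3, -4 * π * (ρ y * χ (f y)) := by
        congr 2
        ext y
        rw [setIntegral_eq_integral_of_forall_compl_eq_zero fun x hx => by rw [hout x hx, zero_mul]]
        have := integral_inv_norm_sub_mul_laplacian hχ hs (f y)
        rw [show -4 * π * (ρ y * χ (f y)) = ρ y * (-4 * π * χ (f y)) by ring, ← this,
          ← integral_const_mul]
        congr 1
        ext x; ring
    _ = _ := by rw [integral_const_mul]; ring

theorem IsNormalizedSource.abs_potential_le (h : IsNormalizedSource f ρ) (g : ℝ) {M : ℝ}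
    (hM : ∀ z ∈ sourceBody f, ‖z‖ ≤ M) {x : Space3} (hx : M < ‖x‖) :
    |newtonianPotential g f ρ x| ≤ |g| * (∫ y in unitBall3, |ρ y|) * (‖x‖ - M)⁻¹ := by
  rw [newtonianPotential_eq_mul, abs_mul, abs_neg, mul_assoc]
  refine mul_le_mul_of_nonneg_left ?_ (abs_nonneg g)
  rw [← integral_mul_const, ← Real.norm_eq_abs]
  refine norm_integral_le_of_norm_le (h.integrableOn.norm.mul_const _) ?_
  filter_upwards [ae_restrict_mem measurableSet_unitBall3] with y hy
  rw [norm_mul, norm_inv, norm_norm]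
  have h1 : ‖x‖ - M ≤ ‖x - f y‖ := by
    have := norm_sub_norm_le x (f y)
    linarith [hM _ (mem_image_of_mem f hy)]
  exact mul_le_mul_of_nonneg_left (inv_anti₀ (by linarith) h1) (norm_nonneg _)

theorem IsNormalizedSource.exists_norm_bound (h : IsNormalizedSource f ρ) :
    ∃ M : ℝ, 0 ≤ M ∧ ∀ z ∈ sourceBody f, ‖z‖ ≤ M := by
  obtain ⟨M, hM⟩ := h.isCompact_sourceBody.isBounded.subset_closedBall (0 : Space3)
  obtain ⟨z, hz⟩ := nonempty_sourceBody f
  exact ⟨M, (norm_nonneg z).trans (by simpa using hM hz), fun z hz => by simpa using hM hz⟩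

theorem IsNormalizedSource.tendsto_potential (h : IsNormalizedSource f ρ) (g : ℝ) :
    Tendsto (newtonianPotential g f ρ) (cocompact Space3) (𝓝 0) := by
  obtain ⟨M, hM0, hM⟩ := h.exists_norm_bound
  have ht : Tendsto (fun x : Space3 => ‖x‖) (cocompact Space3) atTop := tendsto_norm_cocompact_atTop
  have t2 : Tendsto (fun x : Space3 => |g| * (∫ y in unitBall3, |ρ y|) * (‖x‖ - M)⁻¹)
      (cocompact Space3) (𝓝 0) := by
    have := (tendsto_inv_atTop_zero.comp (tendsto_atTop_add_const_right _ (-M) ht)).const_mul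
      (|g| * (∫ y in unitBall3, |ρ y|))
    simpa [sub_eq_add_neg, Function.comp_def] using this
  refine squeeze_zero_norm' ?_ t2
  filter_upwards [ht.eventually (eventually_gt_atTop M)] with x hx
  exact h.abs_potential_le g hM hx

theorem IsNormalizedSource.solvesSourceEquation (h : IsNormalizedSource f ρ) (g : ℝ) :
    SolvesSourceEquation g f ρ (newtonianPotential g f ρ) where
  locallyIntegrable := h.locallyIntegrable_potential g
  laplace _ hχ hs := h.integral_potential_mul_laplacian g (hχ.of_le (by norm_cast)) hs
  tendsto_zero := h.tendsto_potential g

end potential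

/-! ### Analyticity along lines and unique continuation. -/

section lines

variable {f : Space3 → Space3} {ρ : Space3 → ℝ}

/-- The complexification of `t ↦ ‖u + t • d‖ ^ 2`. -/
noncomputable def complexNormSq (u d : Space3) (ζ : ℂ) : ℂ :=
  ((‖u‖ ^ 2 : ℝ) : ℂ) + 2 * ζ * ((inner ℝ u d : ℝ) : ℂ) + ζ ^ 2 * ((‖d‖ ^ 2 : ℝ) : ℂ)

theorem complexNormSq_ofReal (u d : Space3) (t : ℝ) :
    complexNormSq u d t = ((‖u + t • d‖ ^ 2 : ℝ) : ℂ) := by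
  rw [norm_add_sq_real, norm_smul, inner_smul_right, mul_pow, Real.norm_eq_abs, sq_abs]
  simp only [complexNormSq]
  push_cast
  ring

theorem hasDerivAt_complexNormSq (u d : Space3) (ζ : ℂ) : HasDerivAt (complexNormSq u d)
    (2 * ((inner ℝ u d : ℝ) : ℂ) + 2 * ζ * ((‖d‖ ^ 2 : ℝ) : ℂ)) ζ := by
  have h1 := (((hasDerivAt_id ζ).const_mul 2).mul_const ((inner ℝ u d : ℝ) : ℂ)).const_add
    ((‖u‖ ^ 2 : ℝ) : ℂ)
  have h2 := (hasDerivAt_pow 2 ζ).mul_const ((‖d‖ ^ 2 : ℝ) : ℂ)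
  refine (h1.add h2).congr_deriv ?_
  simp

/-- The two terms involving `ζ` are at most `2 · 1/4 + 1/16 = 9/16` of `‖u‖²`. The real part thus
stays positive, and complex powers of `complexNormSq` avoid the branch cut. -/
theorem le_re_complexNormSq {u d : Space3} {ζ : ℂ} (h : 4 * (‖ζ‖ * ‖d‖) ≤ ‖u‖) :
    7 / 16 * ‖u‖ ^ 2 ≤ (complexNormSq u d ζ).re := by
  have h1 : ‖2 * ζ * ((inner ℝ u d : ℝ) : ℂ) + ζ ^ 2 * ((‖d‖ ^ 2 : ℝ) : ℂ)‖ ≤ 9 / 16 * ‖u‖ ^ 2 := by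
    refine (norm_add_le _ _).trans ?_
    rw [norm_mul, norm_mul, norm_mul, norm_pow, Complex.norm_real, Complex.norm_real,
      Real.norm_of_nonneg (sq_nonneg ‖d‖), Complex.norm_ofNat]
    have h2 : ‖(inner ℝ u d : ℝ)‖ ≤ ‖u‖ * ‖d‖ := norm_inner_le_norm u d
    have h3 : 0 ≤ ‖ζ‖ * ‖d‖ := by positivity
    have h4 : 2 * ‖ζ‖ * ‖(inner ℝ u d : ℝ)‖ ≤ 2 * (‖ζ‖ * ‖d‖) * ‖u‖ := by
      have := mul_le_mul_of_nonneg_left h2 (by positivity : 0 ≤ 2 * ‖ζ‖)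
      linarith
    nlinarith [norm_nonneg u]
  have h2 := (abs_le.1 ((Complex.abs_re_le_norm _).trans h1)).1
  have : (complexNormSq u d ζ).re = ‖u‖ ^ 2 +
      (2 * ζ * ((inner ℝ u d : ℝ) : ℂ) + ζ ^ 2 * ((‖d‖ ^ 2 : ℝ) : ℂ)).re := by
    rw [complexNormSq, add_assoc, Complex.add_re, Complex.ofReal_re]
  rw [this]; linarith

/-- This extends the potential on a line to complex parameters. The lower bound on the real part,
uniform over the source, dominates the derivative of the integrand, and holomorphy then supplies
analyticity. -/
theorem IsNormalizedSource.differentiableOn_complex_potential (h : IsNormalizedSource f ρ)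
    {x d : Space3} {m δ : ℝ} (hm : 0 < m) (hxm : ∀ z ∈ sourceBody f, m ≤ ‖x - z‖)
    (hδ : 4 * (δ * ‖d‖) ≤ m) :
    DifferentiableOn ℂ (fun ζ : ℂ => ∫ y in unitBall3,
      (ρ y : ℂ) * complexNormSq (x - f y) d ζ ^ (-(1 / 2) : ℂ)) (Metric.ball 0 δ) := by
  obtain ⟨M, hM0, hM⟩ := h.exists_norm_bound
  have hre : ∀ y ∈ unitBall3, ∀ ζ ∈ Metric.ball (0 : ℂ) δ,
      7 / 16 * m ^ 2 ≤ (complexNormSq (x - f y) d ζ).re := fun y hy ζ hζ => by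
    have h1 := hxm _ (mem_image_of_mem f hy)
    have h2 : ‖ζ‖ ≤ δ := by simpa using (mem_ball_zero_iff.1 hζ).le
    have h3 : 4 * (‖ζ‖ * ‖d‖) ≤ ‖x - f y‖ := by
      have := mul_le_mul_of_nonneg_right h2 (norm_nonneg d)
      linarith
    refine le_trans ?_ (le_re_complexNormSq h3)
    gcongr
  have hmeas : ∀ (ζ p : ℂ), AEStronglyMeasurable
      (fun y => (ρ y : ℂ) * complexNormSq (x - f y) d ζ ^ p) (volume.restrict unitBall3) :=
    fun ζ p => by
    have : Measurable fun z : Space3 => complexNormSq (x - z) d ζ ^ p := by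
      unfold complexNormSq; fun_prop
    exact (Complex.continuous_ofReal.comp_aestronglyMeasurable h.integrableOn.1).mul
      (this.comp_aemeasurable h.aestronglyMeasurable.aemeasurable).aestronglyMeasurable
  have hnorm : ∀ (p : ℝ), p ≤ 0 → ∀ y ∈ unitBall3, ∀ ζ ∈ Metric.ball (0 : ℂ) δ,
      ‖complexNormSq (x - f y) d ζ ^ (p : ℂ)‖ ≤ (7 / 16 * m ^ 2) ^ p := fun p hp y hy ζ hζ => by
    rw [Complex.norm_cpow_real]
    exact Real.rpow_le_rpow_of_nonpos (by positivity)
      ((hre y hy ζ hζ).trans (Complex.re_le_norm _)) hp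
  intro ζ₀ hζ₀
  have hae : ∀ᵐ y ∂volume.restrict unitBall3, y ∈ unitBall3 := ae_restrict_mem measurableSet_unitBall3
  let F' : ℂ → Space3 → ℂ := fun ζ y => (ρ y : ℂ) * complexNormSq (x - f y) d ζ ^ (-(3 / 2) : ℂ) *
    (-(1 / 2) * (2 * ((inner ℝ (x - f y) d : ℝ) : ℂ) + 2 * ζ * ((‖d‖ ^ 2 : ℝ) : ℂ)))
  refine (hasDerivAt_integral_of_dominated_loc_of_deriv_le (F' := F')
    (bound := fun y => ‖ρ y‖ * ((7 / 16 * m ^ 2) ^ (-(3 / 2) : ℝ) *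
      (1 / 2 * (2 * ((‖x‖ + M) * ‖d‖) + 2 * δ * ‖d‖ ^ 2))))
    (Metric.isOpen_ball.mem_nhds hζ₀) (Eventually.of_forall fun ζ => hmeas ζ _) ?_ ?_ ?_
    (h.integrableOn.norm.mul_const _) ?_).2.differentiableAt.differentiableWithinAt
  · refine (h.integrableOn.norm.mul_const ((7 / 16 * m ^ 2) ^ (-(1 / 2) : ℝ))).mono' (hmeas ζ₀ _) ?_
    filter_upwards [hae] with y hy
    rw [norm_mul, Complex.norm_real]
    refine mul_le_mul_of_nonneg_left ?_ (norm_nonneg _)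
    have := hnorm (-(1 / 2)) (by norm_num) y hy ζ₀ hζ₀
    push_cast at this
    exact this
  · refine (hmeas ζ₀ _).mul ?_
    have : Measurable fun z : Space3 => (-(1 / 2) * (2 * ((inner ℝ (x - z) d : ℝ) : ℂ) +
      2 * ζ₀ * ((‖d‖ ^ 2 : ℝ) : ℂ)) : ℂ) := by fun_prop
    exact (this.comp_aemeasurable h.aestronglyMeasurable.aemeasurable).aestronglyMeasurable
  · filter_upwards [hae] with y hy ζ hζ
    have h1 := hnorm (-(3 / 2)) (by norm_num) y hy ζ hζ
    push_cast at h1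
    have h2 : ‖ζ‖ ≤ δ := by simpa using (mem_ball_zero_iff.1 hζ).le
    have h3 : ‖(inner ℝ (x - f y) d : ℝ)‖ ≤ (‖x‖ + M) * ‖d‖ :=
      (norm_inner_le_norm _ _).trans (mul_le_mul_of_nonneg_right ((norm_sub_le _ _).trans
        (by gcongr; exact hM _ (mem_image_of_mem f hy))) (norm_nonneg d))
    simp only [F', norm_mul, mul_assoc, Complex.norm_real]
    refine mul_le_mul_of_nonneg_left ?_ (norm_nonneg _)
    refine mul_le_mul h1 ?_ (by positivity) (by positivity)
    rw [norm_neg]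
    refine mul_le_mul (by norm_num) ?_ (norm_nonneg _) (by norm_num)
    refine (norm_add_le _ _).trans (add_le_add ?_ ?_)
    · rw [norm_mul, Complex.norm_ofNat, Complex.norm_real]; gcongr
    · rw [norm_mul, norm_mul, Complex.norm_ofNat, Complex.norm_real,
        Real.norm_of_nonneg (sq_nonneg ‖d‖)]; gcongr
  · filter_upwards [hae] with y hy ζ hζ
    have hpos : 0 < (complexNormSq (x - f y) d ζ).re :=
      lt_of_lt_of_le (by positivity) (hre y hy ζ hζ)
    have := ((hasDerivAt_complexNormSq (x - f y) d ζ).cpow_const (c := -(1 / 2))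
      (Or.inl hpos)).const_mul (ρ y : ℂ)
    refine this.congr_deriv ?_
    simp only [F']
    have e : (-(1 / 2) - 1 : ℂ) = -(3 / 2) := by norm_num
    rw [e]; ring

/-- Analyticity in one variable on each line is enough for unique continuation, since points of a
ball are joined by segments. -/
theorem IsNormalizedSource.analyticAt_potential_line (h : IsNormalizedSource f ρ) (g : ℝ)
    {x : Space3} (hx : x ∉ sourceBody f) (d : Space3) :
    AnalyticAt ℝ (fun t : ℝ => newtonianPotential g f ρ (x + t • d)) 0 := by
  obtain ⟨m, hm, hmK⟩ := Metric.isOpen_iff.1 h.isOpen_compl x hx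
  have hxm : ∀ z ∈ sourceBody f, m ≤ ‖x - z‖ := fun z hz => by
    by_contra! hlt
    exact hmK (by rw [Metric.mem_ball, dist_comm, dist_eq_norm]; exact hlt) hz
  let δ := m / (4 * (‖d‖ + 1))
  have hδ0 : 0 < δ := by positivity
  have hδ : 4 * (δ * ‖d‖) ≤ m := by
    have : δ * (4 * (‖d‖ + 1)) = m := div_mul_cancel₀ _ (by positivity)
    nlinarith
  have hA := ((h.differentiableOn_complex_potential hm hxm hδ).analyticAt
    (Metric.ball_mem_nhds (0 : ℂ) hδ0))
  have hR := hA.re_ofReal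
  refine (analyticAt_const (v := -g) |>.mul hR).congr ?_
  filter_upwards with t
  rw [newtonianPotential_eq_mul]
  simp only [Pi.mul_apply]
  congr 1
  simp_rw [complexNormSq_ofReal]
  have : ∀ y, (ρ y : ℂ) * ((‖x - f y + t • d‖ ^ 2 : ℝ) : ℂ) ^ (-(1 / 2) : ℂ) =
      ((ρ y * ‖x + t • d - f y‖⁻¹ : ℝ) : ℂ) := fun y => by
    rw [norm_inv_eq_rpow, show x - f y + t • d = x + t • d - f y by abel, Complex.ofReal_mul,
      Complex.ofReal_cpow (sq_nonneg _)]
    push_cast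
    rfl
  simp_rw [this]
  rw [integral_complex_ofReal, Complex.ofReal_re]

/-- Unique continuation for the potential in a ball off the source. -/
theorem IsNormalizedSource.eqOn_ball_of_eventually_eq (h : IsNormalizedSource f ρ) (g : ℝ)
    {p q : Space3} {r c : ℝ} (hb : Metric.ball p r ⊆ (sourceBody f)ᶜ) (hq : q ∈ Metric.ball p r)
    (hc : ∀ᶠ x in 𝓝 q, newtonianPotential g f ρ x = c) :
    ∀ x ∈ Metric.ball p r, newtonianPotential g f ρ x = c := by
  intro x hx
  let γ : ℝ → ℝ := fun t => newtonianPotential g f ρ (q + t • (x - q))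
  have hmem : ∀ t ∈ Icc (0 : ℝ) 1, q + t • (x - q) ∈ Metric.ball p r := fun t ht =>
    (convex_ball p r).add_smul_sub_mem hq hx ht
  have hγ : AnalyticOnNhd ℝ γ (Icc 0 1) := fun t ht => by
    have h1 := h.analyticAt_potential_line g (hb (hmem t ht)) (x - q)
    have h2 : AnalyticAt ℝ (fun s : ℝ => s - t) t := analyticAt_id.sub analyticAt_const
    have h3 : AnalyticAt ℝ (fun s : ℝ => newtonianPotential g f ρ
        (q + t • (x - q) + (s - t) • (x - q))) t :=
      AnalyticAt.fun_comp (f := fun s : ℝ => s - t) (by simpa using h1) h2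
    refine h3.congr (Eventually.of_forall fun s => ?_)
    simp only [γ]
    congr 1
    rw [sub_smul]; abel
  have h0 : γ =ᶠ[𝓝 0] fun _ => c := by
    have : Tendsto (fun t : ℝ => q + t • (x - q)) (𝓝 0) (𝓝 q) := by
      have : Continuous fun t : ℝ => q + t • (x - q) := by fun_prop
      simpa using this.tendsto 0
    exact this.eventually hc
  have := hγ.eqOn_of_preconnected_of_eventuallyEq (fun t _ => analyticAt_const)
    isPreconnected_Icc (left_mem_Icc.2 zero_le_one) h0 (right_mem_Icc.2 zero_le_one)
  simpa [γ] using this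

end lines

/-! ### Topology of the level set and of the two sides. -/

/-- Adding a limit point to a connected set keeps it connected. For open `F` it follows that
boundary points of a component lie outside `F`, which provides boundary values for the maximum
principle. -/
theorem closure_connectedComponentIn_inter_subset {X : Type*} [TopologicalSpace X] {F : Set X}
    (x : X) : closure (connectedComponentIn F x) ∩ F ⊆ connectedComponentIn F x := by
  rintro p ⟨hp, hpF⟩
  by_cases hx : x ∈ F
  · have h1 : IsPreconnected (insert p (connectedComponentIn F x)) :=
      isPreconnected_connectedComponentIn.subset_closure (subset_insert _ _)
        (insert_subset hp subset_closure)
    exact h1.subset_connectedComponentIn (mem_insert_of_mem _ (mem_connectedComponentIn hx))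
      (insert_subset hpF (connectedComponentIn_subset F x)) (mem_insert p _)
  · rw [connectedComponentIn_eq_empty hx] at hp
    simp at hp

/-- A radial push maps the connected punctured space onto this set. It singles out the unbounded
component of the exterior. -/
theorem isConnected_norm_gt (R : ℝ) (hR : 0 ≤ R) : IsConnected {x : Space3 | R < ‖x‖} := by
  have h0 : IsConnected ({0}ᶜ : Set Space3) := by
    refine isConnected_compl_singleton_of_one_lt_rank ?_ 0
    rw [← Module.finrank_eq_rank, finrank_space3]; norm_num
  have : {x : Space3 | R < ‖x‖} = (fun x : Space3 => ((‖x‖ + R) / ‖x‖) • x) '' {0}ᶜ := by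
    ext y
    constructor
    · intro hy
      have hy : R < ‖y‖ := hy
      have hy0 : 0 < ‖y‖ := hR.trans_lt hy
      have hs : 0 < (‖y‖ - R) / ‖y‖ := div_pos (by linarith) hy0
      have hn : ‖((‖y‖ - R) / ‖y‖) • y‖ = ‖y‖ - R := by
        rw [norm_smul, Real.norm_of_nonneg hs.le]; field_simp
      refine ⟨((‖y‖ - R) / ‖y‖) • y, ?_, ?_⟩
      · simp [hs.ne', norm_pos_iff.1 hy0]
      · simp only [hn]
        rw [smul_smul]
        have h1 : ‖y‖ - R ≠ 0 := by linarith
        have : (‖y‖ - R + R) / (‖y‖ - R) * ((‖y‖ - R) / ‖y‖) = 1 := by field_simp; ring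
        rw [this, one_smul]
    · rintro ⟨x, hx, rfl⟩
      have hx0 : 0 < ‖x‖ := norm_pos_iff.2 hx
      have : ‖((‖x‖ + R) / ‖x‖) • x‖ = ‖x‖ + R := by
        rw [norm_smul, Real.norm_of_nonneg (by positivity)]; field_simp
      change R < _
      rw [this]; linarith
  rw [this]
  have c1 : ContinuousOn (fun x : Space3 => ‖x‖ + R) {0}ᶜ := by fun_prop
  have c2 : ContinuousOn (fun x : Space3 => (‖x‖ + R) / ‖x‖) {0}ᶜ :=
    c1.div continuous_norm.continuousOn fun x hx => norm_ne_zero_iff.2 hx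
  exact h0.image _ (c2.smul continuousOn_id)

section bag

variable {f : Space3 → Space3} {ρ : Space3 → ℝ} {g v : ℝ}

theorem IsNormalizedSource.continuousAt_potential (h : IsNormalizedSource f ρ) {x : Space3}
    (hx : x ∉ sourceBody f) : ContinuousAt (newtonianPotential g f ρ) x :=
  (h.contDiffAt_potential g hx).continuousAt

/-- The potential takes the value of an enclosing level on no nonempty open set off the source. -/
theorem IsNormalizedSource.not_eventually_eq_level (h : IsNormalizedSource f ρ) (hv : 0 < v)
    (hL : LevelEncloses v (sourceBody f) (newtonianPotential g f ρ)) {x₀ : Space3}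
    (hx₀ : x₀ ∉ sourceBody f) : ¬ ∀ᶠ x in 𝓝 x₀, newtonianPotential g f ρ x = -v := by
  intro hev
  set φ := newtonianPotential g f ρ
  set D := connectedComponentIn (sourceBody f)ᶜ x₀
  have hxD : x₀ ∈ D := mem_connectedComponentIn hx₀
  have hDK : D ⊆ (sourceBody f)ᶜ := connectedComponentIn_subset _ _
  -- `A` is open by definition, and relatively closed in `D` by unique continuation in balls; so it
  -- contains the whole component.
  let A : Set Space3 := {x | ∀ᶠ y in 𝓝 x, φ y = -v}
  have hA : IsOpen A := isOpen_setOfPred_eventually_nhds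
  have hDA : D ⊆ A := by
    refine isPreconnected_connectedComponentIn.subset_of_closure_inter_subset hA ⟨x₀, hxD, hev⟩ ?_
    rintro p ⟨hp, hpD⟩
    obtain ⟨r, hr, hrK⟩ := Metric.isOpen_iff.1 h.isOpen_compl p (hDK hpD)
    obtain ⟨q, hqA, hq⟩ := Metric.mem_closure_iff.1 hp r hr
    filter_upwards [Metric.ball_mem_nhds p hr] with x hx
    exact h.eqOn_ball_of_eventually_eq g hrK (by rwa [Metric.mem_ball, dist_comm]) hqA x hx
  have hDv : ∀ x ∈ D, φ x = -v := fun x hx => (hDA hx).self_of_nhds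
  -- A bounded `D` has boundary points in the source, near which enclosure gives `φ < -v`. An
  -- unbounded `D` contradicts the decay of `φ`.
  by_cases hb : Bornology.IsBounded D
  · have hne : D ≠ univ := by
      rintro hu
      obtain ⟨z, hz⟩ := nonempty_sourceBody f
      exact hDK (hu ▸ mem_univ z) hz
    obtain ⟨p, hp⟩ := nonempty_frontier_iff.2 ⟨⟨x₀, hxD⟩, hne⟩
    have hDo : IsOpen D := h.isOpen_compl.connectedComponentIn
    have hpK : p ∈ sourceBody f := by
      by_contra hpK
      rw [hDo.frontier_eq] at hp
      exact hp.2 (closure_connectedComponentIn_inter_subset x₀ ⟨hp.1, hpK⟩)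
    have hnear : ∀ᶠ x in 𝓝 p, x ∉ sourceBody f → φ x < -v :=
      (eventually_nhdsSet_iff_forall.1 hL) p hpK
    obtain ⟨x, hxD', hx⟩ := ((mem_closure_iff_frequently.1 hp.1).and_eventually hnear).exists
    exact (hx (hDK hxD')).ne (hDv x hxD')
  · have hlim := (h.tendsto_potential g).eventually (lt_mem_nhds (neg_lt_zero.2 hv))
    obtain ⟨T, hT, hTs⟩ := mem_cocompact.1 hlim
    refine hb (hT.isBounded.subset fun x hx => ?_)
    by_contra hxT
    exact (ne_of_gt (hTs hxT : -v < φ x)) (hDv x hx)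

theorem notMem_bagInterior {K : Set Space3} {φ : Space3 → ℝ} {x : Space3} :
    x ∉ bagInterior v K φ ↔ x ∉ K ∧ -v ≤ φ x := by
  simp [bagInterior]

/-- Nothing is known about `φ` on the source itself. Enclosure gives the neighbourhoods of its
points, continuity those of the others. -/
theorem IsNormalizedSource.isOpen_bagInterior (h : IsNormalizedSource f ρ)
    (hL : LevelEncloses v (sourceBody f) (newtonianPotential g f ρ)) :
    IsOpen (bagInterior v (sourceBody f) (newtonianPotential g f ρ)) := by
  have key : ∀ x, (∀ᶠ y in 𝓝 x, y ∉ sourceBody f → newtonianPotential g f ρ y < -v) →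
      bagInterior v (sourceBody f) (newtonianPotential g f ρ) ∈ 𝓝 x := fun x hx => by
    filter_upwards [hx] with y hy
    by_cases hyK : y ∈ sourceBody f
    · exact Or.inl hyK
    · exact Or.inr (hy hyK)
  refine isOpen_iff_mem_nhds.2 fun x hx => key x ?_
  by_cases hxK : x ∈ sourceBody f
  · exact (eventually_nhdsSet_iff_forall.1 hL) x hxK
  · have hφ : newtonianPotential g f ρ x < -v := hx.resolve_left hxK
    exact ((h.continuousAt_potential hxK).eventually (gt_mem_nhds hφ)).mono fun y hy _ => hy

theorem IsNormalizedSource.isBounded_bagInterior (h : IsNormalizedSource f ρ) (hv : 0 < v) :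
    Bornology.IsBounded (bagInterior v (sourceBody f) (newtonianPotential g f ρ)) := by
  have hlim := (h.tendsto_potential g).eventually (lt_mem_nhds (neg_lt_zero.2 hv))
  obtain ⟨T, hT, hTs⟩ := mem_cocompact.1 hlim
  refine h.isCompact_sourceBody.isBounded.union (hT.isBounded.subset fun x hx => ?_)
  by_contra hxT
  exact lt_asymm (hTs hxT : -v < newtonianPotential g f ρ x) (mem_ofPred.1 hx)

/-- Regularity of the level is not needed: a point of the surface outside the closure of the
interior would be a local minimum, so the strong minimum principle would make `φ` constant nearby.
-/
theorem IsNormalizedSource.frontier_bagInterior (h : IsNormalizedSource f ρ) (hv : 0 < v)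
    (hL : LevelEncloses v (sourceBody f) (newtonianPotential g f ρ)) :
    frontier (bagInterior v (sourceBody f) (newtonianPotential g f ρ)) =
      bagSurface v (sourceBody f) (newtonianPotential g f ρ) := by
  rw [(h.isOpen_bagInterior hL).frontier_eq]
  ext x
  constructor
  · rintro ⟨hc, hx⟩
    obtain ⟨hxK, hφ⟩ := notMem_bagInterior.1 hx
    refine ⟨hxK, le_antisymm ?_ hφ⟩
    by_contra! hlt
    have h1 : ∀ᶠ y in 𝓝 x, y ∉ bagInterior v (sourceBody f) (newtonianPotential g f ρ) := by
      filter_upwards [(h.continuousAt_potential hxK).eventually (lt_mem_nhds hlt),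
        h.isOpen_compl.mem_nhds hxK] with y h1 h2 using notMem_bagInterior.2 ⟨h2, h1.le⟩
    exact (mem_closure_iff_frequently.1 hc) h1
  · rintro ⟨hxK, hφ⟩
    refine ⟨?_, notMem_bagInterior.2 ⟨hxK, hφ.ge⟩⟩
    by_contra hc
    have h1 : IsLocalMin (newtonianPotential g f ρ) x := by
      filter_upwards [isClosed_closure.isOpen_compl.mem_nhds hc] with y hy
      rw [hφ]
      exact (notMem_bagInterior.1 fun hy' => hy (subset_closure hy')).2
    have h2 := (h.harmonicOnNhd_potential g x hxK).eventuallyEq_of_isLocalMin h1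
    rw [hφ] at h2
    exact h.not_eventually_eq_level hv hL hxK h2

theorem IsNormalizedSource.mem_exterior_iff (h : IsNormalizedSource f ρ) (hv : 0 < v)
    (hL : LevelEncloses v (sourceBody f) (newtonianPotential g f ρ)) {x : Space3} :
    x ∈ (closure (bagInterior v (sourceBody f) (newtonianPotential g f ρ)))ᶜ ↔
      x ∉ sourceBody f ∧ -v < newtonianPotential g f ρ x := by
  rw [mem_compl_iff, closure_eq_self_union_frontier, h.frontier_bagInterior hv hL, mem_union,
    not_or, notMem_bagInterior]
  simp only [bagSurface, mem_ofPred_eq, not_and]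
  constructor
  · rintro ⟨⟨h1, h2⟩, h3⟩
    exact ⟨h1, lt_of_le_of_ne h2 (Ne.symm (h3 h1))⟩
  · rintro ⟨h1, h2⟩
    exact ⟨⟨h1, h2.le⟩, fun _ => h2.ne'⟩

theorem isConnected_sourceBody (h : IsNormalizedSource f ρ) : IsConnected (sourceBody f) :=
  ⟨nonempty_sourceBody f, (convex_closedBall 0 1).isPreconnected.image f h.continuousOn⟩

/-- The source is connected and lies in one component. On the boundary of any other component `φ ≥
-v`, and the minimum principle carries this inside, against `φ < -v`. -/
theorem IsNormalizedSource.isConnected_bagInterior (h : IsNormalizedSource f ρ) (hv : 0 < v)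
    (hL : LevelEncloses v (sourceBody f) (newtonianPotential g f ρ)) :
    IsConnected (bagInterior v (sourceBody f) (newtonianPotential g f ρ)) := by
  set φ := newtonianPotential g f ρ
  set Ω := bagInterior v (sourceBody f) φ with hΩ
  have hΩo : IsOpen Ω := h.isOpen_bagInterior hL
  obtain ⟨z, hz⟩ := nonempty_sourceBody f
  have hzΩ : z ∈ Ω := Or.inl hz
  have hKz : sourceBody f ⊆ connectedComponentIn Ω z :=
    (isConnected_sourceBody h).isPreconnected.subset_connectedComponentIn hz subset_union_left
  suffices hs : Ω ⊆ connectedComponentIn Ω z by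
    rw [hs.antisymm (connectedComponentIn_subset Ω z)]
    exact isConnected_connectedComponentIn_iff.2 hzΩ
  intro x hx
  let C := connectedComponentIn Ω x
  have hxC : x ∈ C := mem_connectedComponentIn hx
  by_cases hCK : (C ∩ sourceBody f).Nonempty
  · obtain ⟨p, hpC, hpK⟩ := hCK
    rw [connectedComponentIn_eq (hKz hpK), ← connectedComponentIn_eq hpC]
    exact hxC
  · exfalso
    have hCK' : ∀ y ∈ C, y ∉ sourceBody f := fun y hy hyK => hCK ⟨y, hy, hyK⟩
    have hCΩ : C ⊆ Ω := connectedComponentIn_subset Ω x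
    have hCφ : ∀ y ∈ C, φ y < -v := fun y hy => (hCΩ hy).resolve_left (hCK' y hy)
    have hCo : IsOpen C := hΩo.connectedComponentIn
    have hfr : ∀ p ∈ frontier C, p ∉ Ω := fun p hp hpΩ => by
      rw [hCo.frontier_eq] at hp
      exact hp.2 (closure_connectedComponentIn_inter_subset x ⟨hp.1, hpΩ⟩)
    have hclK : closure C ⊆ (sourceBody f)ᶜ := fun p hp hpK => by
      rw [closure_eq_self_union_frontier] at hp
      rcases hp with hp | hp
      · exact hCK' p hp hpK
      · exact hfr p hp (Or.inl hpK)
    -- Replacing `g` by `-g` negates the potential, so the maximum principle becomes a minimum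
    -- principle.
    have hmax := ((h.harmonicOnNhd_potential (-g)).mono fun y hy => hCK' y hy).le_of_frontier_le
      (U := C) (c := v) hCo ((h.isBounded_bagInterior hv).subset hCΩ)
      (fun p hp => (h.continuousAt_potential (hclK hp)).continuousWithinAt) (fun p hp => ?_) hxC
    · have := hCφ x hxC
      have e : newtonianPotential (-g) f ρ x = -φ x := by simp [φ, newtonianPotential]
      linarith
    · have e : newtonianPotential (-g) f ρ p = -φ p := by simp [φ, newtonianPotential]
      have := (notMem_bagInterior.1 (hfr p hp)).2
      linarith

/-- On the boundary of a bounded component `φ = -v`, so the maximum principle gives `φ ≤ -v` inside,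
against `φ > -v` in the exterior. Only the component containing a neighbourhood of infinity remains.
-/
theorem IsNormalizedSource.isConnected_exterior (h : IsNormalizedSource f ρ) (hv : 0 < v)
    (hL : LevelEncloses v (sourceBody f) (newtonianPotential g f ρ)) :
    IsConnected (closure (bagInterior v (sourceBody f) (newtonianPotential g f ρ)))ᶜ := by
  have hmem := fun x => h.mem_exterior_iff hv hL (x := x)
  have hfront := h.frontier_bagInterior hv hL
  set φ := newtonianPotential g f ρ
  set Ω := bagInterior v (sourceBody f) φ with hΩ
  have hΩo : IsOpen Ω := h.isOpen_bagInterior hL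
  set E := (closure Ω)ᶜ with hE
  have hEo : IsOpen E := isClosed_closure.isOpen_compl
  obtain ⟨R, hR⟩ := (h.isBounded_bagInterior (g := g) hv).closure.subset_closedBall (0 : Space3)
  set R' := max R 0
  have hbig : {x : Space3 | R' < ‖x‖} ⊆ E := fun x hx hxc => by
    have h1 : ‖x‖ ≤ R := by simpa using hR hxc
    have h2 : R' < ‖x‖ := hx
    exact absurd (lt_of_le_of_lt (le_max_left _ _) h2) (not_lt.2 h1)
  have hbc := isConnected_norm_gt R' (le_max_right _ _)
  obtain ⟨z, hz⟩ := hbc.nonempty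
  have hbz : {x : Space3 | R' < ‖x‖} ⊆ connectedComponentIn E z :=
    hbc.isPreconnected.subset_connectedComponentIn hz hbig
  suffices hs : E ⊆ connectedComponentIn E z by
    rw [hs.antisymm (connectedComponentIn_subset E z)]
    exact isConnected_connectedComponentIn_iff.2 (hbig hz)
  intro x hx
  let C := connectedComponentIn E x
  have hxC : x ∈ C := mem_connectedComponentIn hx
  by_cases hCb : (C ∩ {x : Space3 | R' < ‖x‖}).Nonempty
  · obtain ⟨p, hpC, hpK⟩ := hCb
    rw [connectedComponentIn_eq (hbz hpK), ← connectedComponentIn_eq hpC]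
    exact hxC
  · exfalso
    have hCb' : C ⊆ Metric.closedBall 0 R' := fun y hy => by
      by_contra hyR
      exact hCb ⟨y, hy, by simpa using hyR⟩
    have hCE : C ⊆ E := connectedComponentIn_subset E x
    have hCo : IsOpen C := hEo.connectedComponentIn
    have hdisj : ∀ p ∈ closure C, p ∉ Ω := fun p hp hpΩ => by
      obtain ⟨y, hy, hyC⟩ := mem_closure_iff.1 hp Ω hΩo hpΩ
      exact hCE hyC (subset_closure hy)
    have hfr : ∀ p ∈ frontier C, φ p = -v := fun p hp => by
      have hpE : p ∉ E := fun hpE => by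
        rw [hCo.frontier_eq] at hp
        exact hp.2 (closure_connectedComponentIn_inter_subset x ⟨hp.1, hpE⟩)
      have hp2 : p ∈ frontier Ω := by
        rw [hΩo.frontier_eq]
        exact ⟨not_not.1 hpE, hdisj p (frontier_subset_closure hp)⟩
      rw [hfront] at hp2
      exact hp2.2
    have hmax := ((h.harmonicOnNhd_potential g).mono fun y hy =>
        ((hmem y).1 (hCE hy)).1).le_of_frontier_le
      (U := C) (c := -v) hCo (Metric.isBounded_closedBall.subset hCb')
      (fun p hp => (h.continuousAt_potential
        (notMem_bagInterior.1 (hdisj p hp)).1).continuousWithinAt) (fun p hp => (hfr p hp).le) hxC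
    exact absurd ((hmem x).1 hx).2 (not_lt.2 hmax)

theorem IsNormalizedSource.bounds (h : IsNormalizedSource f ρ) (hv : 0 < v)
    (hL : LevelEncloses v (sourceBody f) (newtonianPotential g f ρ)) :
    Bounds (bagSurface v (sourceBody f) (newtonianPotential g f ρ))
      (bagInterior v (sourceBody f) (newtonianPotential g f ρ)) where
  isOpen := h.isOpen_bagInterior hL
  isBounded := h.isBounded_bagInterior hv
  isConnected := h.isConnected_bagInterior hv hL
  exterior_isConnected := h.isConnected_exterior hv hL
  frontier_eq := h.frontier_bagInterior hv hL

end bag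

/-! ### Exterior energy by weighted fluxes. -/

section primitive

variable {η : ℝ → ℝ}

/-- Composed with a harmonic `φ`, such a `W` satisfies `Δ(W ∘ φ) = η(φ)|∇φ|²`. Vanishing below `a`
allows extension by zero; above `b` the slope records the total integral of `η`. -/
theorem exists_second_primitive (hη : Continuous η) {a b c : ℝ} (hca : c ≤ a) (hb : b ≤ 0)
    (h1 : ∀ s ≤ a, η s = 0) (h2 : ∀ s ≥ b, η s = 0) : ∃ W : ℝ → ℝ, ContDiff ℝ 2 W ∧
      deriv (deriv W) = η ∧ (∀ s ≤ a, W s = 0) ∧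
      ∀ s ≥ b, W s = W 0 + (∫ t in c..0, η t) * s := by
  let w : ℝ → ℝ := fun s => ∫ t in c..s, η t
  have dw : ∀ s, HasDerivAt w (η s) s := fun s => hη.integral_hasStrictDerivAt c s |>.hasDerivAt
  have cw : Continuous w := continuous_iff_continuousAt.2 fun s => (dw s).continuousAt
  let W : ℝ → ℝ := fun s => ∫ t in c..s, w t
  have dW : ∀ s, HasDerivAt W (w s) s := fun s => cw.integral_hasStrictDerivAt c s |>.hasDerivAt
  have eW : deriv W = w := by ext s; exact (dW s).deriv
  have ew : deriv w = η := by ext s; exact (dw s).deriv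
  have w0 : ∀ s ≤ a, w s = 0 := fun s hs => by
    refine intervalIntegral.integral_zero_ae (Eventually.of_forall fun t ht => h1 t ?_)
    rcases mem_uIoc.1 ht with h | h <;> linarith
  have w1 : ∀ s ≥ b, w s = w 0 := fun s hs => by
    have : w 0 - w s = ∫ t in s..0, η t := by
      simp only [w]
      rw [intervalIntegral.integral_interval_sub_left] <;> exact hη.intervalIntegrable _ _
    rw [intervalIntegral.integral_zero_ae (Eventually.of_forall fun t ht => h2 t ?_)] at this
    · linarith
    · rcases mem_uIoc.1 ht with h | h <;> linarith
  refine ⟨W, ?_, by rw [eW, ew], fun s hs => ?_, fun s hs => ?_⟩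
  · rw [show (2 : ℕ∞ω) = 1 + 1 by norm_num, contDiff_succ_iff_deriv]
    refine ⟨fun s => (dW s).differentiableAt, by simp, ?_⟩
    rw [eW, contDiff_one_iff_deriv]
    exact ⟨fun s => (dw s).differentiableAt, by rw [ew]; exact hη⟩
  · refine intervalIntegral.integral_zero_ae (Eventually.of_forall fun t ht => w0 t ?_)
    rcases mem_uIoc.1 ht with h | h <;> linarith
  · have : W s - W 0 = ∫ t in (0 : ℝ)..s, w t := by
      simp only [W]
      rw [intervalIntegral.integral_interval_sub_left] <;> exact cw.intervalIntegrable _ _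
    rw [intervalIntegral.integral_congr (g := fun _ => w 0) fun t ht => w1 t ?_,
      intervalIntegral.integral_const] at this
    · simp only [sub_zero, smul_eq_mul] at this
      rw [eq_add_of_sub_eq' this, mul_comm]
    · rcases mem_uIcc.1 ht with h | h <;> linarith

end primitive

section energy

variable {f : Space3 → Space3} {ρ : Space3 → ℝ} {g v : ℝ}

open Laplacian in
theorem integral_laplacian_eq_zero {χ : Space3 → ℝ} (hχ : ContDiff ℝ 2 χ)
    (hs : HasCompactSupport χ) : ∫ x, Δ χ x = 0 := by
  have := integral_mul_laplacian_comm (u := fun _ => 1) contDiff_const hχ (Or.inr hs)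
  simpa using this

open Laplacian in
/-- The flux of the field through the exterior, weighted by a function of the potential. -/
theorem IsNormalizedSource.weighted_flux (h : IsNormalizedSource f ρ)
    (hL : LevelEncloses v (sourceBody f) (newtonianPotential g f ρ)) {η : ℝ → ℝ}
    (hη : Continuous η) {a b : ℝ} (ha : -v < a) (hb : b < 0) (h1 : ∀ s ≤ a, η s = 0)
    (h2 : ∀ s ≥ b, η s = 0) :
    IntegrableOn (fun x => η (newtonianPotential g f ρ x) *
      ‖gradient (newtonianPotential g f ρ) x‖ ^ 2)
      (bagInterior v (sourceBody f) (newtonianPotential g f ρ))ᶜ ∧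
    ∫ x in (bagInterior v (sourceBody f) (newtonianPotential g f ρ))ᶜ,
      η (newtonianPotential g f ρ x) * ‖gradient (newtonianPotential g f ρ) x‖ ^ 2 =
        4 * π * g * ∫ s in (-v)..0, η s := by
  classical
  have hΩo := h.isOpen_bagInterior hL
  have hharm := h.harmonicOnNhd_potential g
  have hlim := (h.tendsto_potential g).eventually (lt_mem_nhds hb)
  have hdist := fun (χ : Space3 → ℝ) hχ hs => h.integral_potential_mul_laplacian g (χ := χ) hχ hs
  have hloc := h.locallyIntegrable_potential g
  set φ := newtonianPotential g f ρ
  set Ω := bagInterior v (sourceBody f) φ with hΩ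
  obtain ⟨W, hW, hW2, hW0, hW1⟩ := exists_second_primitive hη ha.le hb.le h1 h2
  set m := ∫ s in (-v)..0, η s
  -- Since `W` vanishes on values up to `a > -v`, the two pieces agree across the boundary of `Ω`.
  -- Hence `u` is `C²` however irregular that boundary is.
  let u : Space3 → ℝ := fun x => if x ∈ Ω then 0 else W (φ x)
  have uin : ∀ x ∈ Ω, u =ᶠ[𝓝 x] fun _ => 0 := fun x hx => by
    filter_upwards [hΩo.mem_nhds hx] with y hy
    simp [u, hy]
  have uout : ∀ x, x ∉ Ω → u =ᶠ[𝓝 x] fun y => W (φ y) := fun x hx => by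
    filter_upwards [h.isOpen_compl.mem_nhds (notMem_bagInterior.1 hx).1] with y hy
    by_cases hyΩ : y ∈ Ω
    · have : φ y < -v := hyΩ.resolve_left hy
      simp [u, hyΩ, hW0 _ (this.trans ha).le]
    · simp [u, hyΩ]
  have hφ2 : ∀ x, x ∉ Ω → ContDiffAt ℝ 2 φ x := fun x hx =>
    (hharm x (notMem_bagInterior.1 hx).1).1
  have hu : ContDiff ℝ 2 u := contDiff_iff_contDiffAt.2 fun x => by
    by_cases hx : x ∈ Ω
    · exact contDiffAt_const.congr_of_eventuallyEq (uin x hx)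
    · exact (hW.contDiffAt.comp x (hφ2 x hx)).congr_of_eventuallyEq (uout x hx)
  have hΔ : Δ u = Ωᶜ.indicator fun x => η (φ x) * ‖gradient φ x‖ ^ 2 := by
    ext x
    by_cases hx : x ∈ Ω
    · rw [(InnerProductSpace.laplacian_congr_nhds (uin x hx)).eq_of_nhds]
      simp [hx]
    · rw [(InnerProductSpace.laplacian_congr_nhds (uout x hx)).eq_of_nhds,
        laplacian_comp hW.contDiffAt (hφ2 x hx), hW2,
        (hharm x (notMem_bagInterior.1 hx).1).2.eq_of_nhds]
      simp [hx]
  obtain ⟨M, hM0, hM⟩ := h.exists_norm_bound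
  obtain ⟨T, hT, hTs⟩ := mem_cocompact.1 hlim
  obtain ⟨R₀, hR₀⟩ := hT.isBounded.subset_closedBall (0 : Space3)
  let R := max (max R₀ M) 0 + 1
  have hR : 0 < R := by positivity
  have hRK : ∀ x : Space3, R ≤ ‖x‖ → x ∉ sourceBody f := fun x hx hxK => by
    have h3 : M ≤ max (max R₀ M) 0 := (le_max_right _ _).trans (le_max_left _ _)
    have := hM x hxK
    linarith
  have hRφ : ∀ x : Space3, R ≤ ‖x‖ → b < φ x := fun x hx => by
    refine hTs fun hxT => ?_
    have h3 : R₀ ≤ max (max R₀ M) 0 := (le_max_left _ _).trans (le_max_left _ _)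
    have : ‖x‖ ≤ R₀ := by simpa using hR₀ hxT
    linarith
  obtain ⟨χ, hχ, hχs, hχ1⟩ : ∃ χ : Space3 → ℝ, ContDiff ℝ 2 χ ∧ HasCompactSupport χ ∧
      ∀ y, ‖y‖ ≤ R → χ y = 1 := by
    let χ : ContDiffBump (0 : Space3) := ⟨R, R + 1, hR, by linarith⟩
    exact ⟨χ, χ.contDiff, χ.hasCompactSupport, fun y hy =>
      χ.one_of_mem_closedBall (by simpa [χ] using hy)⟩
  have hχΔ : ∀ x, χ x * Δ u x = Δ u x := fun x => by
    by_cases hx : ‖x‖ ≤ R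
    · rw [hχ1 x hx, one_mul]
    · have h3 : Δ u x = 0 := by
        rw [hΔ]
        by_cases hxΩ : x ∈ Ω
        · simp [hxΩ]
        · simp [h2 _ (hRφ x (not_le.1 hx).le).le]
      rw [h3, mul_zero]
  have hint : Integrable (Δ u) := by
    have : Integrable fun x => χ x * Δ u x := (hχ.continuous.mul
      (continuous_laplacian hu)).integrable_of_hasCompactSupport hχs.mul_right
    exact this.congr (Eventually.of_forall hχΔ)
  -- `Δχ` vanishes where `‖x‖ < R`; elsewhere `φ > b`, where `W` is affine with slope `m`.
  have huΔ : ∀ x, u x * Δ χ x = (W 0) * Δ χ x + m * (φ x * Δ χ x) := fun x => by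
    by_cases hx : ‖x‖ < R
    · have : Δ χ x = 0 := by
        have e : χ =ᶠ[𝓝 x] fun _ => (1 : ℝ) := by
          filter_upwards [Metric.isOpen_ball.mem_nhds (mem_ball_zero_iff.2 hx)] with y hy
          exact hχ1 y (mem_ball_zero_iff.1 hy).le
        rw [(InnerProductSpace.laplacian_congr_nhds e).eq_of_nhds]; simp
      rw [this]; ring
    · have hx := not_lt.1 hx
      have hφb := hRφ x hx
      have : u x = W 0 + m * φ x := by
        by_cases hxΩ : x ∈ Ω
        · have h3 : φ x < -v := hxΩ.resolve_left (hRK x hx)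
          simp only [u, hxΩ, if_true]
          rw [← hW1 _ hφb.le, hW0 _ (h3.trans ha).le]
        · simp only [u, hxΩ, if_false]
          exact hW1 _ hφb.le
      rw [this]; ring
  have cΔχ := continuous_laplacian hχ
  have hφχ : Integrable fun x => φ x * Δ χ x := by
    have := hloc.integrable_smul_left_of_hasCompactSupport cΔχ hχs.laplacian
    exact this.congr (Eventually.of_forall fun x => by simp [mul_comm])
  have hρ : ∫ y in unitBall3, ρ y * χ (f y) = 1 := by
    rw [← h.integral_eq_one]
    refine setIntegral_congr_fun measurableSet_unitBall3 fun y hy => ?_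
    have h3 : ‖f y‖ ≤ R := by
      by_contra! h3
      exact hRK _ h3.le (mem_image_of_mem f hy)
    rw [hχ1 _ h3, mul_one]
  -- Green's identity moves the Laplacian onto `χ`. As `χ = 1` on the source, the source equation
  -- then returns the total charge.
  have key : ∫ x, Δ u x = 4 * π * g * m := by
    calc ∫ x, Δ u x = ∫ x, χ x * Δ u x := by simp_rw [hχΔ]
      _ = ∫ x, u x * Δ χ x := integral_mul_laplacian_comm hχ hu (Or.inl hχs)
      _ = ∫ x, ((W 0) * Δ χ x + m * (φ x * Δ χ x)) := by simp_rw [huΔ]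
      _ = W 0 * 0 + m * (4 * π * g * 1) := by
        rw [integral_add ((cΔχ.integrable_of_hasCompactSupport hχs.laplacian).const_mul _)
          (hφχ.const_mul m), integral_const_mul, integral_const_mul,
          integral_laplacian_eq_zero hχ hχs, hdist χ hχ hχs, hρ]
      _ = _ := by ring
  rw [hΔ] at hint key
  rw [integral_indicator hΩo.measurableSet.compl] at key
  exact ⟨(integrable_indicator_iff hΩo.measurableSet.compl).1 hint, key⟩

/-- Continuous functions increasing to the indicator of an open interval. -/
noncomputable def intervalCutoff (s t : ℝ) (n : ℕ) (σ : ℝ) : ℝ :=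
  min 1 (max 0 ((n + 1) * min (σ - s) (t - σ) - 1))

theorem continuous_intervalCutoff (s t : ℝ) (n : ℕ) : Continuous (intervalCutoff s t n) := by
  unfold intervalCutoff; fun_prop

theorem intervalCutoff_nonneg (s t : ℝ) (n : ℕ) (σ : ℝ) : 0 ≤ intervalCutoff s t n σ :=
  le_min zero_le_one (le_max_left _ _)

theorem intervalCutoff_le_one (s t : ℝ) (n : ℕ) (σ : ℝ) : intervalCutoff s t n σ ≤ 1 :=
  min_le_left _ _

theorem intervalCutoff_eq_zero {s t : ℝ} {n : ℕ} {σ : ℝ}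
    (h : σ ≤ s + 1 / (n + 1) ∨ t - 1 / (n + 1) ≤ σ) : intervalCutoff s t n σ = 0 := by
  have hn : (0 : ℝ) < n + 1 := by positivity
  have h1 : min (σ - s) (t - σ) ≤ 1 / (n + 1) := by
    rcases h with h | h
    · exact (min_le_left _ _).trans (by linarith)
    · exact (min_le_right _ _).trans (by linarith)
  have h2 : (n + 1) * min (σ - s) (t - σ) - 1 ≤ 0 := by
    have := mul_le_mul_of_nonneg_left h1 hn.le
    rw [mul_one_div_cancel hn.ne'] at this
    linarith
  rw [intervalCutoff, max_eq_left h2]; norm_num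

theorem monotone_intervalCutoff (s t σ : ℝ) : Monotone fun n => intervalCutoff s t n σ := by
  intro n k hnk
  by_cases hd : 0 ≤ min (σ - s) (t - σ)
  · simp only [intervalCutoff]
    gcongr
  · have h0 : ∀ n : ℕ, intervalCutoff s t n σ = 0 := fun n => by
      have : ((n : ℝ) + 1) * min (σ - s) (t - σ) - 1 ≤ 0 := by
        have := mul_nonpos_of_nonneg_of_nonpos (by positivity : (0 : ℝ) ≤ n + 1) (not_le.1 hd).le
        linarith
      rw [intervalCutoff, max_eq_left this]; norm_num
    simp only [h0, le_refl]

theorem tendsto_intervalCutoff (s t σ : ℝ) :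
    Tendsto (fun n => intervalCutoff s t n σ) atTop (𝓝 ((Ioo s t).indicator 1 σ)) := by
  by_cases hσ : σ ∈ Ioo s t
  · have hd : 0 < min (σ - s) (t - σ) := lt_min (by linarith [hσ.1]) (by linarith [hσ.2])
    obtain ⟨N, hN⟩ := exists_nat_gt (2 / min (σ - s) (t - σ))
    rw [indicator_of_mem hσ]
    refine tendsto_const_nhds.congr' ?_
    filter_upwards [eventually_ge_atTop N] with n hn
    have h1 : (N : ℝ) ≤ n := by exact_mod_cast hn
    rw [div_lt_iff₀ hd] at hN
    have h2 : 1 ≤ ((n : ℝ) + 1) * min (σ - s) (t - σ) - 1 := by nlinarith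
    rw [intervalCutoff, max_eq_right (by linarith), min_eq_left h2]
    rfl
  · rw [indicator_of_notMem hσ]
    refine tendsto_const_nhds.congr fun n => (intervalCutoff_eq_zero ?_).symm
    have hn : (0 : ℝ) < 1 / (n + 1) := by positivity
    by_contra! hc
    exact hσ ⟨by linarith [hc.1], by linarith [hc.2]⟩

theorem tendsto_integral_intervalCutoff {s t a b : ℝ} (has : a ≤ s) (hst : s ≤ t) (htb : t ≤ b) :
    Tendsto (fun n => ∫ σ in a..b, intervalCutoff s t n σ) atTop (𝓝 (t - s)) := by
  have e : ∫ σ in a..b, (Ioo s t).indicator (1 : ℝ → ℝ) σ = t - s := by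
    rw [intervalIntegral.integral_of_le (has.trans (hst.trans htb)),
      setIntegral_indicator measurableSet_Ioo]
    have : Ioc a b ∩ Ioo s t = Ioo s t := inter_eq_right.2 fun σ hσ =>
      ⟨has.trans_lt hσ.1, hσ.2.le.trans htb⟩
    rw [this]
    simp [hst]
  rw [← e]
  refine intervalIntegral.tendsto_integral_filter_of_dominated_convergence (fun _ => 1) ?_ ?_ ?_ ?_
  · exact Eventually.of_forall fun n => (continuous_intervalCutoff s t n).aestronglyMeasurable
  · refine Eventually.of_forall fun n => Eventually.of_forall fun σ _ => ?_
    rw [Real.norm_of_nonneg (intervalCutoff_nonneg _ _ _ _)]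
    exact intervalCutoff_le_one _ _ _ _
  · exact intervalIntegrable_const
  · exact Eventually.of_forall fun σ _ => tendsto_intervalCutoff s t σ

theorem IsNormalizedSource.continuousOn_potential (h : IsNormalizedSource f ρ) :
    ContinuousOn (newtonianPotential g f ρ)
      (bagInterior v (sourceBody f) (newtonianPotential g f ρ))ᶜ := fun _ hx =>
  (h.continuousAt_potential (notMem_bagInterior.1 hx).1).continuousWithinAt

/-- The energy between two level surfaces of the potential. -/
theorem IsNormalizedSource.lintegral_slab (h : IsNormalizedSource f ρ)
    (hL : LevelEncloses v (sourceBody f) (newtonianPotential g f ρ)) {s t : ℝ} (hs : -v ≤ s)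
    (hst : s ≤ t) (ht : t ≤ 0) :
    ∫⁻ x in (bagInterior v (sourceBody f) (newtonianPotential g f ρ))ᶜ ∩
        {x | newtonianPotential g f ρ x ∈ Ioo s t},
      ENNReal.ofReal (‖gradient (newtonianPotential g f ρ) x‖ ^ 2) =
        ENNReal.ofReal (4 * π * g * (t - s)) := by
  have hΩo := h.isOpen_bagInterior hL
  -- The margin `1/(n + 1)` supplies the strict inequalities at both ends, even when `s = -v` or `t
  -- = 0`.
  have hflux := fun (n : ℕ) => h.weighted_flux hL (continuous_intervalCutoff s t n)
    (a := s + 1 / (n + 1)) (b := t - 1 / (n + 1))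
    (by have : (0 : ℝ) < 1 / (n + 1) := by positivity
        linarith)
    (by have : (0 : ℝ) < 1 / (n + 1) := by positivity
        linarith) (fun σ hσ => intervalCutoff_eq_zero (Or.inl hσ))
    (fun σ hσ => intervalCutoff_eq_zero (Or.inr hσ))
  have hcont := h.continuousOn_potential (g := g) (v := v)
  set φ := newtonianPotential g f ρ
  set Ω := bagInterior v (sourceBody f) φ with hΩ
  have hφm : AEMeasurable φ (volume.restrict Ωᶜ) := hcont.aemeasurable hΩo.measurableSet.compl
  have hslab : NullMeasurableSet {x | φ x ∈ Ioo s t} (volume.restrict Ωᶜ) :=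
    hφm.nullMeasurable measurableSet_Ioo
  have hgm : Measurable fun x => ‖gradient φ x‖ := by
    simp_rw [norm_gradient]
    exact (measurable_fderiv ℝ φ).norm
  have hlim := lintegral_tendsto_of_tendsto_of_monotone (μ := volume.restrict Ωᶜ)
    (f := fun n x => ENNReal.ofReal (intervalCutoff s t n (φ x) * ‖gradient φ x‖ ^ 2))
    (F := {x | φ x ∈ Ioo s t}.indicator fun x => ENNReal.ofReal (‖gradient φ x‖ ^ 2))
    (fun n => (((continuous_intervalCutoff s t n).measurable.comp_aemeasurable hφm).mul
      (hgm.pow_const 2).aemeasurable).ennreal_ofReal)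
    (Eventually.of_forall fun x n k hnk => ENNReal.ofReal_le_ofReal
      (mul_le_mul_of_nonneg_right (monotone_intervalCutoff s t (φ x) hnk) (sq_nonneg _)))
    (Eventually.of_forall fun x => ?_)
  · rw [lintegral_indicator₀ hslab, Measure.restrict_restrict₀ hslab, inter_comm] at hlim
    refine tendsto_nhds_unique hlim ?_
    have h1 : ∀ n, ∫⁻ x in Ωᶜ, ENNReal.ofReal (intervalCutoff s t n (φ x) * ‖gradient φ x‖ ^ 2) =
        ENNReal.ofReal (4 * π * g * ∫ σ in (-v)..0, intervalCutoff s t n σ) := fun n => by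
      rw [← (hflux n).2, ofReal_integral_eq_lintegral_ofReal (hflux n).1
        (Eventually.of_forall fun x => mul_nonneg (intervalCutoff_nonneg _ _ _ _) (sq_nonneg _))]
    simp_rw [h1]
    exact ENNReal.tendsto_ofReal ((tendsto_integral_intervalCutoff hs hst ht).const_mul _)
  · have h2 := ENNReal.tendsto_ofReal
      ((tendsto_intervalCutoff s t (φ x)).mul_const (‖gradient φ x‖ ^ 2))
    by_cases hx : φ x ∈ Ioo s t
    · have hx' : x ∈ {x | φ x ∈ Ioo s t} := hx
      rw [indicator_of_mem hx] at h2
      rw [indicator_of_mem hx']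
      simpa using h2
    · have hx' : x ∉ {x | φ x ∈ Ioo s t} := hx
      rw [indicator_of_notMem hx] at h2
      rw [indicator_of_notMem hx']
      simpa using h2

/-- If `c = u x` were positive, decay would make the set where `u > c/2` bounded. The bounded
maximum principle on that set gives `u ≤ c/2`, a contradiction at `x`. -/
theorem InnerProductSpace.HarmonicOnNhd.nonpos_of_exterior {Ω : Set Space3} {u : Space3 → ℝ}
    (hΩ : IsOpen Ω) (hu : InnerProductSpace.HarmonicOnNhd u (closure Ω)ᶜ)
    (hc : ContinuousOn u Ωᶜ) (hlim : Tendsto u (cocompact Space3) (𝓝 0))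
    (hle : ∀ x ∈ frontier Ω, u x ≤ 0) {x : Space3} (hx : x ∉ Ω) : u x ≤ 0 := by
  by_contra! hpos
  set c := u x
  have hUE : ∀ y ∉ Ω, 0 < u y → y ∈ (closure Ω)ᶜ := fun y hy hy0 hyc =>
    absurd (hle y (hΩ.frontier_eq ▸ ⟨hyc, hy⟩)) (not_le.2 hy0)
  have hEΩ : (closure Ω)ᶜ ⊆ Ωᶜ := compl_subset_compl.2 subset_closure
  let U : Set Space3 := {y | y ∉ Ω ∧ c / 2 < u y}
  have hUo : IsOpen U := by
    refine isOpen_iff_mem_nhds.2 fun y hy => ?_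
    have hyE := hUE y hy.1 ((half_pos hpos).trans hy.2)
    filter_upwards [isClosed_closure.isOpen_compl.mem_nhds hyE,
      (hc.continuousAt (mem_of_superset (isClosed_closure.isOpen_compl.mem_nhds hyE)
        hEΩ)).eventually (lt_mem_nhds hy.2)] with z h1 h2 using ⟨hEΩ h1, h2⟩
  have hcl : closure U ⊆ Ωᶜ := closure_minimal (fun y hy => hy.1) hΩ.isClosed_compl
  have hUb : Bornology.IsBounded U := by
    obtain ⟨T, hT, hTs⟩ := mem_cocompact.1 (hlim.eventually (gt_mem_nhds (half_pos hpos)))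
    refine hT.isBounded.subset fun y hy => ?_
    by_contra hyT
    exact lt_asymm hy.2 (hTs hyT : u y < c / 2)
  have := (hu.mono fun y hy => hUE y hy.1 ((half_pos hpos).trans hy.2)).le_of_frontier_le (U := U)
    (c := c / 2) hUo hUb (hc.mono hcl) (fun p hp => ?_) (show x ∈ U from ⟨hx, half_lt_self hpos⟩)
  · linarith
  · rw [hUo.frontier_eq] at hp
    by_contra! hlt
    exact hp.2 ⟨hcl hp.1, hlt⟩

theorem IsNormalizedSource.harmonicOnNhd_exterior (h : IsNormalizedSource f ρ) :
    InnerProductSpace.HarmonicOnNhd (newtonianPotential g f ρ)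
      (closure (bagInterior v (sourceBody f) (newtonianPotential g f ρ)))ᶜ :=
  (h.harmonicOnNhd_potential g).mono fun _ hx => fun hK => hx (subset_closure (Or.inl hK))

/-- With `ρ` of either sign this cannot be read off the integral; it comes from the boundary value
`-v` and decay. -/
theorem IsNormalizedSource.potential_nonpos (h : IsNormalizedSource f ρ) (hv : 0 < v)
    (hL : LevelEncloses v (sourceBody f) (newtonianPotential g f ρ)) {x : Space3}
    (hx : x ∉ bagInterior v (sourceBody f) (newtonianPotential g f ρ)) :
    newtonianPotential g f ρ x ≤ 0 := by
  refine h.harmonicOnNhd_exterior.nonpos_of_exterior (h.isOpen_bagInterior hL)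
    h.continuousOn_potential (h.tendsto_potential g) (fun y hy => ?_) hx
  rw [h.frontier_bagInterior hv hL] at hy
  rw [hy.2]
  exact neg_nonpos.2 hv.le

/-- The slab `-v < φ < 0` may miss exterior points where `φ = 0`. There `φ` attains its maximum over
the exterior, so the gradient is zero and no energy is lost. -/
theorem IsNormalizedSource.lintegral_exterior (h : IsNormalizedSource f ρ)
    (hv : 0 < v) (hL : LevelEncloses v (sourceBody f) (newtonianPotential g f ρ)) :
    ∫⁻ x in (closure (bagInterior v (sourceBody f) (newtonianPotential g f ρ)))ᶜ,
      ENNReal.ofReal (‖gradient (newtonianPotential g f ρ) x‖ ^ 2) =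
        ENNReal.ofReal (4 * π * g * v) := by
  have hslab := h.lintegral_slab hL le_rfl (neg_nonpos.2 hv.le) le_rfl
  have hΩo := h.isOpen_bagInterior hL
  have hmem := fun x => h.mem_exterior_iff hv hL (x := x)
  have hle := fun x => h.potential_nonpos (g := g) hv hL (x := x)
  set φ := newtonianPotential g f ρ with hφ
  set Ω := bagInterior v (sourceBody f) φ with hΩ
  rw [sub_neg_eq_add, zero_add] at hslab
  rw [← hslab]
  have hEΩ : ∀ x ∈ (closure Ω)ᶜ, x ∉ Ω := fun x hx hxΩ => hx (subset_closure hxΩ)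
  have hsub : Ωᶜ ∩ {x | φ x ∈ Ioo (-v) 0} ⊆ (closure Ω)ᶜ := fun x hx =>
    (hmem x).2 ⟨(notMem_bagInterior.1 hx.1).1, hx.2.1⟩
  have hEo : IsOpen (closure Ω)ᶜ := isClosed_closure.isOpen_compl
  have hSo : IsOpen (Ωᶜ ∩ {x | φ x ∈ Ioo (-v) 0}) := by
    refine isOpen_iff_mem_nhds.2 fun x hx => ?_
    filter_upwards [hEo.mem_nhds (hsub hx), (h.continuousAt_potential (g := g)
      (notMem_bagInterior.1 hx.1).1).eventually (gt_mem_nhds hx.2.2)] with y h1 h2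
    exact ⟨hEΩ y h1, ((hmem y).1 h1).2, h2⟩
  rw [← inter_eq_left.2 hsub, ← setLIntegral_indicator hSo.measurableSet]
  refine setLIntegral_congr_fun hEo.measurableSet fun x hxE => ?_
  by_cases hx : x ∈ Ωᶜ ∩ {x | φ x ∈ Ioo (-v) 0}
  · rw [indicator_of_mem hx]
  rw [indicator_of_notMem hx]
  have h1 : φ x = 0 := by
    refine le_antisymm (hle x (hEΩ x hxE)) ?_
    by_contra! hlt
    exact hx ⟨hEΩ x hxE, ((hmem x).1 hxE).2, hlt⟩
  have h2 : IsLocalMax φ x := by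
    filter_upwards [hEo.mem_nhds hxE] with y hy
    rw [h1]; exact hle y (hEΩ y hy)
  have h3 : ‖gradient φ x‖ = 0 := by rw [norm_gradient, h2.fderiv_eq_zero, norm_zero]
  rw [h3]; simp

theorem gradient_const_add (c : ℝ) (φ : Space3 → ℝ) :
    gradient (fun x => c + φ x) = gradient φ := by
  ext1 x
  rw [gradient, gradient, fderiv_const_add]

theorem energyDensity_const_add (c : ℝ) (φ : Space3 → ℝ) :
    energyDensity (fun x => c + φ x) = energyDensity φ := by
  ext1 x
  rw [energyDensity, energyDensity, gradient_const_add]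

theorem IsNormalizedSource.energy (h : IsNormalizedSource f ρ) (hg : 0 < g)
    (hv : 0 < v) (hL : LevelEncloses v (sourceBody f) (newtonianPotential g f ρ)) :
    IntegrableOn (energyDensity (newtonianPotential g f ρ))
      (closure (bagInterior v (sourceBody f) (newtonianPotential g f ρ)))ᶜ ∧
    exteriorEnergy (bagInterior v (sourceBody f) (newtonianPotential g f ρ))
      (newtonianPotential g f ρ) = 2 * π * g * v := by
  have hE := h.lintegral_exterior hv hL
  set φ := newtonianPotential g f ρ with hφ
  set Ω := bagInterior v (sourceBody f) φ with hΩ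
  have hgm : Measurable fun x => ‖gradient φ x‖ := by
    simp_rw [norm_gradient]
    exact (measurable_fderiv ℝ φ).norm
  have hm : Measurable fun x => ‖gradient φ x‖ ^ 2 := hgm.pow_const 2
  have hint : IntegrableOn (fun x => ‖gradient φ x‖ ^ 2) (closure Ω)ᶜ := by
    refine ⟨hm.aestronglyMeasurable, ?_⟩
    rw [hasFiniteIntegral_iff_ofReal (Eventually.of_forall fun x => sq_nonneg _), hE]
    exact ENNReal.ofReal_lt_top
  refine ⟨hint.div_const 2, ?_⟩
  simp only [exteriorEnergy, energyDensity]
  rw [integral_div, integral_eq_lintegral_of_nonneg_ae (Eventually.of_forall fun x => sq_nonneg _)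
    hm.aestronglyMeasurable, hE, ENNReal.toReal_ofReal (by positivity)]
  ring

end energy

/-! ### Lipschitz distortion of area and a local coarea comparison. -/

section area

open scoped ENNReal NNReal

/-- The Hausdorff measure bound is stated between measures, so it passes to an arbitrary integrand,
measurable or not. -/
theorem lintegral_lipschitz_image_le {X Y : Type*} [EMetricSpace X] [MeasurableSpace X]
    [BorelSpace X] [EMetricSpace Y] [MeasurableSpace Y] [BorelSpace Y] {G : X → Y} {L : ℝ≥0}
    {A : Set X} (hA : MeasurableSet A) (hG : LipschitzOnWith L G A) (d : ℕ) (F : Y → ℝ≥0∞) :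
    ∫⁻ y in G '' A, F y ∂(Measure.euclideanHausdorffMeasure d) ≤
      (L : ℝ≥0∞) ^ d * ∫⁻ x in A, F (G x) ∂(Measure.euclideanHausdorffMeasure d) := by
  have hGm : AEMeasurable G ((Measure.euclideanHausdorffMeasure d).restrict A) :=
    hG.continuousOn.aemeasurable hA
  have hle : (Measure.euclideanHausdorffMeasure d).restrict (G '' A) ≤
      (L : ℝ≥0∞) ^ d • ((Measure.euclideanHausdorffMeasure d).restrict A).map G := by
    refine Measure.le_iff.2 fun E hE => ?_
    rw [Measure.restrict_apply hE, Measure.smul_apply, Measure.map_apply_of_aemeasurable hGm hE,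
      Measure.restrict_apply' hA, smul_eq_mul]
    have e1 : E ∩ G '' A = G '' (G ⁻¹' E ∩ A) := by
      rw [inter_comm (G ⁻¹' E), image_inter_preimage, inter_comm]
    rw [e1, Measure.euclideanHausdorffMeasure_def, Measure.euclideanHausdorffMeasure_def,
      Measure.smul_apply, Measure.smul_apply, ENNReal.smul_def, ENNReal.smul_def, smul_eq_mul,
      smul_eq_mul, mul_left_comm]
    refine mul_le_mul_right ?_ _
    have := (hG.mono (inter_subset_right : G ⁻¹' E ∩ A ⊆ A)).hausdorffMeasure_image_le
      (d := (d : ℝ)) (Nat.cast_nonneg d)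
    rwa [ENNReal.rpow_natCast] at this
  calc ∫⁻ y in G '' A, F y ∂(Measure.euclideanHausdorffMeasure d)
      ≤ ∫⁻ y, F y ∂((L : ℝ≥0∞) ^ d • ((Measure.euclideanHausdorffMeasure d).restrict A).map G) :=
        lintegral_mono' hle le_rfl
    _ = (L : ℝ≥0∞) ^ d * ∫⁻ y, F y ∂(((Measure.euclideanHausdorffMeasure d).restrict A).map G) :=
        lintegral_smul_measure _ _
    _ ≤ _ := mul_le_mul_right (lintegral_map_le _ _) _

theorem lintegral_eq_lintegral_slices {n : Space3} (hn : ‖n‖ = 1) {F : Space3 → ℝ≥0∞}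
    (hF : Measurable F) :
    ∫⁻ w, F w = ∫⁻ t : ℝ, ∫⁻ y : (ℝ ∙ n)ᗮ, F (t • n + y) := by
  have h1 := (ℝ ∙ n).measurePreserving_measurableEquivProd (0 : Space3)
  rw [finrank_space3, EuclideanSpace.euclideanHausdorffMeasure_eq_volume] at h1
  have h2 := (h1.symm).lintegral_comp hF
  have hm : Measurable fun q : (ℝ ∙ n) × (ℝ ∙ n)ᗮ => F ((q.1 : Space3) + q.2) := by fun_prop
  have h3 := (LinearIsometryEquiv.toSpanUnitSingleton n hn).measurePreserving.lintegral_comp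
    (hm.lintegral_prod_right' (ν := (volume : Measure (ℝ ∙ n)ᗮ)))
  rw [← h2, Measure.volume_eq_prod]
  simp only [Submodule.measurableEquivProd_symm_apply, vadd_eq_add, add_zero]
  rw [lintegral_prod _ hm.aemeasurable, ← h3]
  rfl

theorem lintegral_plane {n : Space3} (hn : ‖n‖ = 1) (F : Space3 → ℝ≥0∞) :
    ∫⁻ w in {w | inner ℝ n w = 0}, F w ∂(Measure.euclideanHausdorffMeasure 2) =
      ∫⁻ y : (ℝ ∙ n)ᗮ, F y := by
  have hn0 : n ≠ 0 := by rintro rfl; simp at hn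
  have hfr : Module.finrank ℝ (ℝ ∙ n)ᗮ = 2 := by
    have : Fact (Module.finrank ℝ Space3 = 2 + 1) := ⟨finrank_space3⟩
    exact Submodule.finrank_orthogonal_span_singleton hn0
  have h1 := InnerProductSpace.euclideanHausdorffMeasure_eq_volume (V := (ℝ ∙ n)ᗮ)
  rw [hfr] at h1
  have h2 : {w : Space3 | inner ℝ n w = 0} = range ((↑) : (ℝ ∙ n)ᗮ → Space3) := by
    ext w
    rw [Subtype.range_coe, SetLike.mem_coe, Submodule.mem_orthogonal_singleton_iff_inner_right]
    rfl
  have hem : MeasurableEmbedding ((↑) : (ℝ ∙ n)ᗮ → Space3) :=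
    MeasurableEmbedding.subtype_coe (Submodule.isClosed_orthogonal _).measurableSet
  have h3 : (Measure.euclideanHausdorffMeasure 2).map ((↑) : (ℝ ∙ n)ᗮ → Space3) =
      (Measure.euclideanHausdorffMeasure 2).restrict (range ((↑) : (ℝ ∙ n)ᗮ → Space3)) :=
    (ℝ ∙ n)ᗮ.subtypeₗᵢ.isometry.map_euclideanHausdorffMeasure
  rw [h2, ← h3, hem.lintegral_map, h1]

/-- This is the flat case of the coarea limit. The integral over the slice at height `t` is
continuous in `t`, and its averages over `(0, δ)` tend to its value at zero. -/
theorem tendsto_slab_average {n : Space3} (hn : ‖n‖ = 1) {k : Space3 → ℝ} (hk : Continuous k)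
    (hks : HasCompactSupport k) (hk0 : ∀ x, 0 ≤ k x) :
    Tendsto (fun δ : ℝ => ENNReal.ofReal δ⁻¹ *
      ∫⁻ w in {w | inner ℝ n w ∈ Ioo 0 δ}, ENNReal.ofReal (k w)) (𝓝[>] 0)
      (𝓝 (∫⁻ w in {w | inner ℝ n w = 0}, ENNReal.ofReal (k w)
        ∂(Measure.euclideanHausdorffMeasure 2))) := by
  obtain ⟨C, hC⟩ := hks.exists_bound_of_continuous hk
  obtain ⟨R, hR⟩ := hks.isCompact.isBounded.subset_closedBall (0 : Space3)
  have hnorm : ∀ (t : ℝ) (y : (ℝ ∙ n)ᗮ), inner ℝ n (t • n + (y : Space3)) = t := fun t y => by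
    rw [inner_add_right, inner_smul_right, real_inner_self_eq_norm_sq, hn,
      Submodule.mem_orthogonal_singleton_iff_inner_right.1 y.2]
    ring
  have hle : ∀ (t : ℝ) (y : (ℝ ∙ n)ᗮ), ‖y‖ ≤ ‖t • n + (y : Space3)‖ := fun t y => by
    have h1 : ‖t • n + (y : Space3)‖ ^ 2 = t ^ 2 + ‖y‖ ^ 2 := by
      rw [norm_add_sq_real, inner_smul_left,
        Submodule.mem_orthogonal_singleton_iff_inner_right.1 y.2, norm_smul, hn]
      simp
    exact le_of_sq_le_sq (by nlinarith [sq_nonneg t]) (norm_nonneg _)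
  have hbd : ∀ (t : ℝ) (y : (ℝ ∙ n)ᗮ), ‖k (t • n + y)‖ ≤
      (Metric.closedBall (0 : (ℝ ∙ n)ᗮ) R).indicator (fun _ => C) y := fun t y => by
    by_cases hy : y ∈ Metric.closedBall (0 : (ℝ ∙ n)ᗮ) R
    · rw [indicator_of_mem hy]; exact hC _
    · rw [indicator_of_notMem hy, image_eq_zero_of_notMem_tsupport (f := k), norm_zero]
      intro hc
      have h1 := hR hc
      rw [mem_closedBall_zero_iff] at h1 hy
      exact hy ((hle t y).trans h1)
  have hbi : Integrable ((Metric.closedBall (0 : (ℝ ∙ n)ᗮ) R).indicator (fun _ => C)) :=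
    (integrable_indicator_iff measurableSet_closedBall).2
      (integrableOn_const (isCompact_closedBall _ _).measure_lt_top.ne)
  have hm : ∀ t : ℝ, AEStronglyMeasurable (fun y : (ℝ ∙ n)ᗮ => k (t • n + y)) volume := fun t => by
    have : Continuous fun y : (ℝ ∙ n)ᗮ => k (t • n + y) := by fun_prop
    exact this.aestronglyMeasurable
  have hint : ∀ t : ℝ, Integrable (fun y : (ℝ ∙ n)ᗮ => k (t • n + y)) := fun t =>
    hbi.mono' (hm t) (Eventually.of_forall (hbd t))
  let I : ℝ → ℝ := fun t => ∫ y : (ℝ ∙ n)ᗮ, k (t • n + y)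
  have hI : Continuous I := continuous_of_dominated hm
    (fun t => Eventually.of_forall (hbd t)) hbi
    (Eventually.of_forall fun y => by fun_prop)
  have hI0 : ∀ t, 0 ≤ I t := fun t => integral_nonneg fun y => hk0 _
  have hlin : ∀ t, ∫⁻ y : (ℝ ∙ n)ᗮ, ENNReal.ofReal (k (t • n + y)) = ENNReal.ofReal (I t) :=
    fun t => (ofReal_integral_eq_lintegral_ofReal (hint t)
      (Eventually.of_forall fun y => hk0 _)).symm
  have hslab : ∀ δ : ℝ, 0 < δ → ENNReal.ofReal δ⁻¹ *
      ∫⁻ w in {w | inner ℝ n w ∈ Ioo 0 δ}, ENNReal.ofReal (k w) =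
      ENNReal.ofReal (δ⁻¹ * ∫ t in (0 : ℝ)..δ, I t) := fun δ hδ => by
    have hms : MeasurableSet {w : Space3 | inner ℝ n w ∈ Ioo 0 δ} :=
      measurableSet_Ioo.preimage (by fun_prop : Measurable fun w : Space3 => inner ℝ n w)
    rw [ENNReal.ofReal_mul (by positivity), ← lintegral_indicator hms,
      lintegral_eq_lintegral_slices hn ((by fun_prop : Measurable fun w => ENNReal.ofReal
        (k w)).indicator hms)]
    congr 1
    rw [intervalIntegral.integral_of_le hδ.le, integral_Ioc_eq_integral_Ioo,
      ofReal_integral_eq_lintegral_ofReal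
        (hI.integrableOn_Icc.mono_set Ioo_subset_Icc_self) (Eventually.of_forall hI0),
      ← lintegral_indicator measurableSet_Ioo]
    refine lintegral_congr fun t => ?_
    by_cases ht : t ∈ Ioo 0 δ
    · rw [indicator_of_mem ht, ← hlin]
      refine lintegral_congr fun y => indicator_of_mem ?_ _
      change inner ℝ n (t • n + (y : Space3)) ∈ Ioo 0 δ
      rwa [hnorm]
    · rw [indicator_of_notMem ht]
      refine (lintegral_congr fun y => indicator_of_notMem ?_ _).trans lintegral_zero
      change ¬ inner ℝ n (t • n + (y : Space3)) ∈ Ioo 0 δ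
      rwa [hnorm]
  rw [lintegral_plane hn]
  have h0 : ∫⁻ y : (ℝ ∙ n)ᗮ, ENNReal.ofReal (k y) = ENNReal.ofReal (I 0) := by
    rw [← hlin 0]; simp
  rw [h0]
  have hder : HasDerivAt (fun δ => ∫ t in (0 : ℝ)..δ, I t) (I 0) 0 :=
    intervalIntegral.integral_hasDerivAt_right (by simp) (hI.stronglyMeasurableAtFilter _ _)
      hI.continuousAt
  have hlim := (hasDerivAt_iff_tendsto_slope_zero.1 hder).mono_left
    (nhdsWithin_mono 0 (fun x (hx : 0 < x) => hx.ne') : 𝓝[>] (0 : ℝ) ≤ 𝓝[≠] 0)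
  refine (ENNReal.tendsto_ofReal hlim).congr' ?_
  filter_upwards [self_mem_nhdsWithin] with δ hδ
  rw [hslab δ hδ]
  simp

end area

section area

open scoped ENNReal NNReal

/-- Near a regular point a function is linear in a chart that is nearly an isometry. -/
theorem exists_level_chart {φ : Space3 → ℝ} {x₀ : Space3} (hφ : ContDiffAt ℝ 1 φ x₀)
    (h0 : gradient φ x₀ ≠ 0) {L : ℝ≥0} (hL : 1 < L) {U : Set Space3} (hU : U ∈ 𝓝 x₀) :
    ∃ (e : OpenPartialHomeomorph Space3 Space3) (n : Space3) (a : ℝ), x₀ ∈ e.source ∧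
      e.source ⊆ U ∧ ‖n‖ = 1 ∧ 0 < a ∧
      (∀ x ∈ e.source, φ x = φ x₀ + a * inner ℝ n (e x)) ∧
      LipschitzOnWith L e e.source ∧ LipschitzOnWith L e.symm e.target ∧
      (∀ x ∈ e.source, ‖gradient φ x‖ ≤ L * a ∧ a ≤ L * ‖gradient φ x‖) := by
  have hL1 : (1 : ℝ) < L := by exact_mod_cast hL
  set a := ‖gradient φ x₀‖ with ha
  have ha0 : 0 < a := norm_pos_iff.2 h0
  set n := a⁻¹ • gradient φ x₀ with hn
  have hn1 : ‖n‖ = 1 := by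
    rw [hn, norm_smul, norm_inv, Real.norm_of_nonneg ha0.le, ← ha, inv_mul_cancel₀ ha0.ne']
  have hstrict : HasStrictFDerivAt φ (fderiv ℝ φ x₀) x₀ := hφ.hasStrictFDerivAt one_ne_zero
  -- `G` replaces the `n`-component of `x - x₀` by `a⁻¹(φ x - φ x₀)`. To first order the two agree,
  -- so the derivative of `G` at `x₀` is the identity.
  let G : Space3 → Space3 := fun x =>
    (x - x₀) + (a⁻¹ * (φ x - φ x₀) - inner ℝ n (x - x₀)) • n
  have hGn : ∀ x, inner ℝ n (G x) = a⁻¹ * (φ x - φ x₀) := fun x => by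
    simp only [G]
    rw [inner_add_right, inner_smul_right, real_inner_self_eq_norm_sq, hn1]; ring
  have hGd : HasStrictFDerivAt G
      ((ContinuousLinearEquiv.refl ℝ Space3 : Space3 ≃L[ℝ] Space3) : Space3 →L[ℝ] Space3) x₀ := by
    have h1 : HasStrictFDerivAt (fun x : Space3 => x - x₀) (ContinuousLinearMap.id ℝ Space3) x₀ :=
      (hasStrictFDerivAt_id x₀).sub_const x₀
    have h2 := ((hstrict.sub_const (φ x₀)).const_mul a⁻¹).sub
      ((innerSL ℝ n).hasStrictFDerivAt.comp x₀ h1)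
    have h3 := h1.add (h2.smul_const n)
    refine h3.congr_fderiv ?_
    ext1 w
    have h4 : fderiv ℝ φ x₀ w = inner ℝ (gradient φ x₀) w := by
      rw [gradient, InnerProductSpace.toDual_symm_apply]
    have h5 : inner ℝ n w = a⁻¹ * fderiv ℝ φ x₀ w := by rw [hn, real_inner_smul_left, h4]
    simp [h5]
  -- An `ε`-perturbation of the identity has Lipschitz constant `1 + ε` and inverse constant `1/(1 -
  -- ε)`; `ε = (L - 1)/L` bounds both by `L`.
  obtain ⟨ε, hε0, hε1, hε2⟩ : ∃ ε : ℝ≥0, 0 < ε ∧ 1 + (ε : ℝ) ≤ L ∧ 1 ≤ L * (1 - (ε : ℝ)) := by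
    refine ⟨⟨((L : ℝ) - 1) / L, div_nonneg (by linarith) (by linarith)⟩, ?_, ?_, ?_⟩
    · exact NNReal.coe_pos.1 (div_pos (sub_pos.2 hL1) (by linarith))
    · change 1 + ((L : ℝ) - 1) / L ≤ L
      have : ((L : ℝ) - 1) / L ≤ L - 1 := div_le_self (by linarith) hL1.le
      linarith
    · change 1 ≤ (L : ℝ) * (1 - ((L : ℝ) - 1) / L)
      have : (L : ℝ) * (1 - ((L : ℝ) - 1) / L) = 1 := by field_simp; ring
      rw [this]
  obtain ⟨s, hs, hsε⟩ := hGd.approximates_deriv_on_nhds (c := ε) (Or.inr hε0)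
  have hgc : ContinuousAt (fun x => ‖gradient φ x‖) x₀ := by
    simp_rw [norm_gradient]
    exact (hφ.continuousAt_fderiv one_ne_zero).norm
  have hL2 : a < L * a := by nlinarith
  have hs2 : ∀ᶠ x in 𝓝 x₀, ‖gradient φ x‖ ≤ L * a ∧ a ≤ L * ‖gradient φ x‖ := by
    have h1 := hgc.eventually (gt_mem_nhds hL2)
    have h2 := (hgc.const_mul (L : ℝ)).eventually (lt_mem_nhds hL2)
    filter_upwards [h1, h2] with x h3 h4 using ⟨h3.le, h4.le⟩
  obtain ⟨N, hN, hNo, hxN⟩ := mem_nhds_iff.1 (Filter.inter_mem (Filter.inter_mem hs hs2) hU)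
  let e₀ := hGd.toOpenPartialHomeomorph G
  let e := e₀.restrOpen N hNo
  have hes : e.source ⊆ N := inter_subset_right
  have hlow : ∀ x ∈ e.source, ∀ y ∈ e.source, ‖G x - G y - (x - y)‖ ≤ ε * ‖x - y‖ :=
    fun x hx y hy => by simpa using hsε x (hN (hes hx)).1.1 y (hN (hes hy)).1.1
  refine ⟨e, n, a, ⟨hGd.mem_toOpenPartialHomeomorph_source, hxN⟩,
    fun x hx => (hN (hes hx)).2, hn1, ha0, ?_, ?_, ?_,
    fun x hx => (hN (hes hx)).1.2⟩
  · intro x hx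
    change _ = φ x₀ + a * inner ℝ n (G x)
    rw [hGn]; field_simp; ring
  · refine LipschitzOnWith.of_dist_le_mul fun x hx y hy => ?_
    change dist (G x) (G y) ≤ _
    rw [dist_eq_norm, dist_eq_norm]
    have h1 := hlow x hx y hy
    have h2 := norm_le_norm_add_norm_sub' (G x - G y) (x - y)
    nlinarith [norm_nonneg (x - y)]
  · refine LipschitzOnWith.of_dist_le_mul fun p hp q hq => ?_
    have h1 := hlow _ (e.map_target hp) _ (e.map_target hq)
    have hp' : G (e.symm p) = p := e.right_inv hp
    have hq' : G (e.symm q) = q := e.right_inv hq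
    rw [hp', hq'] at h1
    rw [dist_eq_norm, dist_eq_norm]
    have h2 := norm_le_norm_add_norm_sub (p - q) (e.symm p - e.symm q)
    have h3 := norm_nonneg (e.symm p - e.symm q)
    have h4 : ‖e.symm p - e.symm q‖ ≤ L * (1 - ε) * ‖e.symm p - e.symm q‖ := by nlinarith
    have h5 : (1 - (ε : ℝ)) * ‖e.symm p - e.symm q‖ ≤ ‖p - q‖ := by linarith
    calc _ ≤ _ := h4
      _ = L * ((1 - ε) * ‖e.symm p - e.symm q‖) := by ring
      _ ≤ _ := by gcongr

theorem continuous_indicator_comp_symm {X Y : Type*} [TopologicalSpace X] [TopologicalSpace Y]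
    [T2Space Y] (e : OpenPartialHomeomorph X Y) {k : X → ℝ} (hk : Continuous k)
    (hks : HasCompactSupport k) (hs : tsupport k ⊆ e.source) :
    Continuous (e.target.indicator (k ∘ e.symm)) ∧
      HasCompactSupport (e.target.indicator (k ∘ e.symm)) := by
  have hc : IsCompact (e '' tsupport k) := hks.isCompact.image_of_continuousOn
    (e.continuousOn.mono hs)
  have hzero : ∀ y ∉ e '' tsupport k, e.target.indicator (k ∘ e.symm) y = 0 := fun y hy => by
    by_cases hyt : y ∈ e.target
    · rw [indicator_of_mem hyt]
      by_contra hne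
      exact hy ⟨e.symm y, subset_tsupport _ hne, e.right_inv hyt⟩
    · exact indicator_of_notMem hyt _
  refine ⟨continuous_iff_continuousAt.2 fun y => ?_, HasCompactSupport.intro hc hzero⟩
  by_cases hyt : y ∈ e.target
  · refine (hk.continuousAt.comp (e.continuousAt_symm hyt)).congr ?_
    filter_upwards [e.open_target.mem_nhds hyt] with z hz
    exact (indicator_of_mem hz _).symm
  · have : y ∈ (e '' tsupport k)ᶜ := fun hy => by
      obtain ⟨x, hx, rfl⟩ := hy
      exact hyt (e.map_source (hs hx))
    refine (continuousAt_const (y := (0 : ℝ))).congr ?_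
    filter_upwards [hc.isClosed.isOpen_compl.mem_nhds this] with z hz
    exact (hzero z hz).symm

/-- Both directions are needed, with `d = 3` for slabs (where the measure is volume) and `d = 2` for
level surfaces. -/
theorem lintegral_chart_le (e : OpenPartialHomeomorph Space3 Space3) {L : ℝ≥0}
    (he : LipschitzOnWith L e e.source) (hs : LipschitzOnWith L e.symm e.target) (k : Space3 → ℝ)
    {B : Set Space3} (hB : MeasurableSet B) (hA : MeasurableSet (e.source ∩ e ⁻¹' B)) (d : ℕ) :
    ∫⁻ x in e.source ∩ e ⁻¹' B, ENNReal.ofReal (k x) ∂(Measure.euclideanHausdorffMeasure d) ≤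
      (L : ℝ≥0∞) ^ d * ∫⁻ y in B, ENNReal.ofReal (e.target.indicator (k ∘ e.symm) y)
        ∂(Measure.euclideanHausdorffMeasure d) ∧
    ∫⁻ y in B, ENNReal.ofReal (e.target.indicator (k ∘ e.symm) y)
        ∂(Measure.euclideanHausdorffMeasure d) ≤ (L : ℝ≥0∞) ^ d *
      ∫⁻ x in e.source ∩ e ⁻¹' B, ENNReal.ofReal (k x) ∂(Measure.euclideanHausdorffMeasure d) := by
  have e1 : ∫⁻ y in B, ENNReal.ofReal (e.target.indicator (k ∘ e.symm) y)
        ∂(Measure.euclideanHausdorffMeasure d) =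
      ∫⁻ y in e.target ∩ B, ENNReal.ofReal (k (e.symm y))
        ∂(Measure.euclideanHausdorffMeasure d) := by
    rw [← setLIntegral_indicator e.open_target.measurableSet]
    refine lintegral_congr fun y => ?_
    by_cases hy : y ∈ e.target
    · rw [indicator_of_mem hy, indicator_of_mem hy]; rfl
    · rw [indicator_of_notMem hy, indicator_of_notMem hy, ENNReal.ofReal_zero]
  have e2 : e '' (e.source ∩ e ⁻¹' B) = e.target ∩ B := by
    rw [e.image_source_inter_eq', e.target_inter_inv_preimage_preimage]
  have e3 : e.symm '' (e.target ∩ B) = e.source ∩ e ⁻¹' B :=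
    e.symm.image_source_inter_eq' B
  rw [e1]
  constructor
  · rw [← e3]
    exact lintegral_lipschitz_image_le (e.open_target.measurableSet.inter hB)
      (hs.mono inter_subset_left) d _
  · rw [← e2]
    refine (lintegral_lipschitz_image_le hA (he.mono inter_subset_left) d _).trans_eq ?_
    congr 1
    exact setLIntegral_congr_fun hA fun x hx => by simp only [e.left_inv hx.1]

/-- `I` and `ℓ` are the slab average and the plane integral in the chart, where the limit is already
known. The exponents count distortions: `5 = 3 + 2` from volume and `|∇φ|²`, `3 = 2 + 1` from area
and `|∇φ|`. -/
theorem exists_local_coarea {φ : Space3 → ℝ} {x₀ : Space3} (hφ : ContDiffAt ℝ 1 φ x₀)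
    (h0 : gradient φ x₀ ≠ 0) {L : ℝ≥0} (hL : 1 < L) {U : Set Space3} (hU : U ∈ 𝓝 x₀) :
    ∃ N : Set Space3, IsOpen N ∧ x₀ ∈ N ∧ N ⊆ U ∧ ∀ k : Space3 → ℝ, Continuous k → HasCompactSupport k →
      (∀ x, 0 ≤ k x) → tsupport k ⊆ N → ∃ (I : ℝ → ℝ≥0∞) (ℓ : ℝ≥0∞), Tendsto I (𝓝[>] 0) (𝓝 ℓ) ∧
      (∀ δ > 0,
        ENNReal.ofReal δ⁻¹ * ∫⁻ x in N ∩ {x | φ x ∈ Ioo (φ x₀) (φ x₀ + δ)},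
          ENNReal.ofReal (k x) * ENNReal.ofReal (‖gradient φ x‖ ^ 2) ≤ (L : ℝ≥0∞) ^ 5 * I δ ∧
        I δ ≤ (L : ℝ≥0∞) ^ 5 * (ENNReal.ofReal δ⁻¹ *
          ∫⁻ x in N ∩ {x | φ x ∈ Ioo (φ x₀) (φ x₀ + δ)},
            ENNReal.ofReal (k x) * ENNReal.ofReal (‖gradient φ x‖ ^ 2))) ∧
      ∫⁻ x in N ∩ {x | φ x = φ x₀}, ENNReal.ofReal (k x) * ENNReal.ofReal ‖gradient φ x‖
        ∂(Measure.euclideanHausdorffMeasure 2) ≤ (L : ℝ≥0∞) ^ 3 * ℓ ∧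
      ℓ ≤ (L : ℝ≥0∞) ^ 3 * ∫⁻ x in N ∩ {x | φ x = φ x₀},
        ENNReal.ofReal (k x) * ENNReal.ofReal ‖gradient φ x‖
          ∂(Measure.euclideanHausdorffMeasure 2) := by
  obtain ⟨e, n, a, hx₀, heU, hn, ha, hφe, he, hs, hgrad⟩ := exists_level_chart hφ h0 hL hU
  refine ⟨e.source, e.open_source, hx₀, heU, fun k hk hks hk0 hkN => ?_⟩
  obtain ⟨hk', hks'⟩ := continuous_indicator_comp_symm e hk hks hkN
  have hk'0 : ∀ y, 0 ≤ e.target.indicator (k ∘ e.symm) y :=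
    indicator_nonneg fun y _ => hk0 _
  have hlim := tendsto_slab_average hn hk' hks' hk'0
  set k' := e.target.indicator (k ∘ e.symm)
  have hinn : Continuous fun w : Space3 => inner ℝ n w := by fun_prop
  have hgm : Measurable fun x => ‖gradient φ x‖ := by
    simp_rw [norm_gradient]
    exact (measurable_fderiv ℝ φ).norm
  have hkm : Measurable fun x => ENNReal.ofReal (k x) := by fun_prop
  have hLa : ENNReal.ofReal (L * a) = L * ENNReal.ofReal a := by
    rw [ENNReal.ofReal_mul L.coe_nonneg, ENNReal.ofReal_coe_nnreal]
  have hg1 : ∀ x ∈ e.source, ENNReal.ofReal ‖gradient φ x‖ ≤ L * ENNReal.ofReal a := fun x hx => by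
    rw [← hLa]; exact ENNReal.ofReal_le_ofReal (hgrad x hx).1
  have hg2 : ∀ x ∈ e.source, ENNReal.ofReal a ≤ L * ENNReal.ofReal ‖gradient φ x‖ := fun x hx => by
    rw [← ENNReal.ofReal_coe_nnreal (p := L), ← ENNReal.ofReal_mul L.coe_nonneg]
    exact ENNReal.ofReal_le_ofReal (hgrad x hx).2
  -- In the chart `φ` has slope `a`, so a slab of values of width `δ` becomes a flat slab of
  -- thickness `δ/a`. Of the factor `a²` from `|∇φ|²`, one `a` enters the average and one remains.
  refine ⟨fun δ => ENNReal.ofReal a * (ENNReal.ofReal (δ / a)⁻¹ *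
    ∫⁻ w in {w | inner ℝ n w ∈ Ioo 0 (δ / a)}, ENNReal.ofReal (k' w)), ENNReal.ofReal a *
    ∫⁻ w in {w | inner ℝ n w = 0}, ENNReal.ofReal (k' w) ∂(Measure.euclideanHausdorffMeasure 2),
    ?_, ?_, ?_⟩
  · refine ENNReal.Tendsto.const_mul (hlim.comp ?_) (Or.inr ENNReal.ofReal_ne_top)
    refine tendsto_nhdsWithin_iff.2 ⟨?_, ?_⟩
    · have : Tendsto (fun δ : ℝ => δ / a) (𝓝 0) (𝓝 (0 / a)) := (continuous_id.div_const a).tendsto 0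
      rw [zero_div] at this
      exact this.mono_left nhdsWithin_le_nhds
    · filter_upwards [self_mem_nhdsWithin] with δ hδ using div_pos hδ ha
  · intro δ hδ
    have hBo : IsOpen {w : Space3 | inner ℝ n w ∈ Ioo 0 (δ / a)} := isOpen_Ioo.preimage hinn
    have hA : e.source ∩ {x | φ x ∈ Ioo (φ x₀) (φ x₀ + δ)} =
        e.source ∩ e ⁻¹' {w | inner ℝ n w ∈ Ioo 0 (δ / a)} := by
      ext x
      refine and_congr_right fun hx => ?_
      change φ x ∈ Ioo (φ x₀) (φ x₀ + δ) ↔ inner ℝ n (e x) ∈ Ioo 0 (δ / a)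
      rw [hφe x hx, mem_Ioo, mem_Ioo, lt_div_iff₀ ha]
      constructor
      · rintro ⟨h1, h2⟩
        exact ⟨pos_of_mul_pos_right (by linarith) ha.le, by linarith⟩
      · rintro ⟨h1, h2⟩
        exact ⟨by linarith [mul_pos ha h1], by linarith⟩
    have hAm : MeasurableSet (e.source ∩ e ⁻¹' {w | inner ℝ n w ∈ Ioo 0 (δ / a)}) :=
      (e.isOpen_inter_preimage hBo).measurableSet
    have hch := lintegral_chart_le e he hs k hBo.measurableSet hAm 3
    rw [EuclideanSpace.euclideanHausdorffMeasure_eq_volume] at hch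
    have hδa : ENNReal.ofReal (δ / a)⁻¹ = ENNReal.ofReal δ⁻¹ * ENNReal.ofReal a := by
      rw [← ENNReal.ofReal_mul (by positivity), inv_div, div_eq_inv_mul]
    beta_reduce
    rw [hA, hδa]
    set A := e.source ∩ e ⁻¹' {w | inner ℝ n w ∈ Ioo 0 (δ / a)}
    set Y := ∫⁻ w in {w | inner ℝ n w ∈ Ioo 0 (δ / a)}, ENNReal.ofReal (k' w)
    constructor
    · have h1 : ∫⁻ x in A, ENNReal.ofReal (k x) * ENNReal.ofReal (‖gradient φ x‖ ^ 2) ≤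
          (L * ENNReal.ofReal a) ^ 2 * ∫⁻ x in A, ENNReal.ofReal (k x) := by
        rw [← lintegral_const_mul _ hkm]
        refine setLIntegral_mono' hAm fun x hx => ?_
        rw [mul_comm, ENNReal.ofReal_pow (norm_nonneg _)]
        gcongr
        exact hg1 x hx.1
      calc _ ≤ ENNReal.ofReal δ⁻¹ * ((L * ENNReal.ofReal a) ^ 2 * (L ^ 3 * Y)) := by
            gcongr; exact h1.trans (mul_le_mul_right hch.1 _)
        _ = _ := by ring
    · have h1 : ENNReal.ofReal a ^ 2 * ∫⁻ x in A, ENNReal.ofReal (k x) ≤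
          L ^ 2 * ∫⁻ x in A, ENNReal.ofReal (k x) * ENNReal.ofReal (‖gradient φ x‖ ^ 2) := by
        rw [← lintegral_const_mul _ hkm, ← lintegral_const_mul _ (by fun_prop)]
        refine setLIntegral_mono' hAm fun x hx => ?_
        rw [ENNReal.ofReal_pow (norm_nonneg _), mul_left_comm, mul_comm, ← mul_pow]
        gcongr
        exact hg2 x hx.1
      calc ENNReal.ofReal a * (ENNReal.ofReal δ⁻¹ * ENNReal.ofReal a * Y)
          = ENNReal.ofReal δ⁻¹ * (ENNReal.ofReal a ^ 2 * Y) := by ring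
        _ ≤ ENNReal.ofReal δ⁻¹ * (ENNReal.ofReal a ^ 2 *
            (L ^ 3 * ∫⁻ x in A, ENNReal.ofReal (k x))) := by gcongr; exact hch.2
        _ = L ^ 3 * (ENNReal.ofReal δ⁻¹ * (ENNReal.ofReal a ^ 2 *
            ∫⁻ x in A, ENNReal.ofReal (k x))) := by ring
        _ ≤ L ^ 3 * (ENNReal.ofReal δ⁻¹ * (L ^ 2 *
            ∫⁻ x in A, ENNReal.ofReal (k x) * ENNReal.ofReal (‖gradient φ x‖ ^ 2))) := by gcongr
        _ = _ := by ring
  · have hBc : IsClosed {w : Space3 | inner ℝ n w = 0} := isClosed_eq hinn continuous_const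
    have hA : e.source ∩ {x | φ x = φ x₀} = e.source ∩ e ⁻¹' {w | inner ℝ n w = 0} := by
      ext x
      refine and_congr_right fun hx => ?_
      change φ x = φ x₀ ↔ inner ℝ n (e x) = 0
      rw [hφe x hx, add_eq_left, mul_eq_zero_iff_left ha.ne']
    have hAm : MeasurableSet (e.source ∩ e ⁻¹' {w | inner ℝ n w = 0}) := by
      have h1 := (e.isOpen_inter_preimage hBc.isOpen_compl).measurableSet
      have h2 : e.source ∩ e ⁻¹' {w | inner ℝ n w = 0} =
          e.source \ (e.source ∩ e ⁻¹' {w | inner ℝ n w = 0}ᶜ) := by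
        ext x; simp
      rw [h2]
      exact e.open_source.measurableSet.diff h1
    have hch := lintegral_chart_le e he hs k hBc.measurableSet hAm 2
    rw [hA]
    set A := e.source ∩ e ⁻¹' {w | inner ℝ n w = 0}
    set Y := ∫⁻ w in {w | inner ℝ n w = 0}, ENNReal.ofReal (k' w)
      ∂(Measure.euclideanHausdorffMeasure 2)
    constructor
    · have h1 : ∫⁻ x in A, ENNReal.ofReal (k x) * ENNReal.ofReal ‖gradient φ x‖
            ∂(Measure.euclideanHausdorffMeasure 2) ≤
          (L * ENNReal.ofReal a) * ∫⁻ x in A, ENNReal.ofReal (k x)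
            ∂(Measure.euclideanHausdorffMeasure 2) := by
        rw [← lintegral_const_mul _ hkm]
        refine setLIntegral_mono' hAm fun x hx => ?_
        rw [mul_comm]
        gcongr
        exact hg1 x hx.1
      calc _ ≤ (L * ENNReal.ofReal a) * (L ^ 2 * Y) := h1.trans (mul_le_mul_right hch.1 _)
        _ = _ := by ring
    · have h1 : ENNReal.ofReal a * ∫⁻ x in A, ENNReal.ofReal (k x)
            ∂(Measure.euclideanHausdorffMeasure 2) ≤
          L * ∫⁻ x in A, ENNReal.ofReal (k x) * ENNReal.ofReal ‖gradient φ x‖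
            ∂(Measure.euclideanHausdorffMeasure 2) := by
        rw [← lintegral_const_mul _ hkm, ← lintegral_const_mul _ (by fun_prop)]
        refine setLIntegral_mono' hAm fun x hx => ?_
        rw [mul_left_comm, mul_comm]
        gcongr
        exact hg2 x hx.1
      calc ENNReal.ofReal a * Y ≤ ENNReal.ofReal a * (L ^ 2 * ∫⁻ x in A, ENNReal.ofReal (k x)
            ∂(Measure.euclideanHausdorffMeasure 2)) := mul_le_mul_right hch.2 _
        _ = L ^ 2 * (ENNReal.ofReal a * ∫⁻ x in A, ENNReal.ofReal (k x)
            ∂(Measure.euclideanHausdorffMeasure 2)) := by ring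
        _ ≤ L ^ 2 * (L * ∫⁻ x in A, ENNReal.ofReal (k x) * ENNReal.ofReal ‖gradient φ x‖
            ∂(Measure.euclideanHausdorffMeasure 2)) := mul_le_mul_right h1 _
        _ = _ := by ring

end area

/-! ### Total flux through a regular level surface. -/

section flux

open scoped ENNReal NNReal

variable {f : Space3 → Space3} {ρ : Space3 → ℝ} {g v : ℝ}

theorem IsNormalizedSource.isCompact_sublevel (h : IsNormalizedSource f ρ)
    (hL : LevelEncloses v (sourceBody f) (newtonianPotential g f ρ)) {c : ℝ} (hc : c < 0) :
    IsCompact {x | x ∉ bagInterior v (sourceBody f) (newtonianPotential g f ρ) ∧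
      newtonianPotential g f ρ x ≤ c} := by
  have hΩo := h.isOpen_bagInterior hL
  have hcont := h.continuousOn_potential (g := g) (v := v)
  obtain ⟨T, hT, hTs⟩ := mem_cocompact.1
    ((h.tendsto_potential g).eventually (lt_mem_nhds hc))
  refine hT.of_isClosed_subset (hcont.preimage_isClosed_of_isClosed hΩo.isClosed_compl
    (isClosed_Iic (a := c))) fun x hx => ?_
  by_contra hxT
  exact absurd hx.2 (not_le.2 (hTs hxT : c < newtonianPotential g f ρ x))

theorem setLIntegral_inter_of_tsupport {X : Type*} [TopologicalSpace X] [MeasurableSpace X]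
    [BorelSpace X] (μ : Measure X) {N T : Set X} (hN : IsOpen N) {k : X → ℝ} (hk : tsupport k ⊆ N)
    (G : X → ℝ≥0∞) :
    ∫⁻ x in N ∩ T, ENNReal.ofReal (k x) * G x ∂μ = ∫⁻ x in T, ENNReal.ofReal (k x) * G x ∂μ := by
  rw [← setLIntegral_indicator hN.measurableSet]
  refine lintegral_congr fun x => ?_
  by_cases hx : x ∈ N
  · rw [indicator_of_mem hx]
  · rw [indicator_of_notMem hx, image_eq_zero_of_notMem_tsupport fun h => hx (hk h)]
    simp

/-- A partition of unity on a thin layer outside the surface glues the local comparisons. Divided by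
thickness, the layer's integral of `|∇φ|²` is exactly `4πg`; passing through the flat limit costs `5
+ 3 = 8` powers of `L`. -/
theorem IsNormalizedSource.surface_estimates (h : IsNormalizedSource f ρ) (hv : 0 < v)
    (hL : LevelEncloses v (sourceBody f) (newtonianPotential g f ρ))
    (hreg : LevelRegular v (sourceBody f) (newtonianPotential g f ρ)) {L : ℝ≥0} (hL1 : 1 < L) :
    ENNReal.ofReal (4 * π * g) ≤ (L : ℝ≥0∞) ^ 8 *
      ∫⁻ x in bagSurface v (sourceBody f) (newtonianPotential g f ρ),
        ENNReal.ofReal ‖gradient (newtonianPotential g f ρ) x‖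
          ∂(Measure.euclideanHausdorffMeasure 2) ∧
    ∫⁻ x in bagSurface v (sourceBody f) (newtonianPotential g f ρ),
        ENNReal.ofReal ‖gradient (newtonianPotential g f ρ) x‖
          ∂(Measure.euclideanHausdorffMeasure 2) ≤
      (L : ℝ≥0∞) ^ 8 * ENNReal.ofReal (4 * π * g) := by
  have hΩo := h.isOpen_bagInterior hL
  have hKo := h.isOpen_compl
  have hB := h.bounds hv hL
  have hsub := fun c hc => h.isCompact_sublevel hL (c := c) hc
  have hslab := fun δ (hδ : 0 ≤ δ) (hδv : -v + δ ≤ 0) =>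
    h.lintegral_slab hL (le_refl (-v)) (t := -v + δ) (by linarith) hδv
  have hcd := fun x (hx : x ∉ sourceBody f) => h.contDiffAt_potential g hx
  set φ := newtonianPotential g f ρ with hφ
  set Ω := bagInterior v (sourceBody f) φ with hΩ
  set S := bagSurface v (sourceBody f) φ with hS
  have hSΩ : ∀ x ∈ S, x ∉ Ω := fun x hx => notMem_bagInterior.2 ⟨hx.1, hx.2.ge⟩
  have hSc : IsCompact S := by
    rw [← hB.frontier_eq]
    exact Metric.isCompact_of_isClosed_isBounded isClosed_frontier
      (hB.isBounded.closure.subset frontier_subset_closure)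
  choose! N hNo hxN hNU hloc using fun x (hx : x ∈ S) =>
    exists_local_coarea ((hcd x hx.1).of_le (by norm_num : (1 : ℕ∞ω) ≤ ((⊤ : ℕ∞) : ℕ∞ω))) (hreg x hx) hL1
      (hKo.mem_nhds hx.1)
  obtain ⟨t, htS, hcov⟩ := hSc.elim_nhds_subcover N fun x hx => (hNo x hx).mem_nhds (hxN x hx)
  let p : Fin t.card → Space3 := fun i => (t.equivFin.symm i : Space3)
  have hpS : ∀ i, p i ∈ S := fun i => htS _ (t.equivFin.symm i).2
  have hcov' : S ⊆ ⋃ i, N (p i) := fun x hx => by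
    obtain ⟨y, hy, hxy⟩ := mem_iUnion₂.1 (hcov hx)
    exact mem_iUnion.2 ⟨t.equivFin ⟨y, hy⟩, by simpa [p] using hxy⟩
  have hUo : IsOpen (⋃ i, N (p i)) := isOpen_iUnion fun i => hNo _ (hpS i)
  have hcont : ContinuousOn φ Ωᶜ := fun x hx =>
    (hcd x (notMem_bagInterior.1 hx).1).continuousAt.continuousWithinAt
  -- On the compact part of the layer left uncovered, `φ` attains a minimum strictly above `-v`.
  -- Half the gap gives a layer inside the cover.
  obtain ⟨δ₀, hδ₀, hδ₀v, hQ⟩ : ∃ δ₀ : ℝ, 0 < δ₀ ∧ δ₀ < v ∧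
      {x | x ∉ Ω ∧ φ x ≤ -v + δ₀} ⊆ ⋃ i, N (p i) := by
    have hQ1 := (hsub (-v / 2) (by linarith)).diff hUo
    rcases ({x | x ∉ Ω ∧ φ x ≤ -v / 2} \ ⋃ i, N (p i)).eq_empty_or_nonempty with he | hne
    · refine ⟨v / 2, by linarith, by linarith, fun x hx => ?_⟩
      by_contra hxU
      have : x ∈ {x | x ∉ Ω ∧ φ x ≤ -v / 2} \ ⋃ i, N (p i) :=
        ⟨⟨hx.1, by linarith [hx.2]⟩, hxU⟩
      rw [he] at this
      exact this
    · obtain ⟨z, hz, hmin⟩ := hQ1.exists_isMinOn hne (hcont.mono fun x hx => hx.1.1)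
      have hzv : -v < φ z := by
        refine lt_of_le_of_ne (notMem_bagInterior.1 hz.1.1).2 fun heq => hz.2 (hcov' ?_)
        exact ⟨(notMem_bagInterior.1 hz.1.1).1, heq.symm⟩
      refine ⟨(φ z + v) / 2, by linarith, by linarith [hz.1.2], fun x hx => ?_⟩
      by_contra hxU
      have h1 : φ z ≤ φ x := hmin ⟨⟨hx.1, by linarith [hx.2, hz.1.2]⟩, hxU⟩
      linarith [hx.2]
  obtain ⟨k, hkN, hksum, hk01, hkc⟩ := exists_continuous_sum_one_of_isOpen_isCompact
    (fun i => hNo _ (hpS i)) (hsub (-v + δ₀) (by linarith)) hQ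
  choose I ℓ hIℓ hI hℓ1 hℓ2 using fun i => hloc (p i) (hpS i) (k i) (k i).continuous (hkc i)
    (fun x => (hk01 i x).1) (hkN i)
  have hφp : ∀ i, φ (p i) = -v := fun i => (hpS i).2
  simp only [hφp] at hI hℓ1 hℓ2
  have hgm : Measurable fun x => ‖gradient φ x‖ := by
    simp_rw [norm_gradient]
    exact (measurable_fderiv ℝ φ).norm
  have hsumone : ∀ x ∉ Ω, φ x ≤ -v + δ₀ → ∑ i, ENNReal.ofReal (k i x) = 1 := fun x hx hxδ => by
    have h1 := hksum (show x ∈ {x | x ∉ Ω ∧ φ x ≤ -v + δ₀} from ⟨hx, hxδ⟩)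
    rw [← ENNReal.ofReal_sum_of_nonneg fun i _ => (hk01 i x).1]
    simp only [Finset.sum_apply, Pi.one_apply] at h1
    rw [h1, ENNReal.ofReal_one]
  set F := ∫⁻ x in S, ENNReal.ofReal ‖gradient φ x‖ ∂(Measure.euclideanHausdorffMeasure 2)
  have hF : F = ∑ i, ∫⁻ x in N (p i) ∩ {x | φ x = -v}, ENNReal.ofReal (k i x) *
      ENNReal.ofReal ‖gradient φ x‖ ∂(Measure.euclideanHausdorffMeasure 2) := by
    have e1 : ∀ i, ∫⁻ x in N (p i) ∩ {x | φ x = -v}, ENNReal.ofReal (k i x) *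
        ENNReal.ofReal ‖gradient φ x‖ ∂(Measure.euclideanHausdorffMeasure 2) =
        ∫⁻ x in S, ENNReal.ofReal (k i x) *
          ENNReal.ofReal ‖gradient φ x‖ ∂(Measure.euclideanHausdorffMeasure 2) := fun i => by
      rw [← setLIntegral_inter_of_tsupport _ (T := S) (hNo _ (hpS i)) (hkN i)]
      congr 2
      ext x
      exact and_congr_right fun hx => ⟨fun hx2 => ⟨hNU _ (hpS i) hx, hx2⟩, fun hx2 => hx2.2⟩
    simp_rw [e1]
    rw [← lintegral_finsetSum _ fun i _ => by fun_prop]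
    refine setLIntegral_congr_fun hSc.measurableSet fun x hx => ?_
    rw [← Finset.sum_mul, hsumone x (hSΩ x hx) (by rw [hx.2]; linarith), one_mul]
  -- The slab identity makes the sum independent of `δ`, so it survives the limit `δ → 0`.
  have hT : ∀ δ > 0, δ ≤ δ₀ → ENNReal.ofReal (4 * π * g) = ∑ i, ENNReal.ofReal δ⁻¹ *
      ∫⁻ x in N (p i) ∩ {x | φ x ∈ Ioo (-v) (-v + δ)}, ENNReal.ofReal (k i x) *
        ENNReal.ofReal (‖gradient φ x‖ ^ 2) := fun δ hδ hδδ => by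
    set T := Ωᶜ ∩ {x | φ x ∈ Ioo (-v) (-v + δ)}
    have e1 : ∀ i, ∫⁻ x in N (p i) ∩ {x | φ x ∈ Ioo (-v) (-v + δ)}, ENNReal.ofReal (k i x) *
        ENNReal.ofReal (‖gradient φ x‖ ^ 2) =
        ∫⁻ x in T, ENNReal.ofReal (k i x) * ENNReal.ofReal (‖gradient φ x‖ ^ 2) := fun i => by
      rw [← setLIntegral_inter_of_tsupport volume (T := T) (hNo _ (hpS i)) (hkN i)]
      congr 2
      ext x
      exact and_congr_right fun hx => ⟨fun hx2 => ⟨notMem_bagInterior.2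
        ⟨hNU _ (hpS i) hx, hx2.1.le⟩, hx2⟩, fun hx2 => hx2.2⟩
    have hTo : IsOpen T := by
      refine isOpen_iff_mem_nhds.2 fun x hx => ?_
      have hxK := (notMem_bagInterior.1 hx.1).1
      filter_upwards [hKo.mem_nhds hxK, (hcd x hxK).continuousAt.eventually
        (isOpen_Ioo.mem_nhds hx.2)] with y h1 h2
      exact ⟨notMem_bagInterior.2 ⟨h1, h2.1.le⟩, h2⟩
    simp_rw [e1]
    rw [← Finset.mul_sum, ← lintegral_finsetSum _ fun i _ => by fun_prop]
    have e2 : ∫⁻ x in T, ∑ i, ENNReal.ofReal (k i x) * ENNReal.ofReal (‖gradient φ x‖ ^ 2) =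
        ∫⁻ x in T, ENNReal.ofReal (‖gradient φ x‖ ^ 2) := by
      refine setLIntegral_congr_fun hTo.measurableSet fun x hx => ?_
      rw [← Finset.sum_mul, hsumone x hx.1 (by linarith [hx.2.2]), one_mul]
    rw [e2, hslab δ hδ.le (by linarith), ← ENNReal.ofReal_mul (by positivity)]
    congr 1
    field_simp
    ring
  have hIsum : Tendsto (fun δ => ∑ i, I i δ) (𝓝[>] 0) (𝓝 (∑ i, ℓ i)) :=
    tendsto_finsetSum _ fun i _ => hIℓ i
  have hev : ∀ᶠ δ in 𝓝[>] (0 : ℝ), 0 < δ ∧ δ ≤ δ₀ := by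
    filter_upwards [self_mem_nhdsWithin, nhdsWithin_le_nhds (Iic_mem_nhds hδ₀)] with δ h1 h2
      using ⟨h1, h2⟩
  constructor
  · have h1 : ENNReal.ofReal (4 * π * g) ≤ (L : ℝ≥0∞) ^ 5 * ∑ i, ℓ i := by
      refine ge_of_tendsto (ENNReal.Tendsto.const_mul hIsum (Or.inr (by finiteness))) ?_
      filter_upwards [hev] with δ hδ
      rw [hT δ hδ.1 hδ.2, Finset.mul_sum]
      exact Finset.sum_le_sum fun i _ => (hI i δ hδ.1).1
    have h2 : ∑ i, ℓ i ≤ (L : ℝ≥0∞) ^ 3 * F := by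
      rw [hF, Finset.mul_sum]
      exact Finset.sum_le_sum fun i _ => hℓ2 i
    calc _ ≤ _ := h1
      _ ≤ (L : ℝ≥0∞) ^ 5 * ((L : ℝ≥0∞) ^ 3 * F) := mul_le_mul_right h2 _
      _ = _ := by ring
  · have h1 : ∑ i, ℓ i ≤ (L : ℝ≥0∞) ^ 5 * ENNReal.ofReal (4 * π * g) := by
      refine le_of_tendsto hIsum ?_
      filter_upwards [hev] with δ hδ
      rw [hT δ hδ.1 hδ.2, Finset.mul_sum]
      exact Finset.sum_le_sum fun i _ => (hI i δ hδ.1).2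
    have h2 : F ≤ (L : ℝ≥0∞) ^ 3 * ∑ i, ℓ i := by
      rw [hF, Finset.mul_sum]
      exact Finset.sum_le_sum fun i _ => hℓ1 i
    calc _ ≤ _ := h2
      _ ≤ (L : ℝ≥0∞) ^ 3 * ((L : ℝ≥0∞) ^ 5 * ENNReal.ofReal (4 * π * g)) :=
        mul_le_mul_right h1 _
      _ = _ := by ring

/-- The total flux of the field through a regular level surface. -/
theorem IsNormalizedSource.lintegral_surface (h : IsNormalizedSource f ρ) (hv : 0 < v)
    (hL : LevelEncloses v (sourceBody f) (newtonianPotential g f ρ))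
    (hreg : LevelRegular v (sourceBody f) (newtonianPotential g f ρ)) :
    ∫⁻ x in bagSurface v (sourceBody f) (newtonianPotential g f ρ),
        ENNReal.ofReal ‖gradient (newtonianPotential g f ρ) x‖
          ∂(Measure.euclideanHausdorffMeasure 2) = ENNReal.ofReal (4 * π * g) := by
  have hest := fun L hL1 => h.surface_estimates hv hL hreg (L := L) hL1
  set F := ∫⁻ x in bagSurface v (sourceBody f) (newtonianPotential g f ρ),
        ENNReal.ofReal ‖gradient (newtonianPotential g f ρ) x‖
          ∂(Measure.euclideanHausdorffMeasure 2)
  have hFtop : F ≠ ⊤ := ne_top_of_le_ne_top (by finiteness) (hest 2 (by norm_num)).2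
  have hlim : ∀ c : ℝ≥0∞, c ≠ ⊤ →
      Tendsto (fun L : ℝ≥0 => (L : ℝ≥0∞) ^ 8 * c) (𝓝[>] 1) (𝓝 c) := fun c hc => by
    have h1 : Tendsto (fun L : ℝ≥0 => (L : ℝ≥0∞) ^ 8 * c) (𝓝 1) (𝓝 (((1 : ℝ≥0) : ℝ≥0∞) ^ 8 * c)) :=
      ENNReal.Tendsto.mul_const ((ENNReal.continuous_pow 8).tendsto _ |>.comp
        (ENNReal.continuous_coe.tendsto 1)) (Or.inr hc)
    simpa using h1.mono_left nhdsWithin_le_nhds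
  -- The estimates hold for every `L > 1`; let `L` decrease to one.
  refine le_antisymm (ge_of_tendsto (hlim _ ENNReal.ofReal_ne_top) ?_)
    (ge_of_tendsto (hlim _ hFtop) ?_)
  · filter_upwards [self_mem_nhdsWithin] with L hL using (hest L hL).2
  · filter_upwards [self_mem_nhdsWithin] with L hL using (hest L hL).1

end flux

/-! ### The bag and its mass. -/

section bag

variable {f : Space3 → Space3} {ρ : Space3 → ℝ} {g v : ℝ}

theorem inner_gradient_normalized (φ : Space3 → ℝ) (x : Space3) :
    inner ℝ (gradient φ x) (‖gradient φ x‖⁻¹ • gradient φ x) = ‖gradient φ x‖ := by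
  rw [inner_smul_right, real_inner_self_eq_norm_sq]
  by_cases h : ‖gradient φ x‖ = 0
  · simp [h]
  · field_simp

/-- The Higgs field `v + φ` itself serves as the local defining function. -/
theorem IsNormalizedSource.isOutwardUnitNormal (h : IsNormalizedSource f ρ) (hv : 0 < v)
    (hL : LevelEncloses v (sourceBody f) (newtonianPotential g f ρ))
    (hreg : LevelRegular v (sourceBody f) (newtonianPotential g f ρ)) :
    IsOutwardUnitNormal (bagInterior v (sourceBody f) (newtonianPotential g f ρ))
      fun x => ‖gradient (newtonianPotential g f ρ) x‖⁻¹ •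
        gradient (newtonianPotential g f ρ) x := by
  intro x hx
  rw [(h.bounds hv hL).frontier_eq] at hx
  have hne := hreg x hx
  have hn : ‖gradient (newtonianPotential g f ρ) x‖ ≠ 0 := norm_ne_zero_iff.2 hne
  refine ⟨by rw [norm_smul, norm_inv, norm_norm, inv_mul_cancel₀ hn],
    fun y => v + newtonianPotential g f ρ y, ‖gradient (newtonianPotential g f ρ) x‖,
    contDiffAt_const.add (h.contDiffAt_potential g hx.1), norm_pos_iff.2 hne, ?_, ?_, ?_⟩
  · rw [gradient_const_add, smul_smul, mul_inv_cancel₀ hn, one_smul]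
  · filter_upwards [h.isOpen_compl.mem_nhds hx.1] with y hy
    constructor
    · rintro (h1 | h1)
      · exact absurd h1 hy
      · have : newtonianPotential g f ρ y < -v := h1
        linarith
    · intro h1
      exact Or.inr (by change newtonianPotential g f ρ y < -v; linarith)
  · filter_upwards [h.isOpen_compl.mem_nhds hx.1] with y hy
    rw [(h.bounds hv hL).frontier_eq]
    exact ⟨fun h1 => by linarith [h1.2], fun h1 => ⟨hy, by linarith⟩⟩

theorem IsNormalizedSource.isMagneticBag (h : IsNormalizedSource f ρ) (hg : 0 < g) (hv : 0 < v)
    (hL : LevelEncloses v (sourceBody f) (newtonianPotential g f ρ))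
    (hreg : LevelRegular v (sourceBody f) (newtonianPotential g f ρ)) :
    IsMagneticBag g v (bagSurface v (sourceBody f) (newtonianPotential g f ρ))
      (bagInterior v (sourceBody f) (newtonianPotential g f ρ)) (newtonianPotential g f ρ)
      fun x => v + newtonianPotential g f ρ x := by
  have hharm : InnerProductSpace.HarmonicOnNhd (newtonianPotential g f ρ)
      (bagInterior v (sourceBody f) (newtonianPotential g f ρ))ᶜ :=
    (h.harmonicOnNhd_potential g).mono fun x hx => (notMem_bagInterior.1 hx).1
  have hgm : Measurable fun x => ‖gradient (newtonianPotential g f ρ) x‖ := by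
    simp_rw [norm_gradient]
    exact (measurable_fderiv ℝ _).norm
  have hflux := h.lintegral_surface hv hL hreg
  refine ⟨h.bounds hv hL, hharm, fun x hx => ?_, ⟨-v, fun x hx => hx.2⟩,
    ⟨_, h.isOutwardUnitNormal hv hL hreg, ?_, ?_⟩, h.tendsto_potential g,
    fun x hx => by rw [hx.2, add_neg_cancel], ?_⟩
  · exact (InnerProductSpace.harmonicAt_const v).add (hharm x hx)
  · simp_rw [inner_gradient_normalized]
    refine ⟨hgm.aestronglyMeasurable, ?_⟩
    rw [hasFiniteIntegral_iff_ofReal (Eventually.of_forall fun x => norm_nonneg _), hflux]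
    exact ENNReal.ofReal_lt_top
  · simp_rw [inner_gradient_normalized]
    rw [integral_eq_lintegral_of_nonneg_ae (Eventually.of_forall fun x => norm_nonneg _)
      hgm.aestronglyMeasurable, hflux, ENNReal.toReal_ofReal (by positivity)]
  · simpa using (h.tendsto_potential g).const_add v

theorem IsNormalizedSource.bagMass_eq (h : IsNormalizedSource f ρ) (hg : 0 < g) (hv : 0 < v)
    (hL : LevelEncloses v (sourceBody f) (newtonianPotential g f ρ)) :
    bagMass (bagInterior v (sourceBody f) (newtonianPotential g f ρ)) (newtonianPotential g f ρ)
      (fun x => v + newtonianPotential g f ρ x) = 4 * π * g * v := by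
  have h1 := (h.energy hg hv hL).2
  rw [bagMass, exteriorEnergy, exteriorEnergy, energyDensity_const_add]
  rw [exteriorEnergy] at h1
  rw [h1]; ring

theorem IsNormalizedSource.bag_of_encloses (h : IsNormalizedSource f ρ) (hg : 0 < g) (hv : 0 < v)
    {K S Ω : Set Space3} {φ φH : Space3 → ℝ} (hK : K = sourceBody f)
    (hφ : φ = newtonianPotential g f ρ) (hφH : φH = fun x => v + φ x)
    (hS : S = bagSurface v K φ) (hΩ : Ω = bagInterior v K φ) (hL : LevelEncloses v K φ) :
    Bounds S Ω ∧ (LevelRegular v K φ → IsMagneticBag g v S Ω φ φH) ∧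
      (∀ x ∉ Ω, gradient φ x = gradient φH x) ∧ IntegrableOn (energyDensity φ) (closure Ω)ᶜ ∧
      IntegrableOn (energyDensity φH) (closure Ω)ᶜ ∧ exteriorEnergy Ω φ = 2 * π * g * v ∧
      exteriorEnergy Ω φH = 2 * π * g * v ∧ bagMass Ω φ φH = 4 * π * g * v := by
  subst hK hφ hφH hS hΩ
  obtain ⟨h1, h2⟩ := h.energy hg hv hL
  refine ⟨h.bounds hv hL, h.isMagneticBag hg hv hL, fun x _ => by rw [gradient_const_add], h1, ?_,
    h2, ?_, h.bagMass_eq hg hv hL⟩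
  · rwa [energyDensity_const_add]
  · rwa [exteriorEnergy, energyDensity_const_add]

end bag

/-! ### Sources of one sign. -/

section positive

variable {f : Space3 → Space3} {ρ : Space3 → ℝ} {g v : ℝ}

theorem fderiv_inv_norm_apply {w : Space3} (hw : w ≠ 0) (e : Space3) :
    fderiv ℝ (fun w : Space3 => ‖w‖⁻¹) w e = -(inner ℝ w e / ‖w‖ ^ 3) := by
  have hn : ‖w‖ ≠ 0 := norm_ne_zero_iff.2 hw
  have h1 : HasFDerivAt (fun w : Space3 => ‖w‖) (fderiv ℝ (fun w : Space3 => ‖w‖) w) w :=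
    ((contDiffAt_norm ℝ hw).differentiableAt (n := 1) (by norm_num)).hasFDerivAt
  have h2 : fderiv ℝ (fun w : Space3 => ‖w‖) w e = inner ℝ w e / ‖w‖ := by
    have h3 := DFunLike.congr_fun ((h1.pow 2).unique (hasStrictFDerivAt_norm_sq w).hasFDerivAt) e
    simp at h3
    field_simp
    linarith
  have h4 := (hasDerivAt_inv hn).comp_hasFDerivAt w h1
  have h5 : fderiv ℝ (fun w : Space3 => ‖w‖⁻¹) w = _ := h4.fderiv
  rw [h5]
  simp only [smul_apply, smul_eq_mul, h2]
  field_simp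

theorem IsNormalizedSource.integrable_mul_comp (h : IsNormalizedSource f ρ) {q : Space3 → ℝ}
    (hq : ContinuousOn q (sourceBody f)) : IntegrableOn (fun y => ρ y * q (f y)) unitBall3 :=
  h.integrableOn.mul_continuousOn (hq.comp h.continuousOn fun _ hy => mem_image_of_mem f hy)
    isCompact_unitBall3

/-- For `ρ ≥ 0` the source is a probability weight, so pointwise bounds on the kernel become bounds
on the potential. -/
theorem IsNormalizedSource.le_average (h : IsNormalizedSource f ρ) (hρ : ∀ y ∈ unitBall3, 0 ≤ ρ y)
    {q : Space3 → ℝ} (hq : ContinuousOn q (sourceBody f)) {c : ℝ}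
    (hc : ∀ z ∈ sourceBody f, c ≤ q z) : c ≤ ∫ y in unitBall3, ρ y * q (f y) := by
  have h1 : ∫ y in unitBall3, ρ y * c = c := by
    rw [integral_mul_const, h.integral_eq_one, one_mul]
  rw [← h1]
  exact setIntegral_mono_on (h.integrableOn.mul_const c) (h.integrable_mul_comp hq)
    measurableSet_unitBall3 fun y hy =>
      mul_le_mul_of_nonneg_left (hc _ (mem_image_of_mem f hy)) (hρ y hy)

theorem IsNormalizedSource.average_le (h : IsNormalizedSource f ρ) (hρ : ∀ y ∈ unitBall3, 0 ≤ ρ y)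
    {q : Space3 → ℝ} (hq : ContinuousOn q (sourceBody f)) {c : ℝ}
    (hc : ∀ z ∈ sourceBody f, q z ≤ c) : ∫ y in unitBall3, ρ y * q (f y) ≤ c := by
  have h1 : ∫ y in unitBall3, ρ y * c = c := by
    rw [integral_mul_const, h.integral_eq_one, one_mul]
  rw [← h1]
  exact setIntegral_mono_on (h.integrable_mul_comp hq) (h.integrableOn.mul_const c)
    measurableSet_unitBall3 fun y hy =>
      mul_le_mul_of_nonneg_left (hc _ (mem_image_of_mem f hy)) (hρ y hy)

theorem sub_ne_zero_of_notMem {K : Set Space3} {x z : Space3} (hx : x ∉ K) (hz : z ∈ K) :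
    x - z ≠ 0 := sub_ne_zero.2 fun hxz => hx (hxz ▸ hz)

theorem continuousOn_inv_norm_sub {K : Set Space3} {x : Space3} (hx : x ∉ K) :
    ContinuousOn (fun z => ‖x - z‖⁻¹) K :=
  (by fun_prop : Continuous fun z : Space3 => ‖x - z‖).continuousOn.inv₀ fun _ hz =>
    norm_ne_zero_iff.2 (sub_ne_zero_of_notMem hx hz)

theorem IsNormalizedSource.potential_le (h : IsNormalizedSource f ρ) (hg : 0 < g)
    (hρ : ∀ y ∈ unitBall3, 0 ≤ ρ y) {x : Space3} (hx : x ∉ sourceBody f) {d : ℝ}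
    (hd : ∀ z ∈ sourceBody f, ‖x - z‖ ≤ d) : newtonianPotential g f ρ x ≤ -(g / d) := by
  have h1 := h.le_average hρ (continuousOn_inv_norm_sub hx) (c := d⁻¹) fun z hz =>
    inv_anti₀ (norm_pos_iff.2 (sub_ne_zero_of_notMem hx hz)) (hd z hz)
  rw [newtonianPotential_eq_mul, div_eq_mul_inv]
  nlinarith

theorem IsNormalizedSource.le_potential (h : IsNormalizedSource f ρ) (hg : 0 < g)
    (hρ : ∀ y ∈ unitBall3, 0 ≤ ρ y) {x : Space3} {d : ℝ} (hd0 : 0 < d)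
    (hd : ∀ z ∈ sourceBody f, d ≤ ‖x - z‖) : -(g / d) ≤ newtonianPotential g f ρ x := by
  have hx : x ∉ sourceBody f := fun hx => by
    have := hd x hx
    rw [sub_self, norm_zero] at this
    linarith
  have h1 := h.average_le hρ (continuousOn_inv_norm_sub hx) (c := d⁻¹) fun z hz =>
    inv_anti₀ hd0 (hd z hz)
  rw [newtonianPotential_eq_mul, div_eq_mul_inv]
  nlinarith

/-- The level surface of a positive source lies in a shell. -/
theorem IsNormalizedSource.norm_mem_of_mem_bagSurface (h : IsNormalizedSource f ρ) (hg : 0 < g)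
    (hv : 0 < v) (hρ : ∀ y ∈ unitBall3, 0 ≤ ρ y) {M : ℝ} (hM : ∀ z ∈ sourceBody f, ‖z‖ ≤ M)
    {x : Space3} (hx : x ∈ bagSurface v (sourceBody f) (newtonianPotential g f ρ)) :
    g / v - M ≤ ‖x‖ ∧ ‖x‖ ≤ g / v + M := by
  have hgv : 0 < g / v := div_pos hg hv
  constructor
  · have h1 := h.potential_le hg hρ hx.1 (d := ‖x‖ + M) fun z hz =>
      (norm_sub_le x z).trans (by linarith [hM z hz])
    rw [hx.2] at h1
    obtain ⟨z, hz⟩ := nonempty_sourceBody f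
    have h2 : 0 < ‖x‖ + M := (norm_pos_iff.2 (sub_ne_zero_of_notMem hx.1 hz)).trans_le
      ((norm_sub_le x z).trans (by linarith [hM z hz]))
    have h3 : g / (‖x‖ + M) ≤ v := by linarith
    rw [div_le_iff₀ h2] at h3
    have h4 : g / v ≤ ‖x‖ + M := by rw [div_le_iff₀ hv]; linarith
    linarith
  · by_contra! hlt
    have h2 : 0 < ‖x‖ - M := by linarith
    have h1 := h.le_potential hg hρ h2 fun z hz =>
      (by linarith [hM z hz] : ‖x‖ - M ≤ ‖x‖ - ‖z‖).trans (norm_sub_norm_le x z)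
    rw [hx.2] at h1
    have h3 : v ≤ g / (‖x‖ - M) := by linarith
    rw [le_div_iff₀ h2] at h3
    have h4 : ‖x‖ - M ≤ g / v := by rw [le_div_iff₀ hv]; linarith
    linarith

/-- When `‖x‖ < g/v - M` every source point is nearer than `g/v`, which forces `φ < -v`. That ball
contains the source because `M < g/v - M`. -/
theorem IsNormalizedSource.levelEncloses_of_norm_lt (h : IsNormalizedSource f ρ) (hg : 0 < g)
    (hv : 0 < v) (hρ : ∀ y ∈ unitBall3, 0 ≤ ρ y) {M : ℝ} (hM : ∀ z ∈ sourceBody f, ‖z‖ ≤ M)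
    (hMg : 2 * M < g / v) : LevelEncloses v (sourceBody f) (newtonianPotential g f ρ) := by
  have h1 : {x : Space3 | ‖x‖ < g / v - M} ∈ 𝓝ˢ (sourceBody f) :=
    (isOpen_lt continuous_norm continuous_const).mem_nhdsSet.2 fun z hz => by
      have := hM z hz
      change ‖z‖ < g / v - M
      linarith
  filter_upwards [h1] with x hx hxK
  have hx : ‖x‖ < g / v - M := hx
  have h2 := h.potential_le hg hρ hxK (d := ‖x‖ + M) fun z hz =>
      (norm_sub_le x z).trans (by linarith [hM z hz])
  obtain ⟨z, hz⟩ := nonempty_sourceBody f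
  have h3 : 0 < ‖x‖ + M := (norm_pos_iff.2 (sub_ne_zero_of_notMem hxK hz)).trans_le
    ((norm_sub_le x z).trans (by linarith [hM z hz]))
  have h4 : v < g / (‖x‖ + M) := by
    rw [lt_div_iff₀ h3]
    have : ‖x‖ + M < g / v := by linarith
    rw [lt_div_iff₀ hv] at this
    linarith
  linarith

/-- The derivative in direction `x` is `g` times the average of `⟨x - z, x⟩/‖x - z‖³`, and `⟨x - z,
x⟩ ≥ ‖x‖(‖x‖ - M) > 0`. -/
theorem IsNormalizedSource.gradient_potential_ne_zero (h : IsNormalizedSource f ρ) (hg : 0 < g)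
    (hρ : ∀ y ∈ unitBall3, 0 ≤ ρ y) {M : ℝ} (hM : ∀ z ∈ sourceBody f, ‖z‖ ≤ M)
    {x : Space3} (hx : M < ‖x‖) : gradient (newtonianPotential g f ρ) x ≠ 0 := by
  have hxK : x ∉ sourceBody f := fun hxK => absurd (hM x hxK) (not_le.2 hx)
  have hM0 : 0 ≤ M := by
    obtain ⟨z, hz⟩ := nonempty_sourceBody f
    exact (norm_nonneg z).trans (hM z hz)
  have hx0 : 0 < ‖x‖ := hM0.trans_lt hx
  intro h0
  have h1 : fderiv ℝ (newtonianPotential g f ρ) x x = 0 := by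
    have : ‖fderiv ℝ (newtonianPotential g f ρ) x‖ = 0 := by rw [← norm_gradient, h0, norm_zero]
    rw [norm_eq_zero.1 this]; rfl
  rw [h.fderiv_potential_apply g hxK] at h1
  have hq : ContinuousOn (fun z => inner ℝ (x - z) x / ‖x - z‖ ^ 3) (sourceBody f) := by
    refine ContinuousOn.div (by fun_prop) (by fun_prop) fun z hz => ?_
    exact pow_ne_zero _ (norm_ne_zero_iff.2 (sub_ne_zero_of_notMem hxK hz))
  have hc : 0 < ‖x‖ * (‖x‖ - M) / (‖x‖ + M) ^ 3 := by
    have : 0 < ‖x‖ - M := by linarith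
    positivity
  have h2 := h.le_average hρ hq (c := ‖x‖ * (‖x‖ - M) / (‖x‖ + M) ^ 3) fun z hz => by
    have hz0 := norm_pos_iff.2 (sub_ne_zero_of_notMem hxK hz)
    have h3 : ‖x‖ * (‖x‖ - M) ≤ inner ℝ (x - z) x := by
      rw [inner_sub_left, real_inner_self_eq_norm_sq]
      have h4 := real_inner_le_norm z x
      nlinarith [hM z hz]
    have h5 : ‖x - z‖ ≤ ‖x‖ + M := (norm_sub_le x z).trans (by linarith [hM z hz])
    have h6 : 0 ≤ ‖x‖ * (‖x‖ - M) := mul_nonneg hx0.le (by linarith)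
    exact div_le_div₀ (h6.trans h3) h3 (by positivity) (by gcongr)
  have h3 : ∫ y in unitBall3, ρ y * fderiv ℝ (fun w : Space3 => ‖w‖⁻¹) (x - f y) x =
      -∫ y in unitBall3, ρ y * (inner ℝ (x - f y) x / ‖x - f y‖ ^ 3) := by
    rw [← integral_neg]
    refine setIntegral_congr_fun measurableSet_unitBall3 fun y hy => ?_
    rw [fderiv_inv_norm_apply (sub_ne_zero_of_notMem hxK (mem_image_of_mem f hy))]
    ring
  rw [h3] at h1
  nlinarith [mul_pos hg (hc.trans_le h2)]

theorem IsNormalizedSource.levelRegular_of_norm_lt (h : IsNormalizedSource f ρ) (hg : 0 < g)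
    (hv : 0 < v) (hρ : ∀ y ∈ unitBall3, 0 ≤ ρ y) {M : ℝ} (hM : ∀ z ∈ sourceBody f, ‖z‖ ≤ M)
    (hMg : 2 * M < g / v) : LevelRegular v (sourceBody f) (newtonianPotential g f ρ) :=
  fun _ hx => h.gradient_potential_ne_zero hg hρ hM
    (by linarith [(h.norm_mem_of_mem_bagSurface hg hv hρ hM hx).1])

theorem IsNormalizedSource.const_smul (h : IsNormalizedSource f ρ) (l : ℝ) :
    IsNormalizedSource (fun y => l • f y) ρ :=
  ⟨h.continuousOn.const_smul l, h.integrableOn, h.integral_eq_one⟩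

theorem norm_le_of_mem_sourceBody_smul {M l : ℝ} (hl : 0 ≤ l) (hM : ∀ z ∈ sourceBody f, ‖z‖ ≤ M) :
    ∀ z ∈ sourceBody (fun y => l • f y), ‖z‖ ≤ l * M := by
  rintro _ ⟨y, hy, rfl⟩
  rw [norm_smul, Real.norm_of_nonneg hl]
  exact mul_le_mul_of_nonneg_left (hM _ (mem_image_of_mem f hy)) hl

theorem eventually_mul_lt (M : ℝ) {c : ℝ} (hc : 0 < c) : ∀ᶠ l : ℝ in 𝓝[>] 0, l * M < c := by
  have : Tendsto (fun l : ℝ => l * M) (𝓝 0) (𝓝 (0 * M)) := tendsto_id.mul_const M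
  rw [zero_mul] at this
  exact nhdsWithin_le_nhds (this.eventually (gt_mem_nhds hc))

theorem IsNormalizedSource.eventually_encloses_and_regular (h : IsNormalizedSource f ρ)
    (hg : 0 < g) (hv : 0 < v) (hρ : ∀ y ∈ unitBall3, 0 ≤ ρ y) :
    ∀ᶠ l : ℝ in 𝓝[>] 0, LevelEncloses v (sourceBody fun y => l • f y)
      (newtonianPotential g (fun y => l • f y) ρ) ∧
    LevelRegular v (sourceBody fun y => l • f y)
      (newtonianPotential g (fun y => l • f y) ρ) := by
  obtain ⟨M, hM0, hM⟩ := h.exists_norm_bound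
  filter_upwards [eventually_mul_lt M (half_pos (div_pos hg hv)), self_mem_nhdsWithin] with l hl hl0
  have hl' : 2 * (l * M) < g / v := by linarith
  have hMl := norm_le_of_mem_sourceBody_smul (le_of_lt hl0) hM
  exact ⟨(h.const_smul l).levelEncloses_of_norm_lt hg hv hρ hMl hl',
    (h.const_smul l).levelRegular_of_norm_lt hg hv hρ hMl hl'⟩

end positive

/-! ### A spherical level surface forces the quadrupole moment to vanish. -/

section quadrupole

variable {f : Space3 → Space3} {ρ : Space3 → ℝ} {g v : ℝ}

/-- If the level surface lies on a sphere about a point of the source then the exterior potential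
is that of a point charge. -/
theorem IsNormalizedSource.potential_eq_of_norm_eq (h : IsNormalizedSource f ρ) (hv : 0 < v)
    (hL : LevelEncloses v (sourceBody f) (newtonianPotential g f ρ)) (h0 : 0 ∈ sourceBody f) {t : ℝ}
    (ht : ∀ x ∈ bagSurface v (sourceBody f) (newtonianPotential g f ρ), ‖x‖ = t) {x : Space3}
    (hx : x ∉ bagInterior v (sourceBody f) (newtonianPotential g f ρ)) :
    newtonianPotential g f ρ x = -(v * t) * ‖x‖⁻¹ := by
  have hΩo := h.isOpen_bagInterior hL
  have hfr := h.frontier_bagInterior hv hL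
  have hcont := h.continuousOn_potential (g := g) (v := v)
  have hharm := h.harmonicOnNhd_exterior (g := g) (v := v)
  have hlim := h.tendsto_potential g
  set φ := newtonianPotential g f ρ
  set Ω := bagInterior v (sourceBody f) φ
  have hne : ∀ y, y ∉ Ω → y ≠ 0 := fun y hy hy0 => hy (Or.inl (hy0 ▸ h0))
  -- The difference from a point charge is harmonic outside, because the pole lies in the source. It
  -- vanishes on the surface and at infinity, and the exterior principle applies to `u` and to `-u`.
  let u : Space3 → ℝ := φ + (v * t) • fun y : Space3 => ‖y‖⁻¹
  have huc : ContinuousOn u Ωᶜ := hcont.add ((continuous_norm.continuousOn.inv₀ fun y hy =>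
    norm_ne_zero_iff.2 (hne y hy)).const_smul _)
  have huh : InnerProductSpace.HarmonicOnNhd u (closure Ω)ᶜ := hharm.add
    (InnerProductSpace.HarmonicOnNhd.const_smul fun y hy =>
      harmonicAt_inv_norm (hne y fun hyΩ => hy (subset_closure hyΩ)))
  have hul : Tendsto u (cocompact Space3) (𝓝 0) := by
    have h1 : Tendsto (fun y : Space3 => ‖y‖⁻¹) (cocompact Space3) (𝓝 0) :=
      tendsto_inv_atTop_zero.comp tendsto_norm_cocompact_atTop
    have h2 := hlim.add (h1.const_smul (v * t))
    rw [smul_zero, add_zero] at h2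
    exact h2
  have hu0 : ∀ y ∈ frontier Ω, u y = 0 := fun y hy => by
    have hyΩ : y ∉ Ω := fun hyΩ => (hΩo.frontier_eq ▸ hy).2 hyΩ
    rw [hfr] at hy
    have h1 : ‖y‖ ≠ 0 := norm_ne_zero_iff.2 (hne y hyΩ)
    simp only [u, Pi.add_apply, Pi.smul_apply, smul_eq_mul, hy.2, ← ht y hy]
    field_simp
    ring
  have h1 : u x ≤ 0 := huh.nonpos_of_exterior hΩo huc hul (fun y hy => (hu0 y hy).le) hx
  have h2 : (-u) x ≤ 0 := huh.neg.nonpos_of_exterior hΩo huc.neg (neg_zero (G := ℝ) ▸ hul.neg)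
    (fun y hy => by simp [hu0 y hy]) hx
  have h3 : u x = 0 := le_antisymm h1 (by simpa using h2)
  simp only [u, Pi.add_apply, Pi.smul_apply, smul_eq_mul] at h3
  linarith

open Laplacian in
theorem laplacian_coord_sq (i : Fin 3) (x : Space3) : Δ (fun y : Space3 => y i ^ 2) x = 2 := by
  let ℓ : Space3 →L[ℝ] ℝ := EuclideanSpace.proj i
  let u : Space3 → ℝ := ℓ
  let b := EuclideanSpace.basisFun (Fin 3) ℝ
  have h1 := laplacian_comp (h := fun s : ℝ => s ^ 2) (u := u) (x := x) (by fun_prop)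
    ℓ.contDiff.contDiffAt
  have h2 : ‖gradient u x‖ ^ 2 = 1 := by
    rw [norm_gradient_sq_eq_sum b, ℓ.fderiv]
    simp [ℓ, b, EuclideanSpace.basisFun_apply]
  have h3 : Δ u x = 0 := by
    have e : fderiv ℝ u = fun _ => ℓ := by ext1 y; exact ℓ.fderiv
    rw [laplacian_eq_sum_fderiv_fderiv b, e]
    simp
  rw [h2, h3] at h1
  have h4 : deriv (fun s : ℝ => s ^ 2) = fun s => 2 * s := by ext s; simp
  rw [h4] at h1
  have h5 : deriv (fun s : ℝ => 2 * s) (u x) = 2 := by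
    simp
  rw [h5] at h1
  simpa [u, ℓ] using h1

-- The source equation is tested against a cut-off of the harmonic polynomial `y i ^ 2 - y j ^ 2`.
-- The Laplacian of the test function lives only where `φ` is the potential of a charge at the
-- origin, so the outcome is proportional to the polynomial's value there, which is zero.
open Laplacian in
theorem IsNormalizedSource.quadrupole_eq_zero (h : IsNormalizedSource f ρ) (hg : 0 < g)
    (hv : 0 < v) (hL : LevelEncloses v (sourceBody f) (newtonianPotential g f ρ))
    (h0 : 0 ∈ sourceBody f) {t : ℝ}
    (ht : ∀ x ∈ bagSurface v (sourceBody f) (newtonianPotential g f ρ), ‖x‖ = t) (i j : Fin 3) :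
    ∫ y in unitBall3, ρ y * (f y i ^ 2 - f y j ^ 2) = 0 := by
  have hφ := fun x hx => h.potential_eq_of_norm_eq hv hL h0 ht (x := x) hx
  obtain ⟨R₀, hR₀⟩ := (h.isBounded_bagInterior (g := g) hv).subset_closedBall (0 : Space3)
  let R := max R₀ 0 + 1
  have hR : 0 < R := by positivity
  have hΩR : ∀ x ∈ bagInterior v (sourceBody f) (newtonianPotential g f ρ), ‖x‖ < R :=
    fun x hx => by
      have h1 : ‖x‖ ≤ R₀ := by simpa using hR₀ hx
      linarith [le_max_left R₀ 0]
  let p : Space3 → ℝ := (fun y => y i ^ 2) + (-1 : ℝ) • fun y => y j ^ 2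
  have hpi : ∀ i : Fin 3, ContDiff ℝ 2 fun y : Space3 => y i ^ 2 := fun i => by fun_prop
  have hpj : ContDiff ℝ 2 ((-1 : ℝ) • fun y : Space3 => y j ^ 2) :=
    (contDiff_const (c := (-1 : ℝ))).mul (hpi j)
  have hp : ContDiff ℝ 2 p := (hpi i).add hpj
  have hΔp : ∀ x, Δ p x = 0 := fun x => by
    rw [ContDiffAt.laplacian_add (hpi i).contDiffAt hpj.contDiffAt,
      InnerProductSpace.laplacian_smul _ (hpi j).contDiffAt, laplacian_coord_sq,
      laplacian_coord_sq]
    norm_num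
  obtain ⟨χ, hχ, hχs, hχ1⟩ : ∃ χ : Space3 → ℝ, ContDiff ℝ 2 χ ∧ HasCompactSupport χ ∧
      ∀ y, ‖y‖ < R → χ y = p y := by
    let b : ContDiffBump (0 : Space3) := ⟨R, R + 1, hR, by linarith⟩
    exact ⟨fun y => b y * p y, b.contDiff.mul hp, b.hasCompactSupport.mul_right, fun y hy => by
      beta_reduce
      rw [b.one_of_mem_closedBall (by simpa [b] using hy.le), one_mul]⟩
  have hχΔ : ∀ x, ‖x‖ < R → Δ χ x = 0 := fun x hx => by
    have e : χ =ᶠ[𝓝 x] p := by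
      filter_upwards [Metric.isOpen_ball.mem_nhds (mem_ball_zero_iff.2 hx)] with y hy
      exact hχ1 y (mem_ball_zero_iff.1 hy)
    rw [(InnerProductSpace.laplacian_congr_nhds e).eq_of_nhds, hΔp]
  have h1 := h.integral_potential_mul_laplacian g hχ hχs
  have h2 := integral_inv_norm_sub_mul_laplacian hχ hχs 0
  have h3 : ∫ x, newtonianPotential g f ρ x * Δ χ x =
      ∫ x, -(v * t) * (‖x - 0‖⁻¹ * Δ χ x) := by
    refine integral_congr_ae (Eventually.of_forall fun x => ?_)
    by_cases hx : ‖x‖ < R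
    · simp only [hχΔ x hx, mul_zero]
    · simp only [hφ x fun hxΩ => hx (hΩR x hxΩ), sub_zero, mul_assoc]
  have h4 : χ 0 = 0 := by rw [hχ1 0 (by simpa using hR)]; simp [p]
  rw [h3, integral_const_mul, h2, h4, mul_zero, mul_zero] at h1
  have h5 : ∫ y in unitBall3, ρ y * χ (f y) = 0 := by
    have : 4 * π * g ≠ 0 := by positivity
    exact (mul_eq_zero_iff_left this).1 h1.symm
  rw [← h5]
  refine setIntegral_congr_fun measurableSet_unitBall3 fun y hy => ?_
  rw [hχ1 _ (hΩR _ (Or.inl (mem_image_of_mem f hy)))]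
  simp only [p, Pi.add_apply, Pi.smul_apply, smul_eq_mul]
  ring

end quadrupole

/-! ### Similarities of centrally symmetric sets. -/

section similarity

/-- Any two points of `S` have norms whose ratio is at most `c`. -/
def NormRatioLE (S : Set Space3) (c : ℝ) : Prop := ∀ x ∈ S, ∀ y ∈ S, ‖x‖ ≤ c * ‖y‖

/-- A similarity between bounded centrally symmetric sets fixes the centre. -/
theorem similarity_map_zero {S T : Set Space3} (hS : ∀ x ∈ S, -x ∈ S) (hT : ∀ x ∈ T, -x ∈ T)
    (hne : S.Nonempty) (hTb : Bornology.IsBounded T) {r : ℝ} {e : Space3 → Space3} (hr : 0 < r)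
    (he : ∀ x y, dist (e x) (e y) = r * dist x y) (heST : e '' S = T) : e 0 = 0 := by
  have hi : Isometry fun x => r⁻¹ • e x := Isometry.of_dist_eq fun x y => by
    rw [dist_smul₀, he, norm_inv, Real.norm_of_nonneg hr.le, ← mul_assoc, inv_mul_cancel₀ hr.ne',
      one_mul]
  -- The rescaled map is an isometry into a strictly convex space, hence affine, and affine maps
  -- preserve midpoints.
  have hmid : ∀ x, e (-x) + e x = (2 : ℝ) • e 0 := fun x => by
    have h1 := hi.affineIsometryOfStrictConvexSpace.map_vadd 0 x
    have h2 := hi.affineIsometryOfStrictConvexSpace.map_vadd 0 (-x)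
    simp only [Isometry.coe_affineIsometryOfStrictConvexSpace, vadd_eq_add, add_zero, map_neg]
      at h1 h2
    have h3 : r⁻¹ • (e (-x) + e x) = r⁻¹ • ((2 : ℝ) • e 0) := by
      rw [smul_add, h1, h2, smul_comm, two_smul]; abel
    exact smul_right_injective _ (inv_ne_zero hr.ne') h3
  -- `T` is symmetric about `0` and about `e 0`. Composing the two reflections translates by `2 • e
  -- 0`, impossible for a nonempty bounded set unless `e 0 = 0`.
  have hstep : ∀ y ∈ T, y - (2 : ℝ) • e 0 ∈ T := fun y hy => by
    obtain ⟨x, hx, rfl⟩ := heST ▸ hy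
    have h1 : -(e (-x)) ∈ T := hT _ (heST ▸ mem_image_of_mem e (hS x hx))
    rwa [← hmid x, sub_add_cancel_right]
  obtain ⟨x, hx⟩ := hne
  have hiter : ∀ n : ℕ, e x - (n : ℝ) • (2 : ℝ) • e 0 ∈ T := fun n => by
    induction n with
    | zero => simpa using heST ▸ mem_image_of_mem e hx
    | succ n ih =>
      have := hstep _ ih
      rw [sub_sub] at this
      rwa [Nat.cast_succ, add_smul, one_smul]
  obtain ⟨C, hC⟩ := hTb.exists_norm_le
  by_contra h0
  have hpos : 0 < ‖e 0‖ := norm_pos_iff.2 h0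
  obtain ⟨n, hn⟩ := exists_nat_gt ((C + ‖e x‖) / ‖e 0‖)
  rw [div_lt_iff₀ hpos] at hn
  have h1 := hC _ (hiter n)
  have h2 : ‖(n : ℝ) • (2 : ℝ) • e 0‖ = n * (2 * ‖e 0‖) := by simp [norm_smul]
  have h3 := norm_sub_norm_le ((n : ℝ) • (2 : ℝ) • e 0) (e x)
  rw [norm_sub_rev, h2] at h3
  nlinarith [mul_nonneg n.cast_nonneg hpos.le]

/-- Once the centre is fixed, every norm is multiplied by the same `r`. Ratios of norms therefore
distinguish shapes. -/
theorem SameShape.normRatioLE_iff {S T : Set Space3} (hST : SameShape S T)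
    (hS : ∀ x ∈ S, -x ∈ S) (hT : ∀ x ∈ T, -x ∈ T) (hne : S.Nonempty)
    (hTb : Bornology.IsBounded T) (c : ℝ) : NormRatioLE S c ↔ NormRatioLE T c := by
  obtain ⟨r, e, hr, he, heST⟩ := hST
  have h0 := similarity_map_zero hS hT hne hTb hr he heST
  have hn : ∀ x, ‖e x‖ = r * ‖x‖ := fun x => by
    have := he x 0
    rwa [h0, dist_zero_right, dist_zero_right] at this
  rw [← heST]
  simp only [NormRatioLE, forall_mem_image, hn]
  refine forall₂_congr fun x _ => forall₂_congr fun y _ => ?_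
  rw [mul_left_comm, mul_le_mul_iff_right₀ hr]

end similarity

/-! ### Homogeneous ellipsoids. -/

section ellipsoid

variable {g v : ℝ}

/-- The linear map stretching the third axis by a factor two. -/
noncomputable def axisStretch : Space3 →L[ℝ] Space3 :=
  LinearMap.toContinuousLinearMap (Matrix.toEuclideanLin (Matrix.diagonal ![1, 1, 2]))

theorem axisStretch_apply_zero (y : Space3) : axisStretch y 0 = y 0 := by
  simp [axisStretch, Matrix.toLpLin_apply, Matrix.mulVec_diagonal]

theorem axisStretch_apply_two (y : Space3) : axisStretch y 2 = 2 * y 2 := by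
  simp [axisStretch, Matrix.toLpLin_apply, Matrix.mulVec_diagonal]

theorem det_axisStretch : axisStretch.det = 2 := by
  have : LinearMap.det (Matrix.toEuclideanLin (Matrix.diagonal ![(1 : ℝ), 1, 2])) = 2 := by
    change LinearMap.det (Matrix.toLpLin 2 2 (Matrix.diagonal ![(1 : ℝ), 1, 2])) = 2
    rw [Matrix.toLpLin_eq_toLin, LinearMap.det_toLin, Matrix.det_diagonal]
    simp [Fin.prod_univ_three]
  simpa [axisStretch, ContinuousLinearMap.det] using this

theorem det_smul_axisStretch (l : ℝ) : (l • axisStretch).det = l ^ 3 * 2 := by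
  have : (l • axisStretch).det = l ^ Module.finrank ℝ Space3 * axisStretch.det := by
    simp [ContinuousLinearMap.det]
  rw [this, det_axisStretch, finrank_space3]

theorem injective_smul_axisStretch {l : ℝ} (hl : 0 < l) :
    Function.Injective fun y => l • axisStretch y := by
  have h1 : IsUnit (LinearMap.det ((l • axisStretch : Space3 →L[ℝ] Space3) : Space3 →ₗ[ℝ] Space3)) :=
    isUnit_iff_ne_zero.2 (by
      change (l • axisStretch).det ≠ 0
      rw [det_smul_axisStretch]; positivity)
  have h2 := (LinearMap.equivOfIsUnitDet h1).injective
  exact fun a b hab => h2 (by simpa using hab)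

theorem volume_real_unitBall3_pos : 0 < volume.real unitBall3 :=
  ENNReal.toReal_pos (Metric.measure_closedBall_pos _ _ one_pos).ne'
    isCompact_unitBall3.measure_lt_top.ne

theorem fderiv_smul_axisStretch (l : ℝ) (y : Space3) :
    fderiv ℝ (fun y => l • axisStretch y) y = l • axisStretch :=
  (l • axisStretch).hasFDerivAt.fderiv

/-- A linear map has constant Jacobian, so the density is uniform at every scale and the small-scale
result for a fixed `ρ` applies. -/
theorem jacobianDensity_smul_axisStretch {l : ℝ} (hl : 0 < l) :
    jacobianDensity (fun y => l • axisStretch y) = fun _ => (volume.real unitBall3)⁻¹ := by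
  ext y
  have hV := volume_real_unitBall3_pos.ne'
  have hd : l ^ 3 * 2 ≠ 0 := by positivity
  simp only [jacobianDensity, fderiv_smul_axisStretch, det_smul_axisStretch, setIntegral_const,
    smul_eq_mul]
  field_simp

theorem isNormalizedSource_axisStretch :
    IsNormalizedSource axisStretch fun _ => (volume.real unitBall3)⁻¹ where
  continuousOn := axisStretch.continuous.continuousOn
  integrableOn := integrableOn_const isCompact_unitBall3.measure_lt_top.ne
  integral_eq_one := by
    rw [setIntegral_const, smul_eq_mul, mul_inv_cancel₀ volume_real_unitBall3_pos.ne']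

theorem neg_mem_unitBall3 {y : Space3} : -y ∈ unitBall3 ↔ y ∈ unitBall3 := by
  simp [unitBall3]

theorem neg_mem_sourceBody {f : Space3 → Space3} (hf : ∀ y, f (-y) = -f y) {x : Space3} :
    -x ∈ sourceBody f ↔ x ∈ sourceBody f := by
  have h : ∀ x, x ∈ sourceBody f → -x ∈ sourceBody f := by
    rintro _ ⟨y, hy, rfl⟩
    exact ⟨-y, neg_mem_unitBall3.2 hy, hf y⟩
  exact ⟨fun hx => by simpa using h _ hx, h x⟩

theorem newtonianPotential_neg {f : Space3 → Space3} (hf : ∀ y, f (-y) = -f y) (c : ℝ)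
    (x : Space3) : newtonianPotential g f (fun _ => c) (-x) =
      newtonianPotential g f (fun _ => c) x := by
  rw [newtonianPotential, newtonianPotential, ← integral_indicator measurableSet_unitBall3,
    ← integral_indicator measurableSet_unitBall3, ← integral_neg_eq_self]
  congr 2
  ext y
  by_cases hy : y ∈ unitBall3
  · rw [indicator_of_mem hy, indicator_of_mem (neg_mem_unitBall3.2 hy), hf, sub_neg_eq_add,
      ← norm_neg]
    congr 2
    abel
  · rw [indicator_of_notMem hy, indicator_of_notMem (neg_mem_unitBall3.not.2 hy)]

theorem neg_mem_bagSurface {f : Space3 → Space3} (hf : ∀ y, f (-y) = -f y) (c : ℝ) {x : Space3}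
    (hx : x ∈ bagSurface v (sourceBody f) (newtonianPotential g f fun _ => c)) :
    -x ∈ bagSurface v (sourceBody f) (newtonianPotential g f fun _ => c) :=
  ⟨(neg_mem_sourceBody hf).not.2 hx.1, (newtonianPotential_neg hf c x).trans hx.2⟩

theorem setIntegral_coord_sq_swap (i j : Fin 3) :
    ∫ y in unitBall3, y i ^ 2 = ∫ y in unitBall3, y j ^ 2 := by
  let e : Space3 ≃ₗᵢ[ℝ] Space3 := LinearIsometryEquiv.piLpCongrLeft 2 ℝ ℝ (Equiv.swap i j)
  have h1 := e.measurePreserving.setIntegral_preimage_emb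
    e.toHomeomorph.measurableEmbedding (fun y : Space3 => y i ^ 2) unitBall3
  have h2 : e ⁻¹' unitBall3 = unitBall3 := by ext y; simp [unitBall3]
  rw [h2] at h1
  rw [← h1]
  refine integral_congr_ae (Eventually.of_forall fun y => ?_)
  simp [e, LinearIsometryEquiv.piLpCongrLeft_apply, Equiv.piCongrLeft'_apply]

theorem setIntegral_coord_sq_pos (i : Fin 3) : 0 < ∫ y in unitBall3, y i ^ 2 := by
  have hc : Continuous fun y : Space3 => y i ^ 2 := by fun_prop
  rw [setIntegral_pos_iff_support_of_nonneg_ae (Eventually.of_forall fun y => sq_nonneg _)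
    (hc.continuousOn.integrableOn_compact isCompact_unitBall3)]
  have ho : IsOpen ((Function.support fun y : Space3 => y i ^ 2) ∩ Metric.ball 0 1) :=
    hc.isOpen_support.inter Metric.isOpen_ball
  refine (ho.measure_pos volume ⟨EuclideanSpace.single i (1 / 2), ?_, ?_⟩).trans_le
    (measure_mono (inter_subset_inter_right _ Metric.ball_subset_closedBall))
  · simp
  · simp; norm_num

/-- The level surface of a homogeneous ellipsoid is not contained in a sphere. -/
theorem not_forall_norm_eq_axisStretch (hg : 0 < g) (hv : 0 < v) {l : ℝ} (hl : 0 < l)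
    (hL : LevelEncloses v (sourceBody fun y => l • axisStretch y)
      (newtonianPotential g (fun y => l • axisStretch y) fun _ => (volume.real unitBall3)⁻¹))
    (t : ℝ) : ∃ x ∈ bagSurface v (sourceBody fun y => l • axisStretch y)
      (newtonianPotential g (fun y => l • axisStretch y) fun _ => (volume.real unitBall3)⁻¹),
      ‖x‖ ≠ t := by
  by_contra! ht
  have h0 : (0 : Space3) ∈ sourceBody fun y => l • axisStretch y :=
    ⟨0, by simp [unitBall3], by simp⟩
  -- By symmetry of the ball all coordinates have equal second moment `m > 0`. The stretch makes
  -- this quadrupole a positive multiple of `m - 4m`, which is not zero.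
  have hq := (isNormalizedSource_axisStretch.const_smul l).quadrupole_eq_zero hg hv hL h0 ht 0 2
  have hi : ∀ i : Fin 3, IntegrableOn (fun y : Space3 => y i ^ 2) unitBall3 := fun i =>
    (by fun_prop : Continuous fun y : Space3 => y i ^ 2).continuousOn.integrableOn_compact
      isCompact_unitBall3
  have h1 : ∀ y : Space3, (l • axisStretch y) 0 ^ 2 - (l • axisStretch y) 2 ^ 2 =
      l ^ 2 * (y 0 ^ 2 - 4 * y 2 ^ 2) := fun y => by
    simp only [PiLp.smul_apply, smul_eq_mul, axisStretch_apply_zero, axisStretch_apply_two]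
    ring
  simp_rw [h1] at hq
  rw [integral_const_mul, integral_const_mul, integral_sub (hi 0) ((hi 2).const_mul 4),
    integral_const_mul, setIntegral_coord_sq_swap 0 2] at hq
  have h2 := setIntegral_coord_sq_pos 2
  have h3 := inv_pos.2 volume_real_unitBall3_pos
  have h4 : 0 < l ^ 2 := by positivity
  nlinarith [mul_pos (mul_pos h3 h4) h2]

end ellipsoid

/-! ### Roundness of the surfaces at small scale. -/

section shapes

variable {g v : ℝ}

/-- The surface lies in the shell of radii `g/v ± lM`. The smallness condition on `l` is `g/v + lM <
c(g/v - lM)` rearranged. -/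
theorem eventually_normRatioLE_axisStretch (hg : 0 < g) (hv : 0 < v) {c : ℝ} (hc : 1 < c) :
    ∀ᶠ l : ℝ in 𝓝[>] 0, NormRatioLE (bagSurface v (sourceBody fun y => l • axisStretch y)
      (newtonianPotential g (fun y => l • axisStretch y) fun _ => (volume.real unitBall3)⁻¹)) c := by
  obtain ⟨M, hM0, hM⟩ := isNormalizedSource_axisStretch.exists_norm_bound
  have hgv : 0 < g / v := div_pos hg hv
  filter_upwards [eventually_mul_lt ((1 + c) * M) (mul_pos (sub_pos.2 hc) hgv),
    self_mem_nhdsWithin] with l hl hl0 x hx y hy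
  have hbd := fun x hx => (isNormalizedSource_axisStretch.const_smul l).norm_mem_of_mem_bagSurface
    hg hv (fun _ _ => (inv_pos.2 volume_real_unitBall3_pos).le)
    (norm_le_of_mem_sourceBody_smul (le_of_lt hl0) hM) (x := x) hx
  have h1 := (hbd x hx).2
  have h2 := (hbd y hy).1
  nlinarith

theorem exists_not_normRatioLE {S : Set Space3} (h : ∀ t : ℝ, ∃ x ∈ S, ‖x‖ ≠ t)
    (h0 : (0 : Space3) ∉ S) : ∃ c > 1, ¬ NormRatioLE S c := by
  obtain ⟨x, hx, -⟩ := h 0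
  obtain ⟨y, hy, hxy⟩ := h ‖x‖
  have key : ∀ a ∈ S, ∀ b ∈ S, ‖a‖ < ‖b‖ → ∃ c > 1, ¬ NormRatioLE S c := fun a ha b hb hab => by
    have ha0 : 0 < ‖a‖ := norm_pos_iff.2 fun h => h0 (h ▸ ha)
    obtain ⟨c, hc1, hc2⟩ := exists_between ((one_lt_div ha0).2 hab)
    exact ⟨c, hc1, fun hS => absurd (hS b hb a ha) (not_le.2 ((lt_div_iff₀ ha0).1 hc2))⟩
  rcases lt_or_gt_of_ne hxy with hlt | hlt
  · exact key y hy x hx hlt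
  · exact key x hx y hy hlt

end shapes

/-! ### Assembly of the three claims. -/

theorem mainTheorem2 (g v : ℝ) (hg : 0 < g) (hv : 0 < v) :
    -- every source enclosed by the level `-v` of its potential gives a bag of mass `4πgv`
    (∀ (f : Space3 → Space3) (ρ : Space3 → ℝ), IsNormalizedSource f ρ →
      ∀ (K S Ω : Set Space3) (φ φH : Space3 → ℝ),
        K = sourceBody f → φ = newtonianPotential g f ρ → φH = (fun x => v + φ x) →
        S = bagSurface v K φ → Ω = bagInterior v K φ →
        SolvesSourceEquation g f ρ φ ∧
        InnerProductSpace.HarmonicOnNhd φ Kᶜ ∧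
        (LevelEncloses v K φ →
          Bounds S Ω ∧
          (LevelRegular v K φ → IsMagneticBag g v S Ω φ φH) ∧
          (∀ x ∉ Ω, gradient φ x = gradient φH x) ∧
          IntegrableOn (energyDensity φ) (closure Ω)ᶜ ∧
          IntegrableOn (energyDensity φH) (closure Ω)ᶜ ∧
          exteriorEnergy Ω φ = 2 * π * g * v ∧
          exteriorEnergy Ω φH = 2 * π * g * v ∧
          bagMass Ω φ φH = 4 * π * g * v)) ∧
    -- a source of one sign does so as soon as it is compact enough
    (∀ (f : Space3 → Space3) (ρ : Space3 → ℝ), IsNormalizedSource f ρ →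
      (∀ y ∈ unitBall3, 0 ≤ ρ y) →
      ∀ᶠ l : ℝ in 𝓝[>] 0,
        LevelEncloses v (sourceBody fun y => l • f y)
          (newtonianPotential g (fun y => l • f y) ρ) ∧
        LevelRegular v (sourceBody fun y => l • f y)
          (newtonianPotential g (fun y => l • f y) ρ)) ∧
    -- infinitely many bags with pairwise different shapes arise
    (∃ (F : ℕ → Space3 → Space3) (φ : ℕ → Space3 → ℝ) (S Ω : ℕ → Set Space3),
      (∀ k, ContDiff ℝ ∞ (F k) ∧ InjOn (F k) unitBall3 ∧
        (∀ y ∈ unitBall3, 0 < (fderiv ℝ (F k) y).det) ∧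
        φ k = newtonianPotential g (F k) (jacobianDensity (F k)) ∧
        S k = bagSurface v (sourceBody (F k)) (φ k) ∧
        Ω k = bagInterior v (sourceBody (F k)) (φ k) ∧
        LevelEncloses v (sourceBody (F k)) (φ k) ∧
        IsMagneticBag g v (S k) (Ω k) (φ k) (fun x => v + φ k x) ∧
        bagMass (Ω k) (φ k) (fun x => v + φ k x) = 4 * π * g * v) ∧
      ∀ j k, j ≠ k → ¬ SameShape (S j) (S k)) := by
  refine ⟨fun f ρ h K S Ω φ φH hK hφ hφH hS hΩ => ⟨?_, ?_, fun hL => ?_⟩,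
    fun f ρ h hρ => h.eventually_encloses_and_regular hg hv hρ, ?_⟩
  · rw [hφ]; exact h.solvesSourceEquation g
  · rw [hφ, hK]; exact h.harmonicOnNhd_potential g
  · exact h.bag_of_encloses hg hv hK hφ hφH hS hΩ hL
  let E : ℝ → Space3 → Space3 := fun l y => l • axisStretch y
  let ψ : ℝ → Space3 → ℝ := fun l =>
    newtonianPotential g (E l) fun _ => (volume.real unitBall3)⁻¹
  let S : ℝ → Set Space3 := fun l => bagSurface v (sourceBody (E l)) (ψ l)
  have hsrc : ∀ l, IsNormalizedSource (E l) fun _ => (volume.real unitBall3)⁻¹ :=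
    fun l => isNormalizedSource_axisStretch.const_smul l
  let P : ℝ → Prop := fun l =>
    0 < l ∧ LevelEncloses v (sourceBody (E l)) (ψ l) ∧ LevelRegular v (sourceBody (E l)) (ψ l)
  have hP : ∀ᶠ l in 𝓝[>] (0 : ℝ), P l := by
    filter_upwards [self_mem_nhdsWithin,
      isNormalizedSource_axisStretch.eventually_encloses_and_regular hg hv
        fun _ _ => (inv_pos.2 volume_real_unitBall3_pos).le] with l h1 h2 using ⟨h1, h2⟩
  have hratio : ∀ l, P l → ∃ c > 1, ¬ NormRatioLE (S l) c := fun l hl => by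
    refine exists_not_normRatioLE (not_forall_norm_eq_axisStretch hg hv hl.1 hl.2.1) fun h0 => ?_
    exact h0.1 ⟨0, by simp [unitBall3], by simp [E]⟩
  -- Scales are chosen recursively. Each earlier surface violates some bound `c > 1`, and every
  -- sufficiently small new scale satisfies all of these finitely many bounds.
  obtain ⟨l, hlP, hlne⟩ := exists_seq_of_forall_finset_exists P
    (fun a b => ∃ c, ¬ NormRatioLE (S a) c ∧ NormRatioLE (S b) c) fun s hs => by
      have h1 : ∀ a ∈ s, ∀ᶠ b in 𝓝[>] (0 : ℝ),
          ∃ c, ¬ NormRatioLE (S a) c ∧ NormRatioLE (S b) c := fun a ha => by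
        obtain ⟨c, hc, hac⟩ := hratio a (hs a ha)
        filter_upwards [eventually_normRatioLE_axisStretch hg hv hc] with b hb using ⟨c, hac, hb⟩
      exact (hP.and ((eventually_all_finset s).2 h1)).exists
  have hshape : ∀ j k, SameShape (S (l j)) (S (l k)) → ∀ c,
      NormRatioLE (S (l j)) c ↔ NormRatioLE (S (l k)) c := fun j k hjk c => by
    have hsymm : ∀ j, ∀ x ∈ S (l j), -x ∈ S (l j) := fun j x hx =>
      neg_mem_bagSurface (fun y => by simp [E]) _ hx
    obtain ⟨x, hx, -⟩ := not_forall_norm_eq_axisStretch hg hv (hlP j).1 (hlP j).2.1 0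
    have hB := (hsrc (l k)).bounds hv (hlP k).2.1
    have hSb := hB.isBounded.closure.subset frontier_subset_closure
    rw [hB.frontier_eq] at hSb
    exact hjk.normRatioLE_iff (hsymm j) (hsymm k) ⟨x, hx⟩ hSb c
  refine ⟨fun k => E (l k), fun k => ψ (l k), fun k => S (l k),
    fun k => bagInterior v (sourceBody (E (l k))) (ψ (l k)), fun k => ?_, fun j k hjk hss => ?_⟩
  · obtain ⟨h0, hL, hreg⟩ := hlP k
    refine ⟨(l k • axisStretch).contDiff, (injective_smul_axisStretch h0).injOn, fun y _ => ?_, ?_,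
      rfl, rfl, hL, (hsrc _).isMagneticBag hg hv hL hreg, (hsrc _).bagMass_eq hg hv hL⟩
    · rw [fderiv_smul_axisStretch, det_smul_axisStretch]; positivity
    · rw [jacobianDensity_smul_axisStretch h0]
  · rcases lt_or_gt_of_ne hjk with hlt | hlt
    · obtain ⟨c, h1, h2⟩ := hlne j k hlt
      exact h1 ((hshape j k hss c).2 h2)
    · obtain ⟨c, h1, h2⟩ := hlne k j hlt
      exact h1 ((hshape j k hss c).1 h2)
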